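/- Let $\Omega\subset\mathbb R^2$ be a domain (open and connected), $u\in C^1(\Omega)$ real-valued, $\vec F=(F_1,F_2)\in C^1(\Omega;\mathbb R^2)$ and $H\in C^0(\Omega)$. Suppose that $\Omega$ is nonsingular for $u$, i.e. $\nabla u+\vec F\neq 0$ everywhere in $\Omega$, and put $$D=|\nabla u+\vec F|,\qquad N=N^u=\frac{\nabla u+\vec F}{|\nabla u+\vec F|},\qquad N^\perp=(N_2,-N_1),\qquad \operatorname{rot}\vec F=(F_2)_x-(F_1)_y .$$ Integral curves of $N^\perp$ are called characteristic curves and integral curves of $N$ are called seed curves. For a real function $h$ on $\Omega$, $(N^\perp h)(p)$ (respectively $(Nh)(p)$) denotes the derivative of $h$ at $p$ along the characteristic (respectively seed) curves through $p$, if it exists. Suppose that $u$ is a weak solution of $\operatorname{div}N^u=H$ in $\Omega$, i.e. $$\int_\Omega N\cdot\nabla\varphi+\int_\Omega H\varphi=0\qquad\text{for all }\varphi\in C_0^\infty(\Omega),$$ and that $N(H)$ exists and is continuous in $\Omega$. Then: 1. Near every point of $\Omega$ there is a continuous function $\theta$ with $N=(\cos\theta,\sin\theta)$, and every continuous $\theta$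 with this property on an open subset of $\Omega$ is of class $C^1$ there. In particular $N\in C^1(\Omega)$. 2. Through every point of $\Omega$ pass a characteristic curve and a seed curve, and all characteristic curves and all seed curves in $\Omega$ are of class $C^2$. 3. $N^\perp D$ and $N^\perp(\log D)$ exist and are continuous in $\Omega$. 4. Near every point of $\Omega$ there are characteristic coordinates, i.e. a $C^1$ diffeomorphism $(x,y)\mapsto(s,t)$ from an open subset of $\Omega$ onto an open subset of $\mathbb R^2$ such that $\nabla s=fN^\perp$ and $\nabla t=gDN$ for some positive continuous functions $f,g$. In any such coordinates, wherever a continuous $\theta$ with $N=(\cos\theta,\sin\theta)$ is defined, $$\theta_t\equiv\frac{\partial\theta}{\partial t}=\frac{\operatorname{rot}\vec F}{gD^2}-\frac{N^\perp(\log D)}{gD}=\frac{1}{gD^2}\bigl(\operatorname{rot}\vec F-N^\perp D\bigr).$$ -/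

import Mathlib

open Set MeasureTheory
open scoped ContDiff

noncomputable section

/-- The Euclidean plane with coordinates `(x, y)`. Lengths and inner products of vectors are
written out in coordinates, so the sup norm of `ℝ × ℝ` never enters. -/
abbrev Plane : Type := ℝ × ℝ

/-- The Euclidean inner product of two plane vectors. -/
def dotP (v w : Plane) : ℝ := v.1 * w.1 + v.2 * w.2

/-- The Euclidean length of a plane vector. -/
def lenP (v : Plane) : ℝ := Real.sqrt (v.1 ^ 2 + v.2 ^ 2)

/-- Rotation by `-π/2`: `(v₁, v₂) ↦ (v₂, -v₁)`. -/
def perpP (v : Plane) : Plane := (v.2, -v.1)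

/-- The gradient `(u_x, u_y)`. -/
def gradP (u : Plane → ℝ) (p : Plane) : Plane :=
  (fderiv ℝ u p (1, 0), fderiv ℝ u p (0, 1))

/-- `rot F = (F₂)_x - (F₁)_y`. -/
def rotP (F : Plane → Plane) (p : Plane) : ℝ :=
  (fderiv ℝ F p (1, 0)).2 - (fderiv ℝ F p (0, 1)).1

/-- The vector field `∇u + F`. -/
def shiftedGrad (u : Plane → ℝ) (F : Plane → Plane) (p : Plane) : Plane := gradP u p + F p

/-- `D = |∇u + F|`. -/
def lenD (u : Plane → ℝ) (F : Plane → Plane) (p : Plane) : ℝ := lenP (shiftedGrad u F p)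

/-- The Legendrian normal `N^u = (∇u + F) / |∇u + F|`. -/
def normalN (u : Plane → ℝ) (F : Plane → Plane) (p : Plane) : Plane :=
  (lenD u F p)⁻¹ • shiftedGrad u F p

/-- The rotated normal `N^⊥`. -/
def normalPerp (u : Plane → ℝ) (F : Plane → Plane) (p : Plane) : Plane :=
  perpP (normalN u F p)

/-- `Ω` is nonsingular for `u`: the singular set `{∇u + F = 0}` does not meet `Ω`. -/
def Nonsingular (Ω : Set Plane) (u : Plane → ℝ) (F : Plane → Plane) : Prop :=
  ∀ p ∈ Ω, shiftedGrad u F p ≠ 0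

/-- `φ ∈ C₀^∞(Ω)`. -/
def IsTestFun (Ω : Set Plane) (φ : Plane → ℝ) : Prop :=
  ContDiff ℝ ∞ φ ∧ HasCompactSupport φ ∧ tsupport φ ⊆ Ω

/-- `u` solves `div N^u = H` weakly in the nonsingular domain `Ω`. -/
def IsWeakSolution (Ω : Set Plane) (u : Plane → ℝ) (F : Plane → Plane) (H : Plane → ℝ) : Prop :=
  ∀ φ : Plane → ℝ, IsTestFun Ω φ →
    (∫ p in Ω, dotP (normalN u F p) (gradP φ p)) + (∫ p in Ω, H p * φ p) = 0

/-- `γ`, on the open interval `(a, b)`, is an integral curve of `V` lying in `Ω`. -/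
def IsCurveIn (V : Plane → Plane) (Ω : Set Plane) (γ : ℝ → Plane) (a b : ℝ) : Prop :=
  IsIntegralCurveOn γ (fun _ => V) (Ioo a b) ∧ MapsTo γ (Ioo a b) Ω

/-- Characteristic curves: the integral curves of `N^⊥`. -/
def IsCharCurve (Ω : Set Plane) (u : Plane → ℝ) (F : Plane → Plane) (γ : ℝ → Plane)
    (a b : ℝ) : Prop :=
  IsCurveIn (normalPerp u F) Ω γ a b

/-- Seed curves: the integral curves of `N`. -/
def IsSeedCurve (Ω : Set Plane) (u : Plane → ℝ) (F : Plane → Plane) (γ : ℝ → Plane)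
    (a b : ℝ) : Prop :=
  IsCurveIn (normalN u F) Ω γ a b

/-- `(Vh)(p)` exists and equals `d`: along every integral curve of `V` in `Ω` through `p`
the function `h` has derivative `d` at `p`. (Through each point of an open set passes
an integral curve of a continuous field.) -/
def HasDerivAlong (V : Plane → Plane) (Ω : Set Plane) (h : Plane → ℝ) (p : Plane) (d : ℝ) : Prop :=
  ∀ (γ : ℝ → Plane) (a b τ : ℝ), IsCurveIn V Ω γ a b → τ ∈ Ioo a b → γ τ = p →
    HasDerivAt (fun r => h (γ r)) d τ

/-- `Vh` exists in `Ω`, equals `k` there, and is continuous. -/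
def HasContDerivAlong (V : Plane → Plane) (Ω : Set Plane) (h k : Plane → ℝ) : Prop :=
  ContinuousOn k Ω ∧ ∀ p ∈ Ω, HasDerivAlong V Ω h p (k p)

/-- `θ` is a continuous angle function on `U`: `N^u = (cos θ, sin θ)` on `U`. -/
def IsAngleOn (u : Plane → ℝ) (F : Plane → Plane) (U : Set Plane) (θ : Plane → ℝ) : Prop :=
  ContinuousOn θ U ∧ ∀ p ∈ U, normalN u F p = (Real.cos (θ p), Real.sin (θ p))

/-- Characteristic coordinates `Ψ = (s, t)` on an open part of `Ω` (the source of `Ψ`): `Ψ` is a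
`C¹` diffeomorphism onto an open set, and `∇s = f N^⊥`, `∇t = g D N` with `f`, `g` continuous and
positive. -/
structure IsCharCoords (Ω : Set Plane) (u : Plane → ℝ) (F : Plane → Plane)
    (Ψ : OpenPartialHomeomorph Plane Plane) (f g : Plane → ℝ) : Prop where
  source_subset : Ψ.source ⊆ Ω
  contDiffOn : ContDiffOn ℝ 1 Ψ Ψ.source
  contDiffOn_symm : ContDiffOn ℝ 1 Ψ.symm Ψ.target
  f_cont : ContinuousOn f Ψ.source
  g_cont : ContinuousOn g Ψ.source
  f_pos : ∀ p ∈ Ψ.source, 0 < f p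
  g_pos : ∀ p ∈ Ψ.source, 0 < g p
  grad_s : ∀ p ∈ Ψ.source, gradP (fun q => (Ψ q).1) p = f p • normalPerp u F p
  grad_t : ∀ p ∈ Ψ.source, gradP (fun q => (Ψ q).2) p = (g p * lenD u F p) • normalN u F p

end

/-!
The field `N` has divergence `H` and `D N^⊥` has divergence `rot F`, in the strong sense that both
are locally uniform limits of `C¹` fields whose divergences converge uniformly (mollify), so the
divergence theorem holds on curvilinear patches. Since no unit field has a larger flux through a
characteristic curve than `N`, translating the curve shows that `N` is differentiable along it with
`N' = H N^⊥`. A nonvanishing continuous field with continuous divergence has a `C¹` first integral: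
conservation of flux between its Peano trajectories makes them unique and differentiable in their
initial position. The first integrals `s` of `N` and `t` of `D N^⊥` are characteristic coordinates.
In them the position `φ` and the normal `n` satisfy `φ_s = -i ε n` and `n_s = -i η n`, where `ε` and
`η` are differentiable in `t`, the latter because `N(H)` exists; this system makes `n`
differentiable in `t`, so `N` is `C¹`. Then `N^⊥` has a first integral of its own with a factor `G`;
comparing it with `t` shows that `D` is a constant multiple of `G / g` on each characteristic curve.
-/

section Development

open Filter Topology

/-! ### Integrals of continuous functions -/

section ParametricIntegral

variable {α E : Type*} [NormedAddCommGroup E]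

lemma intervalIntegrable_slice_snd [TopologicalSpace α] {S : Set α} {c d : ℝ} {f : α × ℝ → E}
    (hf : ContinuousOn f (S ×ˢ uIcc c d)) {s : α} (hs : s ∈ S) :
    IntervalIntegrable (fun r => f (s, r)) volume c d :=
  (hf.comp (by fun_prop) fun _ hr => ⟨hs, hr⟩).intervalIntegrable

lemma intervalIntegrable_slice_fst [TopologicalSpace α] {S : Set α} {a b : ℝ} {f : ℝ × α → E}
    (hf : ContinuousOn f (uIcc a b ×ˢ S)) {r : α} (hr : r ∈ S) :
    IntervalIntegrable (fun s => f (s, r)) volume a b :=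
  (hf.comp (by fun_prop) fun _ hs => ⟨hs, hr⟩).intervalIntegrable

variable [NormedSpace ℝ E]

lemma continuousOn_intervalIntegral_param [TopologicalSpace α] {S : Set α} {c d : ℝ}
    {f : α × ℝ → E} (hf : ContinuousOn f (S ×ˢ uIcc c d)) :
    ContinuousOn (fun s => ∫ r in c..d, f (s, r)) S := by
  let clamp : ℝ → ℝ := fun r => projIcc (min c d) (max c d) min_le_max r
  have hclamp : Continuous clamp := continuous_subtype_val.comp continuous_projIcc
  have hcont : Continuous fun z : S × ℝ => f (z.1, clamp z.2) :=
    hf.comp_continuous (by fun_prop) fun z => ⟨z.1.2, Subtype.coe_prop _⟩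
  rw [continuousOn_iff_continuous_domRestrict]
  refine (intervalIntegral.continuous_parametric_intervalIntegral_of_continuous'
    (μ := volume) (f := fun (s : S) r => f (s, clamp r)) hcont c d).congr fun s => ?_
  refine intervalIntegral.integral_congr fun r hr => ?_
  simp only [clamp, projIcc_of_mem min_le_max hr]

lemma integral_swap_of_continuousOn {a b c d : ℝ} {f : ℝ × ℝ → E}
    (hf : ContinuousOn f (uIcc a b ×ˢ uIcc c d)) :
    ∫ s in a..b, ∫ r in c..d, f (s, r) = ∫ r in c..d, ∫ s in a..b, f (s, r) :=
  intervalIntegral_intervalIntegral_swap (F := fun s r => f (s, r)) <|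
    (hf.integrableOn_compact (isCompact_uIcc.prod isCompact_uIcc)).mono_set
      (prod_mono uIoc_subset_uIcc uIoc_subset_uIcc)

lemma integral_integral_sub_eq_boundary {a b c d : ℝ} {p q P Q : ℝ × ℝ → ℝ}
    (hP : ContinuousOn P (uIcc a b ×ˢ uIcc c d)) (hQ : ContinuousOn Q (uIcc a b ×ˢ uIcc c d))
    (hp : ∀ s ∈ uIcc a b, ∀ r ∈ uIcc c d, HasDerivAt (fun r => p (s, r)) (P (s, r)) r)
    (hq : ∀ s ∈ uIcc a b, ∀ r ∈ uIcc c d, HasDerivAt (fun s => q (s, r)) (Q (s, r)) s) :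
    ∫ s in a..b, ∫ r in c..d, (P (s, r) - Q (s, r)) =
      (∫ s in a..b, (p (s, d) - p (s, c))) - ∫ r in c..d, (q (b, r) - q (a, r)) := by
  calc ∫ s in a..b, ∫ r in c..d, (P (s, r) - Q (s, r))
      = ∫ s in a..b, ((∫ r in c..d, P (s, r)) - ∫ r in c..d, Q (s, r)) :=
        intervalIntegral.integral_congr fun s hs => intervalIntegral.integral_sub
          (intervalIntegrable_slice_snd hP hs) (intervalIntegrable_slice_snd hQ hs)
    _ = (∫ s in a..b, ∫ r in c..d, P (s, r)) - ∫ r in c..d, ∫ s in a..b, Q (s, r) := by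
        rw [intervalIntegral.integral_sub
          (continuousOn_intervalIntegral_param hP).intervalIntegrable
          (continuousOn_intervalIntegral_param hQ).intervalIntegrable,
          integral_swap_of_continuousOn hQ]
    _ = _ := by
        congr 1
        · exact intervalIntegral.integral_congr fun s hs =>
            intervalIntegral.integral_eq_sub_of_hasDerivAt (hp s hs)
              (intervalIntegrable_slice_snd hP hs)
        · exact intervalIntegral.integral_congr fun r hr =>
            intervalIntegral.integral_eq_sub_of_hasDerivAt (fun s hs => hq s hs r hr)
              (intervalIntegrable_slice_fst hQ hr)

lemma tendstoUniformlyOn_intervalIntegral {ι : Type*} {l : Filter ι} {S : Set α} {c d : ℝ}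
    {f : ι → α × ℝ → E} {g : α × ℝ → E} (h : TendstoUniformlyOn f g l (S ×ˢ uIcc c d))
    (hf : ∀ i, ∀ s ∈ S, IntervalIntegrable (fun r => f i (s, r)) volume c d)
    (hg : ∀ s ∈ S, IntervalIntegrable (fun r => g (s, r)) volume c d) :
    TendstoUniformlyOn (fun i s => ∫ r in c..d, f i (s, r)) (fun s => ∫ r in c..d, g (s, r))
      l S := by
  rw [Metric.tendstoUniformlyOn_iff] at h ⊢
  intro ε hε
  have hη : 0 < ε / (|d - c| + 1) := by positivity
  filter_upwards [h _ hη] with i hi s hs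
  rw [dist_eq_norm, ← intervalIntegral.integral_sub (hg s hs) (hf i s hs)]
  calc ‖∫ r in c..d, (g (s, r) - f i (s, r))‖
      ≤ ε / (|d - c| + 1) * |d - c| :=
        intervalIntegral.norm_integral_le_of_norm_le_const fun r hr => by
          rw [← dist_eq_norm]
          exact (hi (s, r) ⟨hs, uIoc_subset_uIcc hr⟩).le
    _ < ε / (|d - c| + 1) * (|d - c| + 1) := by gcongr; linarith
    _ = ε := by field_simp

lemma tendsto_intervalIntegral_of_tendstoUniformlyOn {ι : Type*} {l : Filter ι} {a b : ℝ}
    {f : ι → ℝ → E} {g : ℝ → E} (h : TendstoUniformlyOn f g l (uIcc a b))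
    (hf : ∀ i, IntervalIntegrable (f i) volume a b) (hg : IntervalIntegrable g volume a b) :
    Tendsto (fun i => ∫ s in a..b, f i s) l (𝓝 (∫ s in a..b, g s)) :=
  (tendstoUniformlyOn_intervalIntegral (S := univ) (f := fun i (z : Unit × ℝ) => f i z.2)
    (g := fun z => g z.2) ((h.comp Prod.snd).mono fun _ hz => hz.2) (fun i _ _ => hf i)
    fun _ _ => hg).tendsto_at (mem_univ ())

end ParametricIntegral

lemma tendstoUniformlyOn_mul_right {α ι : Type*} {l : Filter ι} {f : ι → α → ℝ} {g k : α → ℝ}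
    {S : Set α} (h : TendstoUniformlyOn f g l S) {B : ℝ} (hk : ∀ x ∈ S, |k x| ≤ B) :
    TendstoUniformlyOn (fun i x => f i x * k x) (fun x => g x * k x) l S := by
  rw [Metric.tendstoUniformlyOn_iff] at h ⊢
  intro ε hε
  have hη : 0 < ε / (|B| + 1) := by positivity
  filter_upwards [h _ hη] with i hi x hx
  rw [Real.dist_eq, ← sub_mul, abs_mul, ← Real.dist_eq]
  calc dist (g x) (f i x) * |k x| ≤ ε / (|B| + 1) * |B| :=
        mul_le_mul (hi x hx).le ((hk x hx).trans (le_abs_self B)) (abs_nonneg _) hη.le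
    _ < ε / (|B| + 1) * (|B| + 1) := by gcongr; linarith
    _ = ε := by field_simp

lemma hasDerivAt_fst {c : ℝ → Plane} {c' : Plane} {s : ℝ} (h : HasDerivAt c c' s) :
    HasDerivAt (fun x => (c x).1) c'.1 s :=
  (hasFDerivAt_fst (𝕜 := ℝ) (E := ℝ) (F := ℝ)).comp_hasDerivAt s h

lemma hasDerivAt_snd {c : ℝ → Plane} {c' : Plane} {s : ℝ} (h : HasDerivAt c c' s) :
    HasDerivAt (fun x => (c x).2) c'.2 s :=
  (hasFDerivAt_snd (𝕜 := ℝ) (E := ℝ) (F := ℝ)).comp_hasDerivAt s h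

/-! ### Area forms, fluxes and divergences in the plane -/

/-- The oriented area spanned by two plane vectors. -/
def wedgeP (v w : Plane) : ℝ := v.1 * w.2 - v.2 * w.1

lemma continuousOn_wedgeP {α : Type*} [TopologicalSpace α] {f g : α → Plane} {s : Set α}
    (hf : ContinuousOn f s) (hg : ContinuousOn g s) :
    ContinuousOn (fun x => wedgeP (f x) (g x)) s := by
  unfold wedgeP; fun_prop

lemma continuousOn_perpP {α : Type*} [TopologicalSpace α] {f : α → Plane} {s : Set α}
    (hf : ContinuousOn f s) : ContinuousOn (fun x => perpP (f x)) s := by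
  unfold perpP; fun_prop

lemma hasDerivAt_wedgeP {f g : ℝ → Plane} {f' g' : Plane} {x : ℝ}
    (hf : HasDerivAt f f' x) (hg : HasDerivAt g g' x) :
    HasDerivAt (fun x => wedgeP (f x) (g x)) (wedgeP f' (g x) + wedgeP (f x) g') x := by
  refine (((hasDerivAt_fst hf).mul (hasDerivAt_snd hg)).sub
    ((hasDerivAt_snd hf).mul (hasDerivAt_fst hg))).congr_deriv ?_
  simp only [wedgeP]
  ring

lemma tendstoUniformlyOn_wedgeP {α ι : Type*} {l : Filter ι} {f : ι → α → Plane}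
    {g k : α → Plane} {S : Set α} (h : TendstoUniformlyOn f g l S) {B : ℝ}
    (hk : ∀ x ∈ S, ‖k x‖ ≤ B) :
    TendstoUniformlyOn (fun i x => wedgeP (f i x) (k x)) (fun x => wedgeP (g x) (k x)) l S :=
  (tendstoUniformlyOn_mul_right (uniformContinuous_fst.comp_tendstoUniformlyOn h)
    fun x hx => (norm_snd_le _).trans (hk x hx)).sub
  (tendstoUniformlyOn_mul_right (uniformContinuous_snd.comp_tendstoUniformlyOn h)
    fun x hx => (norm_fst_le _).trans (hk x hx))

lemma apply_eq_smul_add_smul {E : Type*} [NormedAddCommGroup E] [NormedSpace ℝ E]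
    (A : Plane →L[ℝ] E) (v : Plane) : A v = v.1 • A (1, 0) + v.2 • A (0, 1) := by
  rw [← map_smul, ← map_smul, ← map_add]
  congr 1
  ext <;> simp

/-- The divergence of a plane vector field. -/
noncomputable def divP (X : Plane → Plane) (p : Plane) : ℝ :=
  (fderiv ℝ X p (1, 0)).1 + (fderiv ℝ X p (0, 1)).2

lemma wedgeP_fderiv_sub (X : Plane → Plane) (p v w : Plane) :
    wedgeP (fderiv ℝ X p v) w - wedgeP (fderiv ℝ X p w) v = divP X p * wedgeP v w := by
  rw [apply_eq_smul_add_smul _ v, apply_eq_smul_add_smul _ w]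
  simp only [divP, wedgeP, Prod.fst_add, Prod.snd_add, Prod.smul_fst, Prod.smul_snd, smul_eq_mul]
  ring

lemma continuousOn_divP {Ω : Set Plane} (hΩ : IsOpen Ω) {X : Plane → Plane}
    (hX : ContDiffOn ℝ 1 X Ω) : ContinuousOn (divP X) Ω := by
  have := hX.continuousOn_fderiv_of_isOpen hΩ le_rfl
  unfold divP
  fun_prop

/-- The flux of the field `X` through a curve `c` with velocity `c'`. -/
noncomputable def fluxP (X : Plane → Plane) (c c' : ℝ → Plane) (a b : ℝ) : ℝ :=
  ∫ s in a..b, wedgeP (X (c s)) (c' s)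

section Patch

variable {c w c' w' : ℝ → Plane} {a b : ℝ}

lemma continuousOn_patch {E : Type*} [NormedAddCommGroup E] [NormedSpace ℝ E] {c w : ℝ → E}
    {S T : Set ℝ} (hc : ContinuousOn c S) (hw : ContinuousOn w S) :
    ContinuousOn (fun z : ℝ × ℝ => c z.1 + z.2 • w z.1) (S ×ˢ T) :=
  (hc.comp continuousOn_fst fun _ hz => hz.1).add
    (continuousOn_snd.smul (hw.comp continuousOn_fst fun _ hz => hz.1))

lemma integral_patch_of_contDiff {Y : Plane → Plane} (hY : ContDiff ℝ 1 Y)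
    (hc : ∀ s ∈ uIcc a b, HasDerivAt c (c' s) s) (hw : ∀ s ∈ uIcc a b, HasDerivAt w (w' s) s)
    (hc' : ContinuousOn c' (uIcc a b)) (hw' : ContinuousOn w' (uIcc a b)) :
    ∫ s in a..b, ∫ r in (0 : ℝ)..1, divP Y (c s + r • w s) * wedgeP (w s) (c' s + r • w' s) =
      (∫ s in a..b, (wedgeP (Y (c s + w s)) (c' s + w' s) - wedgeP (Y (c s)) (c' s))) -
        ∫ r in (0 : ℝ)..1,
          (wedgeP (Y (c b + r • w b)) (w b) - wedgeP (Y (c a + r • w a)) (w a)) := by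
  have hcc := HasDerivAt.continuousOn hc
  have hwc := HasDerivAt.continuousOn hw
  let Γ : ℝ × ℝ → Plane := fun z => c z.1 + z.2 • w z.1
  let Γs : ℝ × ℝ → Plane := fun z => c' z.1 + z.2 • w' z.1
  have hΓ : ContinuousOn Γ (uIcc a b ×ˢ uIcc 0 1) := continuousOn_patch hcc hwc
  have hΓs : ContinuousOn Γs (uIcc a b ×ˢ uIcc 0 1) := continuousOn_patch hc' hw'
  have hw₁ : ContinuousOn (fun z : ℝ × ℝ => w z.1) (uIcc a b ×ˢ uIcc 0 1) :=
    hwc.comp continuousOn_fst fun _ hz => hz.1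
  have hYΓ : ContinuousOn (fun z => Y (Γ z)) (uIcc a b ×ˢ uIcc 0 1) :=
    hY.continuous.comp_continuousOn hΓ
  have hDY : ContinuousOn (fun z => fderiv ℝ Y (Γ z)) (uIcc a b ×ˢ uIcc 0 1) :=
    (hY.continuous_fderiv one_ne_zero).comp_continuousOn hΓ
  have hYw' : ContinuousOn (fun z => wedgeP (Y (Γ z)) (w' z.1)) (uIcc a b ×ˢ uIcc 0 1) :=
    continuousOn_wedgeP hYΓ (hw'.comp continuousOn_fst fun _ hz => hz.1)
  have hYd (p : Plane) : HasFDerivAt Y (fderiv ℝ Y p) p :=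
    (hY.differentiable one_ne_zero p).hasFDerivAt
  have hline (x v : Plane) (r : ℝ) : HasDerivAt (fun r : ℝ => x + r • v) v r := by
    simpa using ((hasDerivAt_id r).smul_const v).const_add x
  have green := integral_integral_sub_eq_boundary
    ((continuousOn_wedgeP (hDY.clm_apply hw₁) hΓs).add hYw')
    ((continuousOn_wedgeP (hDY.clm_apply hΓs) hw₁).add hYw')
    (p := fun z => wedgeP (Y (Γ z)) (Γs z)) (q := fun z => wedgeP (Y (Γ z)) (w z.1))
    (fun s _ r _ => hasDerivAt_wedgeP
      ((hYd _).comp_hasDerivAt r (hline (c s) (w s) r)) (hline (c' s) (w' s) r))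
    (fun s hs r _ => hasDerivAt_wedgeP
      ((hYd _).comp_hasDerivAt s ((hc s hs).add ((hw s hs).const_smul r))) (hw s hs))
  have integrand (z : ℝ × ℝ) : wedgeP (fderiv ℝ Y (Γ z) (w z.1)) (Γs z) + wedgeP (Y (Γ z)) (w' z.1)
      - (wedgeP (fderiv ℝ Y (Γ z) (Γs z)) (w z.1) + wedgeP (Y (Γ z)) (w' z.1))
      = divP Y (Γ z) * wedgeP (w z.1) (Γs z) := by
    rw [← wedgeP_fderiv_sub]
    ring
  simp only [Pi.add_apply, integrand] at green
  simpa only [Γ, Γs, one_smul, zero_smul, add_zero] using green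

lemma flux_patch_of_contDiff {Y : Plane → Plane} (hY : ContDiff ℝ 1 Y)
    (hc : ∀ s ∈ uIcc a b, HasDerivAt c (c' s) s) (hw : ∀ s ∈ uIcc a b, HasDerivAt w (w' s) s)
    (hc' : ContinuousOn c' (uIcc a b)) (hw' : ContinuousOn w' (uIcc a b)) :
    fluxP Y (fun s => c s + w s) (fun s => c' s + w' s) a b - fluxP Y c c' a b
        - (fluxP Y (fun r => c b + r • w b) (fun _ => w b) 0 1
          - fluxP Y (fun r => c a + r • w a) (fun _ => w a) 0 1) =
      ∫ s in a..b, ∫ r in (0 : ℝ)..1,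
        divP Y (c s + r • w s) * wedgeP (w s) (c' s + r • w' s) := by
  have hcc := HasDerivAt.continuousOn hc
  have hflux {c c' : ℝ → Plane} (hc : ContinuousOn c (uIcc a b))
      (hc' : ContinuousOn c' (uIcc a b)) :
      IntervalIntegrable (fun s => wedgeP (Y (c s)) (c' s)) volume a b :=
    (continuousOn_wedgeP (hY.continuous.comp_continuousOn hc) hc').intervalIntegrable
  have hside (s : ℝ) :
      IntervalIntegrable (fun r => wedgeP (Y (c s + r • w s)) (w s)) volume 0 1 :=
    (continuousOn_wedgeP (hY.continuous.comp_continuousOn (by fun_prop))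
      continuousOn_const).intervalIntegrable
  rw [integral_patch_of_contDiff hY hc hw hc' hw', intervalIntegral.integral_sub
    (hflux (c := fun s => c s + w s) (c' := fun s => c' s + w' s)
      (hcc.add (HasDerivAt.continuousOn hw)) (hc'.add hw')) (hflux hcc hc'),
    intervalIntegral.integral_sub (hside b) (hside a)]
  rfl

end Patch

/-- `X` has divergence `h` in `Ω`, in the sense that on every compact part of `Ω` the pair `(X, h)`
is a uniform limit of pairs `(Y, div Y)` with `Y` of class `C¹`. Neither `X` nor `h` need be
differentiable, but the divergence theorem survives. -/
def HasUniformDiv (Ω : Set Plane) (X : Plane → Plane) (h : Plane → ℝ) : Prop :=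
  ∀ K ⊆ Ω, IsCompact K → ∃ Y : ℕ → Plane → Plane, (∀ n, ContDiff ℝ 1 (Y n)) ∧
    TendstoUniformlyOn Y X atTop K ∧ TendstoUniformlyOn (fun n => divP (Y n)) h atTop K

namespace HasUniformDiv

variable {Ω : Set Plane} {X : Plane → Plane} {h : Plane → ℝ}

lemma continuousOn_of_isCompact (hdiv : HasUniformDiv Ω X h) {K : Set Plane} (hK : IsCompact K)
    (hKΩ : K ⊆ Ω) : ContinuousOn X K ∧ ContinuousOn h K := by
  obtain ⟨Y, hY, hYX, hYh⟩ := hdiv K hKΩ hK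
  exact ⟨hYX.continuousOn (.of_forall fun n => (hY n).continuous.continuousOn),
    hYh.continuousOn (.of_forall fun n =>
      (continuousOn_divP isOpen_univ (hY n).contDiffOn).mono (subset_univ K))⟩

lemma continuousOn (hdiv : HasUniformDiv Ω X h) (hΩ : IsOpen Ω) :
    ContinuousOn X Ω ∧ ContinuousOn h Ω := by
  have hcompact : ∀ p ∈ Ω, ContinuousAt X p ∧ ContinuousAt h p := fun p hp => by
    obtain ⟨K, hK, hpK, hKΩ⟩ := exists_compact_subset hΩ hp
    have hnhds : K ∈ 𝓝 p := mem_interior_iff_mem_nhds.1 hpK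
    have hcont := hdiv.continuousOn_of_isCompact hK hKΩ
    exact ⟨hcont.1.continuousAt hnhds, hcont.2.continuousAt hnhds⟩
  exact ⟨fun p hp => (hcompact p hp).1.continuousWithinAt,
    fun p hp => (hcompact p hp).2.continuousWithinAt⟩

lemma congr {X' : Plane → Plane} {h' : Plane → ℝ} (hdiv : HasUniformDiv Ω X h)
    (hXX' : EqOn X X' Ω) (hhh' : EqOn h h' Ω) : HasUniformDiv Ω X' h' := fun K hKΩ hK =>
  let ⟨Y, hY, hYX, hYh⟩ := hdiv K hKΩ hK
  ⟨Y, hY, hYX.congr_right fun _ hp => hXX' (hKΩ hp), hYh.congr_right fun _ hp => hhh' (hKΩ hp)⟩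

lemma mono {U : Set Plane} (hdiv : HasUniformDiv Ω X h) (hU : U ⊆ Ω) : HasUniformDiv U X h :=
  fun K hKU hK => hdiv K (hKU.trans hU) hK

end HasUniformDiv

lemma tendsto_fluxP {ι : Type*} {l : Filter ι} {Y : ι → Plane → Plane} {X : Plane → Plane}
    {K : Set Plane} (hYX : TendstoUniformlyOn Y X l K) (hY : ∀ i, ContinuousOn (Y i) K)
    (hX : ContinuousOn X K) {c c' : ℝ → Plane} {a b : ℝ} (hc : ContinuousOn c (uIcc a b))
    (hc' : ContinuousOn c' (uIcc a b)) (hcK : ∀ s ∈ uIcc a b, c s ∈ K) :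
    Tendsto (fun i => fluxP (Y i) c c' a b) l (𝓝 (fluxP X c c' a b)) := by
  obtain ⟨B, hB⟩ := isCompact_uIcc.exists_bound_of_continuousOn hc'
  exact tendsto_intervalIntegral_of_tendstoUniformlyOn
    (tendstoUniformlyOn_wedgeP ((hYX.comp c).mono hcK) hB)
    (fun i => (continuousOn_wedgeP ((hY i).comp hc hcK) hc').intervalIntegrable)
    (continuousOn_wedgeP (hX.comp hc hcK) hc').intervalIntegrable

lemma tendsto_integral_integral_mul {ι : Type*} {l : Filter ι} {f : ι → Plane → ℝ} {g : Plane → ℝ}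
    {K : Set Plane} (hfg : TendstoUniformlyOn f g l K) (hf : ∀ i, ContinuousOn (f i) K)
    (hg : ContinuousOn g K) {Γ : ℝ × ℝ → Plane} {m : ℝ × ℝ → ℝ} {a b c d : ℝ}
    (hΓ : ContinuousOn Γ (uIcc a b ×ˢ uIcc c d)) (hm : ContinuousOn m (uIcc a b ×ˢ uIcc c d))
    (hΓK : ∀ z ∈ uIcc a b ×ˢ uIcc c d, Γ z ∈ K) :
    Tendsto (fun i => ∫ s in a..b, ∫ r in c..d, f i (Γ (s, r)) * m (s, r)) l
      (𝓝 (∫ s in a..b, ∫ r in c..d, g (Γ (s, r)) * m (s, r))) := by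
  obtain ⟨B, hB⟩ := (isCompact_uIcc.prod isCompact_uIcc).exists_bound_of_continuousOn hm
  have hfm (i : ι) : ContinuousOn (fun z => f i (Γ z) * m z) (uIcc a b ×ˢ uIcc c d) :=
    ((hf i).comp hΓ hΓK).mul hm
  have hgm : ContinuousOn (fun z => g (Γ z) * m z) (uIcc a b ×ˢ uIcc c d) :=
    (hg.comp hΓ hΓK).mul hm
  exact tendsto_intervalIntegral_of_tendstoUniformlyOn
    (tendstoUniformlyOn_intervalIntegral
      (tendstoUniformlyOn_mul_right ((hfg.comp Γ).mono hΓK) hB)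
      (fun i s hs => intervalIntegrable_slice_snd (hfm i) hs)
      fun s hs => intervalIntegrable_slice_snd hgm hs)
    (fun i => (continuousOn_intervalIntegral_param (hfm i)).intervalIntegrable)
    (continuousOn_intervalIntegral_param hgm).intervalIntegrable

lemma HasUniformDiv.flux_patch {Ω : Set Plane} {X : Plane → Plane} {h : Plane → ℝ}
    (hdiv : HasUniformDiv Ω X h) {c w c' w' : ℝ → Plane} {a b : ℝ}
    (hc : ∀ s ∈ uIcc a b, HasDerivAt c (c' s) s) (hw : ∀ s ∈ uIcc a b, HasDerivAt w (w' s) s)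
    (hc' : ContinuousOn c' (uIcc a b)) (hw' : ContinuousOn w' (uIcc a b))
    (hΩ : ∀ s ∈ uIcc a b, ∀ r ∈ Icc (0 : ℝ) 1, c s + r • w s ∈ Ω) :
    fluxP X (fun s => c s + w s) (fun s => c' s + w' s) a b - fluxP X c c' a b
        - (fluxP X (fun r => c b + r • w b) (fun _ => w b) 0 1
          - fluxP X (fun r => c a + r • w a) (fun _ => w a) 0 1) =
      ∫ s in a..b, ∫ r in (0 : ℝ)..1,
        h (c s + r • w s) * wedgeP (w s) (c' s + r • w' s) := by
  have hcc := HasDerivAt.continuousOn hc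
  have hwc := HasDerivAt.continuousOn hw
  rw [← uIcc_of_le zero_le_one] at hΩ
  let K : Set Plane := (fun z : ℝ × ℝ => c z.1 + z.2 • w z.1) '' (uIcc a b ×ˢ uIcc 0 1)
  have hΓ : ContinuousOn (fun z : ℝ × ℝ => c z.1 + z.2 • w z.1) (uIcc a b ×ˢ uIcc 0 1) :=
    continuousOn_patch hcc hwc
  have hK : IsCompact K := (isCompact_uIcc.prod isCompact_uIcc).image_of_continuousOn hΓ
  have hKΩ : K ⊆ Ω := by rintro _ ⟨z, hz, rfl⟩; exact hΩ _ hz.1 _ hz.2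
  have mem {s r : ℝ} (hs : s ∈ uIcc a b) (hr : r ∈ uIcc (0 : ℝ) 1) : c s + r • w s ∈ K :=
    ⟨(s, r), ⟨hs, hr⟩, rfl⟩
  obtain ⟨hX, hh⟩ := hdiv.continuousOn_of_isCompact hK hKΩ
  obtain ⟨Y, hY, hYX, hYh⟩ := hdiv K hKΩ hK
  have hflux {c c' : ℝ → Plane} {a b : ℝ} (hc : ContinuousOn c (uIcc a b))
      (hc' : ContinuousOn c' (uIcc a b)) (hcK : ∀ s ∈ uIcc a b, c s ∈ K) :=
    tendsto_fluxP hYX (fun n => (hY n).continuous.continuousOn) hX hc hc' hcK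
  have hside (s : ℝ) (hs : s ∈ uIcc a b) :=
    hflux (a := 0) (b := 1) (c := fun r => c s + r • w s) (c' := fun _ => w s) (by fun_prop)
      (by fun_prop) fun r hr => mem hs hr
  have hboundary := ((hflux (hcc.add hwc) (hc'.add hw') fun s hs => by
      simpa using mem hs right_mem_uIcc).sub
    (hflux hcc hc' fun s hs => by simpa using mem hs left_mem_uIcc)).sub
    ((hside b right_mem_uIcc).sub (hside a left_mem_uIcc))
  have hbulk := tendsto_integral_integral_mul hYh
    (fun n => (continuousOn_divP isOpen_univ (hY n).contDiffOn).mono (subset_univ K)) hh hΓ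
    (continuousOn_wedgeP (hwc.comp continuousOn_fst fun _ hz => hz.1) (continuousOn_patch hc' hw'))
    fun z hz => mem hz.1 hz.2
  exact tendsto_nhds_unique
    (hboundary.congr fun n => flux_patch_of_contDiff (hY n) hc hw hc' hw') hbulk

/-! ### Weak divergences -/

/-- `h` is the distributional divergence of `X` in `Ω`. -/
def HasWeakDiv (Ω : Set Plane) (X : Plane → Plane) (h : Plane → ℝ) : Prop :=
  ∀ φ : Plane → ℝ, IsTestFun Ω φ →
    (∫ p in Ω, dotP (X p) (gradP φ p)) + (∫ p in Ω, h p * φ p) = 0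

section Mollification

open scoped Convolution

variable {E : Type*} [NormedAddCommGroup E] [NormedSpace ℝ E]

lemma tendstoUniformlyOn_normed_convolution [CompleteSpace E] {ι : Type*} {l : Filter ι}
    {b : ι → ContDiffBump (0 : Plane)} (hb : Tendsto (fun i => (b i).rOut) l (𝓝 0))
    {K : Set Plane} (hK : IsCompact K) {δ : ℝ} (hδ : 0 < δ) {g : Plane → E}
    (hg : ContinuousOn g (Metric.cthickening δ K)) :
    TendstoUniformlyOn (fun i => (b i).normed volume ⋆[ContinuousLinearMap.lsmul ℝ ℝ, volume]
      (Metric.cthickening δ K).indicator g) g l K := by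
  rw [Metric.tendstoUniformlyOn_iff]
  intro ε hε
  obtain ⟨ρ, hρ, hunif⟩ := Metric.uniformContinuousOn_iff.1
    (hK.cthickening.uniformContinuousOn_of_continuous hg) (ε / 2) (half_pos hε)
  filter_upwards [hb.eventually_lt_const (lt_min hδ hρ)] with i hi p hp
  have hball : ∀ q ∈ Metric.ball p (b i).rOut, q ∈ Metric.cthickening δ K := fun q hq =>
    Metric.mem_cthickening_of_dist_le q p δ K hp (hq.trans (hi.trans_le (min_le_left _ _))).le
  have hpK := hball p (Metric.mem_ball_self (b i).rOut_pos)
  rw [dist_comm, ← indicator_of_mem hpK g]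
  refine ((b i).dist_normed_convolution_le
    ((hg.integrableOn_compact hK.cthickening).integrable_indicator
      Metric.isClosed_cthickening.measurableSet).aestronglyMeasurable fun q hq => ?_).trans_lt
    (half_lt_self hε)
  rw [indicator_of_mem (hball q hq), indicator_of_mem hpK]
  exact (hunif q (hball q hq) p hpK (lt_trans hq (hi.trans_le (min_le_right _ _)))).le

variable {η : Plane → ℝ} {S : Set Plane}

lemma convolution_indicator_apply (hS : MeasurableSet S) (g : Plane → E) (p : Plane) :
    (η ⋆[ContinuousLinearMap.lsmul ℝ ℝ, volume] S.indicator g) p =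
      ∫ q in S, η (p - q) • g q := by
  rw [convolution_lsmul_swap, ← integral_indicator hS]
  exact integral_congr_ae (.of_forall fun q => by by_cases hq : q ∈ S <;> simp [hq])

lemma fderiv_convolution_indicator_apply (hη : ContDiff ℝ 1 η) (hηc : HasCompactSupport η)
    (hS : MeasurableSet S) {g : Plane → E} (hg : IntegrableOn g S) (p v : Plane) :
    fderiv ℝ (η ⋆[ContinuousLinearMap.lsmul ℝ ℝ, volume] S.indicator g) p v =
      ∫ q in S, fderiv ℝ η (p - q) v • g q := by
  have hgS := (hg.integrable_indicator hS).locallyIntegrable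
  rw [← convolution_flip, (hηc.hasFDerivAt_convolution_right _ hgS hη p).fderiv,
    convolution_precompR_apply _ hgS (hηc.fderiv ℝ) (hη.continuous_fderiv one_ne_zero),
    convolution_flip]
  exact convolution_indicator_apply (η := fun q => fderiv ℝ η q v) hS g p

lemma integrableOn_fderiv_sub_smul (hη : ContDiff ℝ 1 η) (hS : IsCompact S) {g : Plane → E}
    (hg : ContinuousOn g S) (p v : Plane) :
    IntegrableOn (fun q => fderiv ℝ η (p - q) v • g q) S := by
  have := hη.continuous_fderiv one_ne_zero
  exact ContinuousOn.integrableOn_compact hS (by fun_prop)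

lemma isTestFun_comp_const_sub {Ω : Set Plane} (hη : ContDiff ℝ ∞ η) (hηc : HasCompactSupport η)
    {p : Plane} (hp : ∀ q, p - q ∈ tsupport η → q ∈ Ω) : IsTestFun Ω fun q => η (p - q) :=
  ⟨hη.comp (contDiff_const.sub contDiff_id), hηc.comp_homeomorph (Homeomorph.subLeft p),
    (tsupport_comp_subset_preimage η (f := fun q => p - q) (by fun_prop)).trans hp⟩

/-- The weak divergence is tested against the reflected kernel `q ↦ η (p - q)`. -/
lemma HasWeakDiv.divP_convolution {Ω : Set Plane} {X : Plane → Plane} {h : Plane → ℝ}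
    (hdiv : HasWeakDiv Ω X h) (hΩ : IsOpen Ω) (hS : IsCompact S) (hSΩ : S ⊆ Ω)
    (hX : ContinuousOn X S) (hη : ContDiff ℝ ∞ η) (hηc : HasCompactSupport η) {p : Plane}
    (hp : ∀ q, p - q ∈ tsupport η → q ∈ S) :
    divP (η ⋆[ContinuousLinearMap.lsmul ℝ ℝ, volume] S.indicator X) p =
      (η ⋆[ContinuousLinearMap.lsmul ℝ ℝ, volume] S.indicator h) p := by
  have hη₁ : ContDiff ℝ 1 η := hη.of_le (by exact_mod_cast le_top)
  have hint (v : Plane) := integrableOn_fderiv_sub_smul hη₁ hS hX p v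
  have hgrad (q : Plane) : dotP (X q) (gradP (fun q => η (p - q)) q) =
      -((fderiv ℝ η (p - q) (1, 0) • X q).1 + (fderiv ℝ η (p - q) (0, 1) • X q).2) := by
    have hderiv : HasFDerivAt (fun q => η (p - q)) _ q :=
      (hη₁.differentiable one_ne_zero (p - q)).hasFDerivAt.comp q ((hasFDerivAt_id q).const_sub p)
    simp only [dotP, gradP, hderiv.fderiv, ContinuousLinearMap.comp_neg, neg_apply,
      ContinuousLinearMap.comp_id, Prod.smul_fst, Prod.smul_snd, smul_eq_mul]
    ring
  have hvanish {q : Plane} (hq : q ∉ S) : η (p - q) = 0 ∧ fderiv ℝ η (p - q) = 0 :=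
    have hq' : p - q ∉ tsupport η := fun hmem => hq (hp q hmem)
    ⟨image_eq_zero_of_notMem_tsupport hq',
      image_eq_zero_of_notMem_tsupport fun hmem => hq' (tsupport_fderiv_subset ℝ hmem)⟩
  have htest := hdiv _ (isTestFun_comp_const_sub hη hηc fun q hq => hSΩ (hp q hq))
  rw [setIntegral_eq_of_subset_of_forall_sdiff_eq_zero hΩ.measurableSet hSΩ fun q hq => by
      rw [hgrad, (hvanish hq.2).2]; simp,
    setIntegral_eq_of_subset_of_forall_sdiff_eq_zero hΩ.measurableSet hSΩ fun q hq => by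
      rw [(hvanish hq.2).1, mul_zero]] at htest
  simp only [hgrad, integral_neg] at htest
  rw [divP, fderiv_convolution_indicator_apply hη₁ hηc hS.measurableSet
      (hX.integrableOn_compact hS), fderiv_convolution_indicator_apply hη₁ hηc hS.measurableSet
      (hX.integrableOn_compact hS), convolution_indicator_apply hS.measurableSet,
    fst_integral (hint _), snd_integral (hint _), ← integral_add (hint _).fst (hint _).snd]
  simp only [smul_eq_mul, mul_comm (η _)]
  linarith

lemma HasWeakDiv.hasUniformDiv {Ω : Set Plane} (hΩ : IsOpen Ω) {X : Plane → Plane}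
    {h : Plane → ℝ} (hdiv : HasWeakDiv Ω X h) (hX : ContinuousOn X Ω) (hh : ContinuousOn h Ω) :
    HasUniformDiv Ω X h := by
  intro K hKΩ hK
  obtain ⟨δ, hδ, hδΩ⟩ := hK.exists_cthickening_subset_open hΩ hKΩ
  have hXδ := hX.mono hδΩ
  let b (n : ℕ) : ContDiffBump (0 : Plane) :=
    ⟨δ / (n + 1) / 2, δ / (n + 1), by positivity, half_lt_self (by positivity)⟩
  have hb : Tendsto (fun n => (b n).rOut) atTop (𝓝 0) := by
    simpa [b, div_eq_mul_inv] using tendsto_one_div_add_atTop_nhds_zero_nat.const_mul δ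
  have hsupport {n : ℕ} {p q : Plane} (hp : p ∈ K)
      (hq : p - q ∈ tsupport ((b n).normed volume)) : q ∈ Metric.cthickening δ K := by
    rw [(b n).tsupport_normed_eq, mem_closedBall_zero_iff, ← dist_eq_norm, dist_comm] at hq
    exact Metric.mem_cthickening_of_dist_le q p δ K hp
      (hq.trans (div_le_self hδ.le (by simp)))
  refine ⟨fun n => (b n).normed volume ⋆[ContinuousLinearMap.lsmul ℝ ℝ, volume]
    (Metric.cthickening δ K).indicator X, fun n => ?_,
    tendstoUniformlyOn_normed_convolution hb hK hδ hXδ,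
    (tendstoUniformlyOn_normed_convolution hb hK hδ (hh.mono hδΩ)).congr (.of_forall fun n p hp =>
      (hdiv.divP_convolution hΩ hK.cthickening hδΩ hXδ (b n).contDiff_normed
        (b n).hasCompactSupport_normed fun q => hsupport hp).symm)⟩
  exact (b n).hasCompactSupport_normed.contDiff_convolution_left _ (b n).contDiff_normed
    ((hXδ.integrableOn_compact hK.cthickening).integrable_indicator
      hK.cthickening.measurableSet).locallyIntegrable

end Mollification

lemma integrable_mul_of_tsupport_subset {Ω : Set Plane} {f g : Plane → ℝ} (hf : ContinuousOn f Ω)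
    (hg : Continuous g) (hc : HasCompactSupport g) (hs : tsupport g ⊆ Ω) :
    Integrable fun p => f p * g p :=
  (integrableOn_iff_integrable_of_support_subset ((Function.support_mul_subset_right f g).trans
    (subset_tsupport g))).1
    (((hf.mono hs).mul hg.continuousOn).integrableOn_compact hc)

lemma setIntegral_mul_fderiv_eq_neg {Ω : Set Plane} (hΩ : IsOpen Ω) {w : Plane → ℝ}
    (hw : ContDiffOn ℝ 1 w Ω) {φ : Plane → ℝ} (hφ : ContDiff ℝ 1 φ) (hc : HasCompactSupport φ)
    (hs : tsupport φ ⊆ Ω) (v : Plane) :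
    ∫ p in Ω, w p * fderiv ℝ φ p v = -∫ p in Ω, fderiv ℝ w p v * φ p := by
  have hs' := (tsupport_fderiv_apply_subset ℝ v).trans hs
  rw [setIntegral_eq_integral_of_forall_compl_eq_zero fun p hp => ?_,
    setIntegral_eq_integral_of_forall_compl_eq_zero fun p hp => ?_]
  · exact integral_mul_fderiv_eq_neg_fderiv_mul_of_integrable
      (integrable_mul_of_tsupport_subset ((hw.continuousOn_fderiv_of_isOpen hΩ le_rfl).clm_apply
        continuousOn_const) hφ.continuous hc hs)
      (integrable_mul_of_tsupport_subset hw.continuousOn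
        ((hφ.continuous_fderiv one_ne_zero).clm_apply continuous_const) (hc.fderiv_apply ℝ v) hs')
      (integrable_mul_of_tsupport_subset hw.continuousOn hφ.continuous hc hs)
      (fun p hp => (hw.differentiableOn one_ne_zero).differentiableAt (hΩ.mem_nhds (hs hp)))
      fun p _ => hφ.differentiable one_ne_zero p
  · rw [image_eq_zero_of_notMem_tsupport fun hmem => hp (hs hmem), mul_zero]
  · rw [image_eq_zero_of_notMem_tsupport (f := fun p => fderiv ℝ φ p v) fun hmem => hp (hs' hmem),
      mul_zero]

lemma fderiv_fderiv_apply_comm {φ : Plane → ℝ} (hφ : ContDiff ℝ 2 φ) (p v w : Plane) :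
    fderiv ℝ (fun q => fderiv ℝ φ q v) p w = fderiv ℝ (fun q => fderiv ℝ φ q w) p v := by
  have hdd : DifferentiableAt ℝ (fderiv ℝ φ) p :=
    (hφ.fderiv_right (m := 1) one_add_one_eq_two.le).differentiable one_ne_zero p
  have hsymm : IsSymmSndFDerivAt ℝ φ p := hφ.contDiffAt.isSymmSndFDerivAt (by simp)
  rw [fderiv_clm_apply hdd (by fun_prop), fderiv_clm_apply hdd (by fun_prop)]
  simpa using hsymm w v

section WeakDivergence

variable {Ω : Set Plane} {X Z : Plane → Plane} {h k : Plane → ℝ}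

lemma IsTestFun.isTestFun_fderiv_apply {φ : Plane → ℝ} (hφ : IsTestFun Ω φ) (v : Plane) :
    IsTestFun Ω fun p => fderiv ℝ φ p v :=
  ⟨(hφ.1.fderiv_right (m := ∞) le_rfl).clm_apply contDiff_const, hφ.2.1.fderiv_apply ℝ v,
    (tsupport_fderiv_apply_subset ℝ v).trans hφ.2.2⟩

lemma setIntegral_dotP_gradP (hX : ContinuousOn X Ω) {φ : Plane → ℝ} (hφ : IsTestFun Ω φ) :
    ∫ p in Ω, dotP (X p) (gradP φ p) =
      (∫ p in Ω, (X p).1 * fderiv ℝ φ p (1, 0)) + ∫ p in Ω, (X p).2 * fderiv ℝ φ p (0, 1) := by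
  have hint (v : Plane) {f : Plane → ℝ} (hf : ContinuousOn f Ω) :
      Integrable (fun p => f p * fderiv ℝ φ p v) :=
    integrable_mul_of_tsupport_subset hf (hφ.isTestFun_fderiv_apply v).1.continuous
      (hφ.isTestFun_fderiv_apply v).2.1 (hφ.isTestFun_fderiv_apply v).2.2
  exact integral_add (hint _ hX.fst).integrableOn (hint _ hX.snd).integrableOn

lemma HasWeakDiv.add (hX : ContinuousOn X Ω) (hZ : ContinuousOn Z Ω) (hh : ContinuousOn h Ω)
    (hk : ContinuousOn k Ω) (hXh : HasWeakDiv Ω X h) (hZk : HasWeakDiv Ω Z k) :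
    HasWeakDiv Ω (X + Z) (h + k) := by
  intro φ hφ
  have hint {f : Plane → ℝ} {ψ : Plane → ℝ} (hf : ContinuousOn f Ω) (hψ : IsTestFun Ω ψ) :
      IntegrableOn (fun p => f p * ψ p) Ω :=
    (integrable_mul_of_tsupport_subset hf hψ.1.continuous hψ.2.1 hψ.2.2).integrableOn
  have hX' := hXh φ hφ
  have hZ' := hZk φ hφ
  rw [setIntegral_dotP_gradP hX hφ] at hX'
  rw [setIntegral_dotP_gradP hZ hφ] at hZ'
  rw [setIntegral_dotP_gradP (hX.add hZ) hφ]
  simp only [Pi.add_apply, Prod.fst_add, Prod.snd_add, add_mul]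
  rw [integral_add (hint hX.fst (hφ.isTestFun_fderiv_apply _))
      (hint hZ.fst (hφ.isTestFun_fderiv_apply _)),
    integral_add (hint hX.snd (hφ.isTestFun_fderiv_apply _))
      (hint hZ.snd (hφ.isTestFun_fderiv_apply _)),
    integral_add (hint hh hφ) (hint hk hφ)]
  linarith

lemma hasWeakDiv_divP (hΩ : IsOpen Ω) (hX : ContDiffOn ℝ 1 X Ω) : HasWeakDiv Ω X (divP X) := by
  intro φ hφ
  have hφ₁ : ContDiff ℝ 1 φ := hφ.1.of_le (by exact_mod_cast le_top)
  have hDX (v : Plane) : ContinuousOn (fun p => fderiv ℝ X p v) Ω :=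
    (hX.continuousOn_fderiv_of_isOpen hΩ le_rfl).clm_apply continuousOn_const
  have hint {f : Plane → ℝ} (hf : ContinuousOn f Ω) : IntegrableOn (fun p => f p * φ p) Ω :=
    (integrable_mul_of_tsupport_subset hf hφ.1.continuous hφ.2.1 hφ.2.2).integrableOn
  have hfst : EqOn (fun p => fderiv ℝ (fun q => (X q).1) p (1, 0) * φ p)
      (fun p => (fderiv ℝ X p (1, 0)).1 * φ p) Ω := fun p hp => by
    simp [fderiv.fst ((hX.differentiableOn one_ne_zero).differentiableAt (hΩ.mem_nhds hp))]
  have hsnd : EqOn (fun p => fderiv ℝ (fun q => (X q).2) p (0, 1) * φ p)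
      (fun p => (fderiv ℝ X p (0, 1)).2 * φ p) Ω := fun p hp => by
    simp [fderiv.snd ((hX.differentiableOn one_ne_zero).differentiableAt (hΩ.mem_nhds hp))]
  rw [setIntegral_dotP_gradP hX.continuousOn hφ,
    setIntegral_mul_fderiv_eq_neg hΩ hX.fst hφ₁ hφ.2.1 hφ.2.2,
    setIntegral_mul_fderiv_eq_neg hΩ hX.snd hφ₁ hφ.2.1 hφ.2.2,
    setIntegral_congr_fun hΩ.measurableSet hfst, setIntegral_congr_fun hΩ.measurableSet hsnd]
  simp only [divP, add_mul]
  rw [integral_add (hint (hDX _).fst) (hint (hDX _).snd)]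
  ring

lemma continuousOn_gradP (hΩ : IsOpen Ω) {u : Plane → ℝ} (hu : ContDiffOn ℝ 1 u Ω) :
    ContinuousOn (gradP u) Ω := by
  have := hu.continuousOn_fderiv_of_isOpen hΩ le_rfl
  unfold gradP
  fun_prop

lemma hasWeakDiv_perpP_gradP (hΩ : IsOpen Ω) {u : Plane → ℝ} (hu : ContDiffOn ℝ 1 u Ω) :
    HasWeakDiv Ω (fun p => perpP (gradP u p)) 0 := by
  intro φ hφ
  have hparts (v w : Plane) : ∫ p in Ω, fderiv ℝ u p w * fderiv ℝ φ p v =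
      -∫ p in Ω, u p * fderiv ℝ (fun q => fderiv ℝ φ q v) p w := by
    obtain ⟨hsmooth, hcompact, hsubset⟩ := hφ.isTestFun_fderiv_apply v
    rw [setIntegral_mul_fderiv_eq_neg hΩ hu (hsmooth.of_le (by exact_mod_cast le_top)) hcompact
      hsubset, neg_neg]
  rw [setIntegral_dotP_gradP (continuousOn_perpP (continuousOn_gradP hΩ hu)) hφ]
  simp only [perpP, gradP, neg_mul, integral_neg, hparts, fderiv_fderiv_apply_comm
    (contDiff_infty.1 hφ.1 2) _ (1, 0), Pi.zero_apply, zero_mul, integral_zero]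
  ring

lemma divP_perpP {F : Plane → Plane} {p : Plane} (hF : DifferentiableAt ℝ F p) :
    divP (fun q => perpP (F q)) p = rotP F p := by
  have hderiv : HasFDerivAt (fun q => perpP (F q)) _ p :=
    (hF.hasFDerivAt.snd).prodMk hF.hasFDerivAt.fst.neg
  simp [divP, rotP, hderiv.fderiv, sub_eq_add_neg]

lemma hasWeakDiv_perpP_shiftedGrad (hΩ : IsOpen Ω) {u : Plane → ℝ} {F : Plane → Plane}
    (hu : ContDiffOn ℝ 1 u Ω) (hF : ContDiffOn ℝ 1 F Ω) :
    HasWeakDiv Ω (fun p => perpP (shiftedGrad u F p)) (rotP F) := by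
  have hperp : ContDiffOn ℝ 1 (fun p => perpP (F p)) Ω := hF.snd.prodMk hF.fst.neg
  have hsum := (hasWeakDiv_perpP_gradP hΩ hu).add
    (continuousOn_perpP (continuousOn_gradP hΩ hu)) hperp.continuousOn
    (continuousOn_const (c := (0 : ℝ))) (continuousOn_divP hΩ hperp) (hasWeakDiv_divP hΩ hperp)
  intro φ hφ
  rw [← hsum φ hφ]
  congr 1
  · refine integral_congr_ae (.of_forall fun p => ?_)
    simp only [Pi.add_apply, shiftedGrad, perpP, Prod.fst_add, Prod.snd_add, Prod.mk_add_mk,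
      neg_add]
  · refine setIntegral_congr_fun hΩ.measurableSet fun p hp => ?_
    simp only [divP_perpP ((hF.differentiableOn one_ne_zero).differentiableAt (hΩ.mem_nhds hp)),
      Pi.add_apply, zero_add]

end WeakDivergence

/-! ### The extremality of the flux of a unit field -/

lemma hasDerivAt_integral_of_continuousOn {E : Type*} [NormedAddCommGroup E] [NormedSpace ℝ E]
    [CompleteSpace E] {k : ℝ → E} {S : Set ℝ} (hS : IsOpen S) (hconn : S.OrdConnected)
    (hk : ContinuousOn k S) {x s : ℝ} (hx : x ∈ S) (hs : s ∈ S) :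
    HasDerivAt (fun y => ∫ z in x..y, k z) (k s) s :=
  intervalIntegral.integral_hasDerivAt_right
    (hk.mono (hconn.uIcc_subset hx hs)).intervalIntegrable
    (hk.stronglyMeasurableAtFilter hS _ hs) (hk.continuousAt (hS.mem_nhds hs))

lemma hasDerivAt_of_integral_eq {E : Type*} [NormedAddCommGroup E] [NormedSpace ℝ E]
    [CompleteSpace E] {f k : ℝ → E} {a b s : ℝ} (hk : ContinuousOn k (Ioo a b))
    (hs : s ∈ Ioo a b)
    (h : ∀ x ∈ Ioo a b, ∀ y ∈ Ioo a b, x ≤ y → f y - f x = ∫ z in x..y, k z) :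
    HasDerivAt f (k s) s := by
  obtain ⟨x, hax, hxs⟩ := exists_between hs.1
  have hx : x ∈ Ioo a b := ⟨hax, hxs.trans hs.2⟩
  refine ((hasDerivAt_integral_of_continuousOn isOpen_Ioo ordConnected_Ioo hk hx hs).const_add
    (f x)).congr_of_eventuallyEq ?_
  filter_upwards [Ioo_mem_nhds hxs hs.2] with y hy
  rw [← h x hx y ⟨hax.trans hy.1, hy.2⟩ hy.1.le, add_sub_cancel]

lemma eventually_forall_add_smul_mem {Ω : Set Plane} (hΩ : IsOpen Ω) {c : ℝ → Plane} {S : Set ℝ}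
    (hS : IsCompact S) (hc : ContinuousOn c S) (hcΩ : MapsTo c S Ω) (v : Plane) :
    ∀ᶠ ρ : ℝ in 𝓝 0, ∀ s ∈ S, c s + ρ • v ∈ Ω := by
  have hmem : ∀ᶠ ρ : ℝ in 𝓝 0, ∀ p ∈ c '' S, p + ρ • v ∈ Ω := by
    refine (hS.image_of_continuousOn hc).eventually_forall_of_forall_eventually ?_
    rintro _ ⟨s, hs, rfl⟩
    have hcont : Continuous fun z : ℝ × Plane => z.2 + z.1 • v := by fun_prop
    exact hcont.continuousAt.eventually (hΩ.mem_nhds (by simpa using hcΩ hs))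
  exact hmem.mono fun ρ hρ s hs => hρ _ (mem_image_of_mem c hs)

section Translation

variable {Ω : Set Plane} {X : Plane → Plane} {h : Plane → ℝ} {c c' : ℝ → Plane} {a b : ℝ}

lemma integral_mul_comp_mul (g : ℝ → ℝ) (ρ : ℝ) :
    ∫ r in (0 : ℝ)..1, ρ * g (r * ρ) = ∫ r in (0 : ℝ)..ρ, g r := by
  rw [intervalIntegral.integral_const_mul]
  simp

lemma HasUniformDiv.fluxP_translate_sub (hdiv : HasUniformDiv Ω X h)
    (hc : ∀ s ∈ uIcc a b, HasDerivAt c (c' s) s) (hc' : ContinuousOn c' (uIcc a b)) {v : Plane}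
    {ρ : ℝ} (hΩ : ∀ r ∈ Icc (0 : ℝ) 1, ∀ s ∈ uIcc a b, c s + (r * ρ) • v ∈ Ω) :
    fluxP X (fun s => c s + ρ • v) c' a b - fluxP X c c' a b =
      (∫ r in (0 : ℝ)..ρ, wedgeP (X (c b + r • v)) v)
        - (∫ r in (0 : ℝ)..ρ, wedgeP (X (c a + r • v)) v)
        + ∫ r in (0 : ℝ)..ρ, ∫ s in a..b, h (c s + r • v) * wedgeP v (c' s) := by
  have hpatch := hdiv.flux_patch (w := fun _ => ρ • v) (w' := fun _ => 0) hc
    (fun s _ => hasDerivAt_const s _) hc' continuousOn_const fun s hs r hr => by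
      rw [smul_smul]; exact hΩ r hr s hs
  have hcc := HasDerivAt.continuousOn hc
  have hΓ : ContinuousOn (fun z : ℝ × ℝ => c z.1 + (z.2 * ρ) • v) (uIcc a b ×ˢ uIcc 0 1) :=
    (hcc.comp continuousOn_fst fun _ hz => hz.1).add (by fun_prop)
  have hΓΩ : (fun z : ℝ × ℝ => c z.1 + (z.2 * ρ) • v) '' (uIcc a b ×ˢ uIcc 0 1) ⊆ Ω := by
    rintro _ ⟨z, hz, rfl⟩
    exact hΩ z.2 (by simpa using hz.2) z.1 hz.1
  have hh := (hdiv.continuousOn_of_isCompact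
    ((isCompact_uIcc.prod isCompact_uIcc).image_of_continuousOn hΓ) hΓΩ).2
  have hbulk : ∫ s in a..b, ∫ r in (0 : ℝ)..1, ρ * (h (c s + (r * ρ) • v) * wedgeP v (c' s)) =
      ∫ r in (0 : ℝ)..ρ, ∫ s in a..b, h (c s + r • v) * wedgeP v (c' s) := by
    rw [integral_swap_of_continuousOn (f := fun z : ℝ × ℝ =>
      ρ * (h (c z.1 + (z.2 * ρ) • v) * wedgeP v (c' z.1)))]
    · simp only [intervalIntegral.integral_const_mul (a := a)]
      exact integral_mul_comp_mul (fun r => ∫ s in a..b, h (c s + r • v) * wedgeP v (c' s)) ρ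
    · exact continuousOn_const.mul ((hh.comp hΓ fun z hz => mem_image_of_mem _ hz).mul
        (continuousOn_wedgeP continuousOn_const
          (hc'.comp continuousOn_fst fun _ hz => hz.1)))
  have hside (x : Plane) := integral_mul_comp_mul (fun r => wedgeP (X (x + r • v)) v) ρ
  have hright (x : Plane) : wedgeP x (ρ • v) = ρ * wedgeP x v := by
    simp only [wedgeP, Prod.smul_fst, Prod.smul_snd, smul_eq_mul]; ring
  have hleft (y : ℝ) (x : Plane) : y * wedgeP (ρ • v) x = ρ * (y * wedgeP v x) := by
    simp only [wedgeP, Prod.smul_fst, Prod.smul_snd, smul_eq_mul]; ring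
  simp only [fluxP, smul_zero, add_zero, smul_smul, hright, hleft, hside, hbulk] at hpatch ⊢
  linarith

lemma HasUniformDiv.hasDerivAt_fluxP_translate (hΩ : IsOpen Ω) (hdiv : HasUniformDiv Ω X h)
    (hc : ∀ s ∈ uIcc a b, HasDerivAt c (c' s) s) (hc' : ContinuousOn c' (uIcc a b))
    (hcΩ : MapsTo c (uIcc a b) Ω) (v : Plane) :
    HasDerivAt (fun ρ : ℝ => fluxP X (fun s => c s + ρ • v) c' a b)
      (wedgeP (X (c b)) v - wedgeP (X (c a)) v + ∫ s in a..b, h (c s) * wedgeP v (c' s)) 0 := by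
  obtain ⟨hX, hh⟩ := hdiv.continuousOn hΩ
  have hcc := HasDerivAt.continuousOn hc
  obtain ⟨δ, hδ, hδΩ⟩ := Metric.eventually_nhds_iff.1
    (eventually_forall_add_smul_mem hΩ isCompact_uIcc hcc hcΩ v)
  have hmem : ∀ ρ ∈ Ioo (-δ) δ, ∀ s ∈ uIcc a b, c s + ρ • v ∈ Ω := fun ρ hρ =>
    hδΩ (by simpa [abs_lt] using hρ)
  have h0 : (0 : ℝ) ∈ Ioo (-δ) δ := ⟨neg_lt_zero.2 hδ, hδ⟩
  have hside {s : ℝ} (hs : s ∈ uIcc a b) :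
      HasDerivAt (fun ρ => ∫ r in (0 : ℝ)..ρ, wedgeP (X (c s + r • v)) v)
        (wedgeP (X (c s)) v) 0 := by
    simpa using hasDerivAt_integral_of_continuousOn isOpen_Ioo ordConnected_Ioo
      (continuousOn_wedgeP (hX.comp (by fun_prop) fun r hr => hmem r hr s hs) continuousOn_const)
      h0 h0
  have hslices : ContinuousOn (fun r => ∫ s in a..b, h (c s + r • v) * wedgeP v (c' s))
      (Ioo (-δ) δ) :=
    continuousOn_intervalIntegral_param (f := fun z => h (c z.2 + z.1 • v) * wedgeP v (c' z.2))
      ((hh.comp ((hcc.comp continuousOn_snd fun _ hz => hz.2).add (by fun_prop))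
        fun z hz => hmem z.1 hz.1 z.2 hz.2).mul
      (continuousOn_wedgeP continuousOn_const (hc'.comp continuousOn_snd fun _ hz => hz.2)))
  have hbulk := hasDerivAt_integral_of_continuousOn isOpen_Ioo ordConnected_Ioo hslices h0 h0
  have hsum := (((hside right_mem_uIcc).sub (hside left_mem_uIcc)).add hbulk).const_add
    (fluxP X c c' a b)
  simp only [zero_smul, add_zero] at hsum
  refine hsum.congr_of_eventuallyEq ?_
  filter_upwards [Ioo_mem_nhds h0.1 h0.2] with ρ hρ
  refine eq_add_of_sub_eq' (hdiv.fluxP_translate_sub hc hc' fun r hr => hmem _ ?_)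
  rw [mem_Ioo, ← abs_lt, abs_mul, abs_of_nonneg hr.1]
  exact (mul_le_of_le_one_left (abs_nonneg ρ) hr.2).trans_lt (abs_lt.2 hρ)

end Translation

section UnitField

variable {Ω : Set Plane} {N : Plane → Plane} {H : Plane → ℝ} {c : ℝ → Plane} {e : ℝ → ℝ}

/-- Among unit fields, `N` has the least flux through a curve directed along `N^⊥`, so translating
the curve cannot decrease the flux of `N`. -/
lemma isLocalMin_fluxP_translate (hΩ : IsOpen Ω) (hN : ContinuousOn N Ω)
    (hunit : ∀ p ∈ Ω, (N p).1 ^ 2 + (N p).2 ^ 2 = 1) {x y : ℝ} (hxy : x ≤ y)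
    (hc : ContinuousOn c (uIcc x y)) (hcΩ : MapsTo c (uIcc x y) Ω)
    (he : ContinuousOn e (uIcc x y)) (he0 : ∀ s ∈ uIcc x y, 0 ≤ e s) (v : Plane) :
    IsLocalMin (fun ρ : ℝ => fluxP N (fun s => c s + ρ • v) (fun s => e s • perpP (N (c s))) x y)
      0 := by
  have hc' : ContinuousOn (fun s => e s • perpP (N (c s))) (uIcc x y) :=
    he.smul (continuousOn_perpP (hN.comp hc hcΩ))
  filter_upwards [eventually_forall_add_smul_mem hΩ isCompact_uIcc hc hcΩ v] with ρ hρ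
  simp only [zero_smul, add_zero]
  refine intervalIntegral.integral_mono_on hxy
    (continuousOn_wedgeP (hN.comp hc hcΩ) hc').intervalIntegrable
    (continuousOn_wedgeP (hN.comp (hc.add continuousOn_const) hρ) hc').intervalIntegrable
    fun s hs => ?_
  rw [← uIcc_of_le hxy] at hs
  have hdot : (N (c s)).1 * (N (c s + ρ • v)).1 + (N (c s)).2 * (N (c s + ρ • v)).2 ≤
      (N (c s)).1 ^ 2 + (N (c s)).2 ^ 2 := by
    nlinarith [hunit _ (hcΩ hs), hunit _ (hρ s hs),
      sq_nonneg ((N (c s)).1 - (N (c s + ρ • v)).1), sq_nonneg ((N (c s)).2 - (N (c s + ρ • v)).2)]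
  simp only [wedgeP, perpP, Prod.smul_mk, smul_eq_mul]
  linarith [mul_le_mul_of_nonneg_left hdot (he0 s hs)]

lemma HasUniformDiv.wedgeP_unit_sub (hΩ : IsOpen Ω) (hdiv : HasUniformDiv Ω N H)
    (hunit : ∀ p ∈ Ω, (N p).1 ^ 2 + (N p).2 ^ 2 = 1) {x y : ℝ} (hxy : x ≤ y)
    (hcΩ : MapsTo c (uIcc x y) Ω)
    (hc : ∀ s ∈ uIcc x y, HasDerivAt c (e s • perpP (N (c s))) s)
    (he : ContinuousOn e (uIcc x y)) (he0 : ∀ s ∈ uIcc x y, 0 ≤ e s) (v : Plane) :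
    wedgeP (N (c y)) v - wedgeP (N (c x)) v =
      ∫ s in x..y, -(H (c s) * wedgeP v (e s • perpP (N (c s)))) := by
  have hN := (hdiv.continuousOn hΩ).1
  have hcc := HasDerivAt.continuousOn hc
  have hstationary := (isLocalMin_fluxP_translate hΩ hN hunit hxy hcc hcΩ he he0
    v).hasDerivAt_eq_zero (hdiv.hasDerivAt_fluxP_translate hΩ hc
      (he.smul (continuousOn_perpP (hN.comp hcc hcΩ))) hcΩ v)
  rw [intervalIntegral.integral_neg]
  linarith

lemma HasUniformDiv.hasDerivAt_unit_field (hΩ : IsOpen Ω) (hdiv : HasUniformDiv Ω N H)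
    (hunit : ∀ p ∈ Ω, (N p).1 ^ 2 + (N p).2 ^ 2 = 1) {a b : ℝ} (hcΩ : MapsTo c (Ioo a b) Ω)
    (hc : ∀ s ∈ Ioo a b, HasDerivAt c (e s • perpP (N (c s))) s)
    (he : ContinuousOn e (Ioo a b)) (he0 : ∀ s ∈ Ioo a b, 0 ≤ e s) {s : ℝ} (hs : s ∈ Ioo a b) :
    HasDerivAt (fun s => N (c s)) ((e s * H (c s)) • perpP (N (c s))) s := by
  obtain ⟨hN, hH⟩ := hdiv.continuousOn hΩ
  have hcc := HasDerivAt.continuousOn hc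
  have hwedge (v : Plane) : HasDerivAt (fun s => wedgeP (N (c s)) v)
      (-(H (c s) * wedgeP v (e s • perpP (N (c s))))) s := by
    refine hasDerivAt_of_integral_eq (((hH.comp hcc hcΩ).mul (continuousOn_wedgeP
      continuousOn_const (he.smul (continuousOn_perpP (hN.comp hcc hcΩ))))).neg) hs
      fun x hx y hy hxy => ?_
    have hsub := ordConnected_Ioo.uIcc_subset hx hy
    exact hdiv.wedgeP_unit_sub hΩ hunit hxy (hcΩ.mono_left hsub) (fun s hs => hc s (hsub hs))
      (he.mono hsub) (fun s hs => he0 s (hsub hs)) v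
  have hfst := hwedge (0, 1)
  have hsnd := hwedge (-1, 0)
  simp only [wedgeP, perpP, Prod.smul_mk, mul_one, mul_zero, sub_zero, zero_sub, mul_neg, neg_neg,
    zero_mul, neg_mul, one_mul, smul_eq_mul] at hfst hsnd
  refine (hfst.prodMk hsnd).congr_deriv ?_
  simp only [perpP, Prod.smul_mk, smul_eq_mul]
  ext <;> ring

end UnitField

/-! ### Peano's theorem and the inverse function theorem -/

section Peano

open scoped NNReal BoundedContinuousFunction

lemma exists_subseq_tendsto_of_lipschitzWith {α β : Type*} [PseudoMetricSpace α] [CompactSpace α]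
    [MetricSpace β] {C : ℝ≥0} {f : ℕ → α → β} (hf : ∀ n, LipschitzWith C (f n)) {s : Set β}
    (hs : IsCompact s) (hfs : ∀ n x, f n x ∈ s) :
    ∃ g : α → β, LipschitzWith C g ∧
      ∃ φ : ℕ → ℕ, StrictMono φ ∧ ∀ x, Tendsto (fun k => f (φ k) x) atTop (𝓝 (g x)) := by
  let F : ℕ → α →ᵇ β := fun n => .mkOfCompact ⟨f n, (hf n).continuous⟩
  have hequi : Equicontinuous fun u : range F => (u : α → β) :=
    (LipschitzWith.uniformEquicontinuous _ C (by rintro ⟨_, n, rfl⟩; exact hf n)).equicontinuous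
  obtain ⟨g, -, φ, hφ, hlim⟩ := (BoundedContinuousFunction.arzela_ascoli s hs (range F)
    (by rintro _ x ⟨n, rfl⟩; exact hfs n x) hequi).tendsto_subseq
    fun n => subset_closure (mem_range_self n)
  have hpoint (x : α) : Tendsto (fun k => f (φ k) x) atTop (𝓝 (g x)) :=
    ((continuous_eval_const x).tendsto g).comp hlim
  refine ⟨g, LipschitzWith.of_dist_le_mul fun x y => ?_, φ, hφ, hpoint⟩
  exact le_of_tendsto' ((hpoint x).dist (hpoint y)) fun k => (hf _).dist_le_mul x y

lemma exists_lipschitzWith_eq_add_integral {f : ℝ × ℝ → ℝ} (hf : Continuous f) {C : ℝ≥0}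
    (hC : ∀ z, |f z| ≤ C) {K : ℝ≥0} (hK : ∀ t, LipschitzWith K fun y => f (t, y)) (σ : ℝ) {ρ : ℝ}
    (hρ : 0 ≤ ρ) :
    ∃ ξ : ℝ → ℝ, LipschitzWith C ξ ∧
      ∀ x ∈ Icc (-ρ) ρ, ξ x = σ + ∫ t in (0 : ℝ)..x, f (t, ξ t) := by
  have h0 : (0 : ℝ) ∈ Icc (-ρ) ρ := ⟨neg_nonpos.2 hρ, hρ⟩
  have hpl : IsPicardLindelof (fun t y => f (t, y)) (⟨0, h0⟩ : Icc (-ρ) ρ) σ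
      (C * ρ.toNNReal) 0 C K :=
    { lipschitzOnWith := fun t _ => (hK t).lipschitzOnWith
      continuousOn := fun y _ => (hf.comp (by fun_prop)).continuousOn
      norm_le := fun t _ y _ => hC _
      mul_max_le := by simp [hρ] }
  obtain ⟨α, hα0, hα⟩ := hpl.exists_eq_forall_mem_Icc_hasDerivWithinAt₀
  obtain ⟨ξ, hξ, hαξ⟩ := ((convex_Icc _ _).lipschitzOnWith_of_nnnorm_hasDerivWithin_le hα
    fun t _ => by rw [← NNReal.coe_le_coe]; exact hC _).extend_real
  refine ⟨ξ, hξ, fun x hx => ?_⟩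
  have hderiv : ∀ t ∈ Ioo (min 0 x) (max 0 x), HasDerivWithinAt ξ (f (t, ξ t)) (Ioi t) t := by
    intro t ht
    have ht' : t ∈ Ioo (-ρ) ρ :=
      ⟨(le_min h0.1 hx.1).trans_lt ht.1, ht.2.trans_le (max_le h0.2 hx.2)⟩
    have hnhds : Icc (-ρ) ρ ∈ 𝓝 t := Icc_mem_nhds ht'.1 ht'.2
    rw [← hαξ (Ioo_subset_Icc_self ht')]
    exact (((hα t (Ioo_subset_Icc_self ht')).hasDerivAt hnhds).congr_of_eventuallyEq
      (hαξ.symm.eventuallyEq_of_mem hnhds)).hasDerivWithinAt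
  rw [intervalIntegral.integral_eq_sub_of_hasDeriv_right hξ.continuous.continuousOn hderiv
    (hf.comp (continuous_id.prodMk hξ.continuous)).continuousOn.intervalIntegrable, ← hαξ h0]
  simp [hα0]

lemma lipschitzWith_average {f : ℝ → ℝ} (hf : Continuous f) {C : ℝ≥0} (hC : ∀ z, |f z| ≤ C)
    {ε : ℝ} (hε : 0 < ε) :
    LipschitzWith (2 * C / ε.toNNReal) fun y => ∫ z in (0 : ℝ)..1, f (y + ε * z) := by
  have hint (a b : ℝ) : IntervalIntegrable f volume a b := hf.intervalIntegrable a b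
  have hbound (a b : ℝ) : |∫ z in a..b, f z| ≤ C * |b - a| :=
    intervalIntegral.norm_integral_le_of_norm_le_const (f := f) fun x _ => hC x
  have haverage (y : ℝ) : ∫ z in (0 : ℝ)..1, f (y + ε * z) = ε⁻¹ * ∫ z in y..(y + ε), f z := by
    simp [intervalIntegral.integral_comp_add_mul f hε.ne']
  refine LipschitzWith.of_dist_le_mul fun y y' => ?_
  rw [Real.dist_eq, haverage, haverage, ← mul_sub, abs_mul, abs_of_pos (inv_pos.2 hε),
    intervalIntegral.integral_interval_sub_interval_comm' (hint _ _) (hint _ _) (hint _ _)]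
  calc ε⁻¹ * |(∫ z in (y' + ε)..(y + ε), f z) - ∫ z in y'..y, f z|
      ≤ ε⁻¹ * (C * |(y + ε) - (y' + ε)| + C * |y - y'|) := by
        gcongr
        exact (abs_sub _ _).trans (add_le_add (hbound _ _) (hbound _ _))
    _ = (2 * C / ε.toNNReal : ℝ≥0) * dist y y' := by
        push_cast
        rw [Real.coe_toNNReal _ hε.le, Real.dist_eq, add_sub_add_right_eq_sub]
        ring

lemma exists_subseq_tendsto_on_Icc {C : ℝ≥0} {ξ : ℕ → ℝ → ℝ} (hξ : ∀ n, LipschitzWith C (ξ n))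
    {σ : ℝ} (hσ : ∀ n, ξ n 0 = σ) {ρ : ℝ} (hρ : 0 ≤ ρ) :
    ∃ ζ : ℝ → ℝ, LipschitzWith C ζ ∧ ∃ φ : ℕ → ℕ, StrictMono φ ∧
      ∀ x ∈ Icc (-ρ) ρ, Tendsto (fun k => ξ (φ k) x) atTop (𝓝 (ζ x)) := by
  have hle : -ρ ≤ ρ := by linarith
  have hmem (n : ℕ) (x : Icc (-ρ) ρ) : ξ n x ∈ Metric.closedBall σ (C * ρ) := by
    have hx : dist (x : ℝ) 0 ≤ ρ := by simpa using abs_le.2 x.2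
    rw [Metric.mem_closedBall, ← hσ n]
    exact ((hξ n).dist_le_mul _ _).trans (by gcongr)
  obtain ⟨g, hg, φ, hφ, hlim⟩ := exists_subseq_tendsto_of_lipschitzWith
    (f := fun n (x : Icc (-ρ) ρ) => ξ n x)
    (fun n => LipschitzWith.of_dist_le_mul fun x y => (hξ n).dist_le_mul x y)
    (isCompact_closedBall σ (C * ρ)) hmem
  refine ⟨fun x => g (projIcc (-ρ) ρ hle x), ?_, φ, hφ, fun x hx => ?_⟩
  · have h := hg.comp (LipschitzWith.projIcc hle)
    rwa [mul_one] at h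
  · simpa only [projIcc_of_mem hle hx] using hlim ⟨x, hx⟩

lemma tendsto_integral_comp_of_bounded {α : Type*} [TopologicalSpace α] {M : α × ℝ × ℝ → ℝ}
    (hM : Continuous M) {C : ℝ} (hC : ∀ p, |M p| ≤ C) {ε : ℕ → α} {ε₀ : α}
    (hε : Tendsto ε atTop (𝓝 ε₀)) {ξ : ℕ → ℝ → ℝ} (hξ : ∀ n, Continuous (ξ n)) {ζ : ℝ → ℝ}
    {a b : ℝ} (hlim : ∀ t ∈ uIcc a b, Tendsto (fun n => ξ n t) atTop (𝓝 (ζ t))) :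
    Tendsto (fun n => ∫ t in a..b, M (ε n, t, ξ n t)) atTop
      (𝓝 (∫ t in a..b, M (ε₀, t, ζ t))) :=
  intervalIntegral.tendsto_integral_filter_of_dominated_convergence (fun _ => C)
    (.of_forall fun n => (hM.comp (continuous_const.prodMk
      (continuous_id.prodMk (hξ n)))).aestronglyMeasurable)
    (.of_forall fun _ => ae_of_all _ fun _ _ => hC _) (by simp)
    (ae_of_all _ fun t ht => (hM.tendsto (ε₀, t, ζ t)).comp (hε.prodMk_nhds
      (tendsto_const_nhds.prodMk_nhds (hlim t (uIoc_subset_uIcc ht)))))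

/- Peano's theorem: solutions for the averages of `m` over `[y, y + ε]`, which are Lipschitz in `y`,
subconverge as `ε` tends to zero. -/
lemma exists_lipschitzWith_forall_hasDerivAt {m : ℝ × ℝ → ℝ} (hm : Continuous m) {C : ℝ≥0}
    (hC : ∀ z, |m z| ≤ C) (σ : ℝ) {ρ : ℝ} (hρ : 0 ≤ ρ) :
    ∃ ξ : ℝ → ℝ, ξ 0 = σ ∧ LipschitzWith C ξ ∧
      ∀ x ∈ Ioo (-ρ) ρ, HasDerivAt ξ (m (x, ξ x)) x := by
  have h0 : (0 : ℝ) ∈ Icc (-ρ) ρ := ⟨neg_nonpos.2 hρ, hρ⟩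
  let M : ℝ × ℝ × ℝ → ℝ := fun p => ∫ y in (0 : ℝ)..1, m (p.2.1, p.2.2 + p.1 * y)
  have hM : Continuous M :=
    intervalIntegral.continuous_parametric_intervalIntegral_of_continuous' (μ := volume)
      (f := fun (p : ℝ × ℝ × ℝ) y => m (p.2.1, p.2.2 + p.1 * y)) (hm.comp (by fun_prop)) _ _
  have hMC (p : ℝ × ℝ × ℝ) : |M p| ≤ C := by
    simpa using intervalIntegral.norm_integral_le_of_norm_le_const (a := 0) (b := 1) (C := C)
      (f := fun y => m (p.2.1, p.2.2 + p.1 * y)) fun x _ => hC _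
  have hM0 (z : ℝ × ℝ) : M (0, z) = m z := by simp [M]
  choose ξ hξlip hξ using fun n : ℕ => exists_lipschitzWith_eq_add_integral
    (f := fun z => M (1 / ((n : ℝ) + 1), z)) (hM.comp (continuous_const.prodMk continuous_id))
    (fun z => hMC _) (fun t => lipschitzWith_average (f := fun y => m (t, y))
      (hm.comp (by fun_prop)) (fun z => hC _) Nat.one_div_pos_of_nat) σ hρ
  obtain ⟨ζ, hζ, φ, hφ, hlim⟩ := exists_subseq_tendsto_on_Icc hξlip (σ := σ)
    (fun n => by simp [hξ n 0 h0]) hρ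
  have hζint : ∀ x ∈ Icc (-ρ) ρ, ζ x = σ + ∫ t in (0 : ℝ)..x, m (t, ζ t) := by
    intro x hx
    have hconv := tendsto_integral_comp_of_bounded hM hMC
      (tendsto_one_div_add_atTop_nhds_zero_nat.comp hφ.tendsto_atTop)
      (fun k => (hξlip (φ k)).continuous) fun t ht => hlim t (uIcc_subset_Icc h0 hx ht)
    simp only [hM0] at hconv
    exact tendsto_nhds_unique (hlim x hx)
      ((hconv.const_add σ).congr fun k => (hξ _ x hx).symm)
  refine ⟨ζ, by simp [hζint 0 h0], hζ, fun x hx => ?_⟩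
  refine ((hasDerivAt_integral_of_continuousOn isOpen_univ ordConnected_univ
    (hm.comp (continuous_id.prodMk hζ.continuous)).continuousOn (mem_univ 0)
    (mem_univ x)).const_add σ).congr_of_eventuallyEq ?_
  filter_upwards [Icc_mem_nhds hx.1 hx.2] with y hy using hζint y hy

end Peano

section Columns

variable {E F : Type*} [NormedAddCommGroup E] [NormedSpace ℝ E] [NormedAddCommGroup F]
  [NormedSpace ℝ F]

/-- The linear map from the plane with columns `a` and `b`, used to write down derivatives of maps
of two variables in terms of their partial derivatives. -/
noncomputable def columnsP (a b : E) : Plane →L[ℝ] E :=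
  (ContinuousLinearMap.fst ℝ ℝ ℝ).smulRight a + (ContinuousLinearMap.snd ℝ ℝ ℝ).smulRight b

lemma columnsP_apply (a b : E) (v : Plane) : columnsP a b v = v.1 • a + v.2 • b := by
  simp [columnsP]

lemma continuousOn_columnsP {α : Type*} [TopologicalSpace α] {a b : α → E} {s : Set α}
    (ha : ContinuousOn a s) (hb : ContinuousOn b s) :
    ContinuousOn (fun x => columnsP (a x) (b x)) s := by
  have hL (L : Plane →L[ℝ] ℝ) : Continuous fun x : E => L.smulRight x :=
    (ContinuousLinearMap.smulRightL ℝ Plane E L).continuous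
  exact ((hL _).comp_continuousOn ha).add ((hL _).comp_continuousOn hb)

lemma contDiffOn_one_of_hasFDerivAt {f : E → F} {f' : E → E →L[ℝ] F} {U : Set E} (hU : IsOpen U)
    (hf : ∀ x ∈ U, HasFDerivAt f (f' x) x) (hf' : ContinuousOn f' U) : ContDiffOn ℝ 1 f U :=
  fun _ hx => (contDiffAt_one_iff.2 ⟨f', U, hU.mem_nhds hx, hf', hf⟩).contDiffWithinAt

lemma hasStrictFDerivAt_of_partials {f a b : Plane → E} {U : Set Plane} (hU : IsOpen U)
    (ha : ∀ q ∈ U, HasDerivAt (fun x => f (x, q.2)) (a q) q.1)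
    (hb : ∀ q ∈ U, HasDerivAt (fun y => f (q.1, y)) (b q) q.2)
    (hac : ContinuousOn a U) (hbc : ContinuousOn b U) {q : Plane} (hq : q ∈ U) :
    HasStrictFDerivAt f (columnsP (a q) (b q)) q := by
  have hn := hU.mem_nhds hq
  have hT : Continuous fun x : E => ContinuousLinearMap.toSpanSingleton ℝ x :=
    (ContinuousLinearMap.toSpanSingletonCLE (𝕜 := ℝ) (E := E)).continuous
  have hstrict := hasStrictFDerivAt_uncurry_coprod (𝕜 := ℝ) (u := q) (f := fun x y => f (x, y))
    (f₁ := fun x y => ContinuousLinearMap.toSpanSingleton ℝ (a (x, y)))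
    (f₂ := fun x y => ContinuousLinearMap.toSpanSingleton ℝ (b (x, y)))
    (by filter_upwards [hn] with z hz using (ha z hz).hasFDerivAt)
    (by filter_upwards [hn] with z hz using (hb z hz).hasFDerivAt)
    (hT.continuousAt.comp (hac.continuousAt hn)) (hT.continuousAt.comp (hbc.continuousAt hn))
  refine hstrict.congr_fderiv ?_
  ext <;> simp [columnsP_apply, Function.HasUncurry.uncurry]

lemma contDiffOn_one_of_partials {f a b : Plane → E} {U : Set Plane} (hU : IsOpen U)
    (ha : ∀ q ∈ U, HasDerivAt (fun x => f (x, q.2)) (a q) q.1)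
    (hb : ∀ q ∈ U, HasDerivAt (fun y => f (q.1, y)) (b q) q.2)
    (hac : ContinuousOn a U) (hbc : ContinuousOn b U) : ContDiffOn ℝ 1 f U :=
  contDiffOn_one_of_hasFDerivAt hU
    (fun _ hq => (hasStrictFDerivAt_of_partials hU ha hb hac hbc hq).hasFDerivAt)
    (continuousOn_columnsP hac hbc)

/-- The inverse of `columnsP a b`, by Cramer's rule; meaningful when `wedgeP a b ≠ 0`. -/
noncomputable def invColumnsP (a b : Plane) : Plane →L[ℝ] Plane :=
  (wedgeP a b)⁻¹ • columnsP (b.2, -a.2) (-b.1, a.1)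

lemma invColumnsP_columnsP {a b : Plane} (h : wedgeP a b ≠ 0) (v : Plane) :
    invColumnsP a b (columnsP a b v) = v := by
  have hadj : columnsP (b.2, -a.2) (-b.1, a.1) (columnsP a b v) = wedgeP a b • v := by
    ext <;> simp [columnsP_apply, wedgeP] <;> ring
  rw [invColumnsP, smul_apply, hadj, inv_smul_smul₀ h]

lemma columnsP_invColumnsP {a b : Plane} (h : wedgeP a b ≠ 0) (v : Plane) :
    columnsP a b (invColumnsP a b v) = v := by
  have hadj : columnsP a b (columnsP (b.2, -a.2) (-b.1, a.1) v) = wedgeP a b • v := by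
    ext <;> simp [columnsP_apply, wedgeP] <;> ring
  rw [invColumnsP, smul_apply, map_smul, hadj, inv_smul_smul₀ h]

/-- The linear automorphism of the plane with independent columns `a` and `b`, in the form the
inverse function theorem asks for. -/
noncomputable def columnsEquivP (a b : Plane) (h : wedgeP a b ≠ 0) : Plane ≃L[ℝ] Plane :=
  .equivOfInverse (columnsP a b) (invColumnsP a b) (invColumnsP_columnsP h) (columnsP_invColumnsP h)

lemma continuousOn_invColumnsP {α : Type*} [TopologicalSpace α] {a b : α → Plane} {s : Set α}
    (ha : ContinuousOn a s) (hb : ContinuousOn b s) (hab : ∀ x ∈ s, wedgeP (a x) (b x) ≠ 0) :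
    ContinuousOn (fun x => invColumnsP (a x) (b x)) s := by
  exact ((continuousOn_wedgeP ha hb).inv₀ hab).smul
    (continuousOn_columnsP (hb.snd.prodMk ha.snd.neg) (hb.fst.neg.prodMk ha.fst))

lemma exists_openPartialHomeomorph_of_columns {Ξ a b : Plane → Plane} {S : Set Plane}
    (hS : IsOpen S) (hΞ : ∀ z ∈ S, HasFDerivAt Ξ (columnsP (a z) (b z)) z)
    (ha : ContinuousOn a S) (hb : ContinuousOn b S) (hab : ∀ z ∈ S, wedgeP (a z) (b z) ≠ 0)
    {z₀ : Plane} (hz₀ : z₀ ∈ S) :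
    ∃ e : OpenPartialHomeomorph Plane Plane, z₀ ∈ e.source ∧ e.source ⊆ S ∧ (∀ z, e z = Ξ z) ∧
      ContDiffOn ℝ 1 e e.source ∧ ContDiffOn ℝ 1 e.symm e.target ∧
      ∀ q ∈ e.target, HasFDerivAt e.symm (invColumnsP (a (e.symm q)) (b (e.symm q))) q := by
  have hC : ContDiffOn ℝ 1 Ξ S :=
    contDiffOn_one_of_hasFDerivAt hS hΞ (continuousOn_columnsP ha hb)
  have hstrict : HasStrictFDerivAt Ξ (columnsEquivP _ _ (hab z₀ hz₀) : Plane →L[ℝ] Plane) z₀ :=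
    (hC.contDiffAt (hS.mem_nhds hz₀)).hasStrictFDerivAt' (hΞ z₀ hz₀) one_ne_zero
  let e := (hstrict.toOpenPartialHomeomorph Ξ).restrOpen S hS
  have hes : e.source ⊆ S := fun z (hz : z ∈ _ ∩ S) => hz.2
  have hmaps : MapsTo e.symm e.target S := fun q hq => hes (e.map_target hq)
  have hder : ∀ q ∈ e.target,
      HasFDerivAt e.symm (invColumnsP (a (e.symm q)) (b (e.symm q))) q := fun q hq =>
    e.hasFDerivAt_symm (f' := columnsEquivP _ _ (hab _ (hmaps hq))) hq (hΞ _ (hmaps hq))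
  have hsymm := e.continuousOn_symm
  exact ⟨e, ⟨hstrict.mem_toOpenPartialHomeomorph_source, hz₀⟩, hes, fun z => rfl, hC.mono hes,
    contDiffOn_one_of_hasFDerivAt e.open_target hder (continuousOn_invColumnsP
      (ha.comp hsymm hmaps) (hb.comp hsymm hmaps) fun q hq => hab _ (hmaps hq)), hder⟩

end Columns

/-! ### Trajectories of a continuous field with continuous divergence -/

lemma eq_of_hasDerivAt_zero {E : Type*} [NormedAddCommGroup E] [NormedSpace ℝ E] {f : ℝ → E}
    {a b : ℝ} (hf : ∀ x ∈ Ioo a b, HasDerivAt f 0 x) {x y : ℝ} (hx : x ∈ Ioo a b)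
    (hy : y ∈ Ioo a b) : f x = f y := by
  have hbound := (convex_Ioo a b).norm_image_sub_le_of_norm_hasDerivWithin_le (C := 0)
    (fun z hz => (hf z hz).hasDerivWithinAt) (fun _ _ => by simp) hy hx
  rw [zero_mul] at hbound
  exact sub_eq_zero.1 (norm_le_zero_iff.1 hbound)

lemma eq_mul_exp_of_hasDerivAt {A k : ℝ → ℝ} {a b x₀ : ℝ} (hk : Continuous k)
    (hA : ∀ x ∈ Ioo a b, HasDerivAt A (k x * A x) x) (hx₀ : x₀ ∈ Ioo a b) {x : ℝ}
    (hx : x ∈ Ioo a b) : A x = A x₀ * Real.exp (∫ z in x₀..x, k z) := by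
  have hquot : ∀ x ∈ Ioo a b, HasDerivAt (fun x => A x * Real.exp (-∫ z in x₀..x, k z)) 0 x :=
    fun x hx => ((hA x hx).mul
      (hk.integral_hasStrictDerivAt x₀ x).hasDerivAt.fun_neg.exp).congr_deriv (by ring)
  have hconst := eq_of_hasDerivAt_zero hquot hx hx₀
  simp only [intervalIntegral.integral_same, neg_zero, Real.exp_zero, mul_one] at hconst
  rw [← hconst, mul_assoc, ← Real.exp_add, neg_add_cancel, Real.exp_zero, mul_one]

/-- The mean of `f` over the vertical segment from `(x, y)` to `(x, y')`, at `z = (x, y, y')`. -/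
noncomputable def segmentMean (f : Plane → ℝ) (z : ℝ × ℝ × ℝ) : ℝ :=
  ∫ r in (0 : ℝ)..1, f (z.1, z.2.1 + r * (z.2.2 - z.2.1))

lemma continuous_segmentMean {f : Plane → ℝ} (hf : Continuous f) : Continuous (segmentMean f) :=
  intervalIntegral.continuous_parametric_intervalIntegral_of_continuous' (μ := volume)
    (f := fun (z : ℝ × ℝ × ℝ) r => f (z.1, z.2.1 + r * (z.2.2 - z.2.1)))
    (hf.comp (by fun_prop)) _ _

lemma segmentMean_diag (f : Plane → ℝ) (x y : ℝ) : segmentMean f (x, y, y) = f (x, y) := by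
  simp [segmentMean]

lemma le_segmentMean {f : Plane → ℝ} (hf : Continuous f) {a : ℝ} (h : ∀ z, a ≤ f z)
    (z : ℝ × ℝ × ℝ) : a ≤ segmentMean f z := by
  have hmono := intervalIntegral.integral_mono_on (a := 0) (b := 1) (μ := volume)
    (f := fun _ => a) (g := fun r => f (z.1, z.2.1 + r * (z.2.2 - z.2.1))) zero_le_one (by simp)
    ((hf.comp (by fun_prop)).intervalIntegrable _ _) fun r _ => h _
  simpa [segmentMean] using! hmono

lemma abs_segmentMean_le {f : Plane → ℝ} {B : ℝ} (h : ∀ z, |f z| ≤ B) (z : ℝ × ℝ × ℝ) :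
    |segmentMean f z| ≤ B := by
  simpa [segmentMean] using! intervalIntegral.norm_integral_le_of_norm_le_const
    (a := 0) (b := 1) (C := B) (f := fun r => f (z.1, z.2.1 + r * (z.2.2 - z.2.1)))
    fun r _ => h _

lemma exists_continuous_eqOn_square {E : Type*} [TopologicalSpace E] {f : Plane → E} {ρ : ℝ}
    (hρ : 0 ≤ ρ) (hf : ContinuousOn f (Icc (-ρ) ρ ×ˢ Icc (-ρ) ρ)) :
    ∃ g : Plane → E, Continuous g ∧ EqOn g f (Icc (-ρ) ρ ×ˢ Icc (-ρ) ρ) ∧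
      ∀ z, ∃ w ∈ Icc (-ρ) ρ ×ˢ Icc (-ρ) ρ, g z = f w := by
  let π : ℝ → Icc (-ρ) ρ := projIcc (-ρ) ρ (by linarith)
  have hπ (z : Plane) : ((π z.1 : ℝ), (π z.2 : ℝ)) ∈ Icc (-ρ) ρ ×ˢ Icc (-ρ) ρ :=
    ⟨(π z.1).2, (π z.2).2⟩
  have hπc : Continuous π := continuous_projIcc
  refine ⟨fun z => f (π z.1, π z.2), hf.comp_continuous (by fun_prop) hπ, fun z hz => ?_,
    fun z => ⟨_, hπ z, rfl⟩⟩
  simp only [π, projIcc_of_mem _ hz.1, projIcc_of_mem _ hz.2]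

/-- The slope of the direction of `X` at `z`; meaningful when the first component is not zero. -/
noncomputable def slopeP (X : Plane → Plane) (z : Plane) : ℝ :=
  (X z).2 / (X z).1

lemma wedgeP_one_slopeP {X : Plane → Plane} {z : Plane} (hz : (X z).1 ≠ 0) :
    wedgeP (X z) (1, slopeP X z) = 0 := by
  simp [wedgeP, slopeP, mul_div_cancel₀ _ hz]

/-- The graph of `ξ` over `(-r, r)` is a trajectory of `X` in `Ω`, up to parametrization. -/
structure IsTrajectoryGraph (X : Plane → Plane) (Ω : Set Plane) (r : ℝ) (ξ : ℝ → ℝ) : Prop where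
  continuous : Continuous ξ
  mem : ∀ x ∈ Ioo (-r) r, (x, ξ x) ∈ Ω
  hasDerivAt : ∀ x ∈ Ioo (-r) r, HasDerivAt ξ (slopeP X (x, ξ x)) x

/- No flux crosses a trajectory, so the divergence theorem on the region between two of them gives
the change of the flux through the vertical segment that joins them. -/
lemma HasUniformDiv.hasDerivAt_segmentMean_mul_sub {Ω : Set Plane} {X : Plane → Plane}
    {h : Plane → ℝ} (hdiv : HasUniformDiv Ω X h) (hΩ : Convex ℝ Ω) (hX : Continuous X)
    (hh : Continuous h) (hX0 : ∀ z, (X z).1 ≠ 0) {r : ℝ} {ξ₁ ξ₂ : ℝ → ℝ}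
    (h₁ : IsTrajectoryGraph X Ω r ξ₁) (h₂ : IsTrajectoryGraph X Ω r ξ₂) {x : ℝ}
    (hx : x ∈ Ioo (-r) r) :
    HasDerivAt (fun x => segmentMean (fun z => (X z).1) (x, ξ₁ x, ξ₂ x) * (ξ₂ x - ξ₁ x))
      (segmentMean h (x, ξ₁ x, ξ₂ x) * (ξ₂ x - ξ₁ x)) x := by
  have hξ₁ := h₁.continuous
  have hξ₂ := h₂.continuous
  have hslope : Continuous (slopeP X) := hX.snd.div hX.fst hX0
  have hk : Continuous fun x => segmentMean h (x, ξ₁ x, ξ₂ x) * (ξ₂ x - ξ₁ x) :=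
    ((continuous_segmentMean hh).comp (continuous_id.prodMk (hξ₁.prodMk hξ₂))).mul (hξ₂.sub hξ₁)
  refine hasDerivAt_of_integral_eq (k := fun x => segmentMean h (x, ξ₁ x, ξ₂ x) * (ξ₂ x - ξ₁ x))
    hk.continuousOn hx fun a ha b hb _ => ?_
  have hsub : uIcc a b ⊆ Ioo (-r) r := ordConnected_Ioo.uIcc_subset ha hb
  have hflux := hdiv.flux_patch (c := fun x => (x, ξ₁ x)) (w := fun x => (0, ξ₂ x - ξ₁ x))
    (c' := fun x => (1, slopeP X (x, ξ₁ x)))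
    (w' := fun x => (0, slopeP X (x, ξ₂ x) - slopeP X (x, ξ₁ x))) (a := a) (b := b)
    (fun s hs => (hasDerivAt_id s).prodMk (h₁.hasDerivAt s (hsub hs)))
    (fun s hs => (hasDerivAt_const s 0).prodMk
      ((h₂.hasDerivAt s (hsub hs)).sub (h₁.hasDerivAt s (hsub hs))))
    (by fun_prop) (by fun_prop) fun s hs t ht => by
      simpa using hΩ.add_smul_sub_mem (h₁.mem s (hsub hs)) (h₂.mem s (hsub hs)) ht
  simp only [fluxP, Prod.smul_mk, smul_eq_mul, Prod.mk_add_mk, mul_zero, add_zero, add_sub_cancel,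
    wedgeP_one_slopeP (hX0 _), intervalIntegral.integral_zero, sub_zero, zero_sub] at hflux
  simp only [wedgeP, mul_zero, sub_zero, zero_mul, zero_sub, mul_one, mul_neg,
    intervalIntegral.integral_neg, intervalIntegral.integral_mul_const] at hflux
  simp only [segmentMean]
  linarith

/-- The ratio between the distances of two trajectories `ξ₁` and `ξ₂` of `X`, whose divergence is
`h`, at the abscissas `x` and `0`; see `IsTransverseField.sub_eq_mul_spreadFactor`. -/
noncomputable def spreadFactor (X : Plane → Plane) (h : Plane → ℝ) (ξ₁ ξ₂ : ℝ → ℝ) (x : ℝ) : ℝ :=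
  segmentMean (fun z => (X z).1) (0, ξ₁ 0, ξ₂ 0) / segmentMean (fun z => (X z).1) (x, ξ₁ x, ξ₂ x) *
    Real.exp (∫ y in (0 : ℝ)..x,
      segmentMean h (y, ξ₁ y, ξ₂ y) / segmentMean (fun z => (X z).1) (y, ξ₁ y, ξ₂ y))

lemma spreadFactor_self (X : Plane → Plane) (h : Plane → ℝ) (ξ : ℝ → ℝ) (x : ℝ) :
    spreadFactor X h ξ ξ x = (X (0, ξ 0)).1 / (X (x, ξ x)).1 *
      Real.exp (∫ y in (0 : ℝ)..x, h (y, ξ y) / (X (y, ξ y)).1) := by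
  simp only [spreadFactor, segmentMean_diag]

/-- A field with divergence `h` in `Ω` that is uniformly transverse to the vertical lines; `X` and
`h` are continuous and bounded on the whole plane, which costs nothing locally. -/
structure IsTransverseField (Ω : Set Plane) (X : Plane → Plane) (h : Plane → ℝ) (α B : ℝ) :
    Prop where
  continuous : Continuous X
  continuous_div : Continuous h
  hasUniformDiv : HasUniformDiv Ω X h
  pos : 0 < α
  le_fst : ∀ z, α ≤ (X z).1
  fst_le : ∀ z, (X z).1 ≤ B
  abs_snd_le : ∀ z, |(X z).2| ≤ (X z).1
  abs_div_le : ∀ z, |h z| ≤ B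

namespace IsTransverseField

variable {Ω : Set Plane} {X : Plane → Plane} {h : Plane → ℝ} {α B : ℝ}

lemma fst_pos (H : IsTransverseField Ω X h α B) (z : Plane) : 0 < (X z).1 :=
  H.pos.trans_le (H.le_fst z)

lemma continuous_slopeP (H : IsTransverseField Ω X h α B) : Continuous (slopeP X) :=
  H.continuous.snd.div H.continuous.fst fun z => (H.fst_pos z).ne'

lemma abs_slopeP_le_one (H : IsTransverseField Ω X h α B) (z : Plane) : |slopeP X z| ≤ 1 := by
  rw [slopeP, abs_div, abs_of_pos (H.fst_pos z)]
  exact div_le_one_of_le₀ (H.abs_snd_le z) (H.fst_pos z).le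

lemma continuous_segmentMean_fst (H : IsTransverseField Ω X h α B) :
    Continuous (segmentMean fun z => (X z).1) :=
  continuous_segmentMean H.continuous.fst

lemma le_segmentMean_fst (H : IsTransverseField Ω X h α B) (z : ℝ × ℝ × ℝ) :
    α ≤ segmentMean (fun z => (X z).1) z :=
  le_segmentMean H.continuous.fst H.le_fst z

lemma segmentMean_fst_pos (H : IsTransverseField Ω X h α B) (z : ℝ × ℝ × ℝ) :
    0 < segmentMean (fun z => (X z).1) z :=
  H.pos.trans_le (H.le_segmentMean_fst z)

lemma segmentMean_fst_le (H : IsTransverseField Ω X h α B) (z : ℝ × ℝ × ℝ) :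
    segmentMean (fun z => (X z).1) z ≤ B :=
  (le_abs_self _).trans (abs_segmentMean_le
    (fun z => (abs_of_pos (H.fst_pos z)).trans_le (H.fst_le z)) z)

lemma bound_pos (H : IsTransverseField Ω X h α B) : 0 < B :=
  (H.fst_pos 0).trans_le (H.fst_le 0)

lemma continuous_segmentMean_div (H : IsTransverseField Ω X h α B) :
    Continuous fun z => segmentMean h z / segmentMean (fun z => (X z).1) z :=
  (continuous_segmentMean H.continuous_div).div H.continuous_segmentMean_fst
    fun z => (H.segmentMean_fst_pos z).ne'

lemma continuous_spreadFactor (H : IsTransverseField Ω X h α B) {ξ : Plane → ℝ}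
    (hξ : Continuous ξ) :
    Continuous fun p : ℝ × ℝ × ℝ =>
      spreadFactor X h (fun x => ξ (p.1, x)) (fun x => ξ (p.2.1, x)) p.2.2 := by
  have hmean := H.continuous_segmentMean_fst
  refine ((hmean.comp (by fun_prop)).div (hmean.comp (by fun_prop))
    fun p => (H.segmentMean_fst_pos _).ne').mul (Real.continuous_exp.comp ?_)
  exact intervalIntegral.continuous_parametric_intervalIntegral_of_continuous
    (f := fun (p : ℝ × ℝ × ℝ) y => segmentMean h (y, ξ (p.1, y), ξ (p.2.1, y)) /
      segmentMean (fun z => (X z).1) (y, ξ (p.1, y), ξ (p.2.1, y)))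
    (H.continuous_segmentMean_div.comp (by fun_prop)) (by fun_prop)

lemma abs_spreadFactor_le (H : IsTransverseField Ω X h α B) (ξ₁ ξ₂ : ℝ → ℝ) {r x : ℝ}
    (hx : x ∈ Ioo (-r) r) : |spreadFactor X h ξ₁ ξ₂ x| ≤ B / α * Real.exp (B / α * r) := by
  have hB := H.bound_pos
  have hα := H.pos
  have hpos := H.segmentMean_fst_pos
  have hquot (z : ℝ × ℝ × ℝ) : |segmentMean h z / segmentMean (fun z => (X z).1) z| ≤ B / α := by
    rw [abs_div, abs_of_pos (hpos z)]
    exact div_le_div₀ hB.le (abs_segmentMean_le H.abs_div_le z) hα (H.le_segmentMean_fst z)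
  have hexp : ∫ y in (0 : ℝ)..x, segmentMean h (y, ξ₁ y, ξ₂ y) /
      segmentMean (fun z => (X z).1) (y, ξ₁ y, ξ₂ y) ≤ B / α * r :=
    calc _ ≤ B / α * |x - 0| := (Real.le_norm_self _).trans
          (intervalIntegral.norm_integral_le_of_norm_le_const fun y _ => hquot _)
      _ ≤ B / α * r := by
          rw [sub_zero]
          gcongr
          exact (abs_lt.2 hx).le
  rw [spreadFactor, abs_of_pos (mul_pos (div_pos (hpos _) (hpos _)) (Real.exp_pos _))]
  gcongr
  exacts [H.segmentMean_fst_le _, H.le_segmentMean_fst _]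

lemma sub_eq_mul_spreadFactor (H : IsTransverseField Ω X h α B) (hΩ : Convex ℝ Ω) {r : ℝ}
    {ξ₁ ξ₂ : ℝ → ℝ} (h₁ : IsTrajectoryGraph X Ω r ξ₁) (h₂ : IsTrajectoryGraph X Ω r ξ₂) {x : ℝ}
    (hx : x ∈ Ioo (-r) r) : ξ₂ x - ξ₁ x = (ξ₂ 0 - ξ₁ 0) * spreadFactor X h ξ₁ ξ₂ x := by
  have hne := fun z => (H.segmentMean_fst_pos z).ne'
  have h0 : (0 : ℝ) ∈ Ioo (-r) r := by
    constructor <;> linarith [hx.1, hx.2]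
  have hk : Continuous fun y => segmentMean h (y, ξ₁ y, ξ₂ y) /
      segmentMean (fun z => (X z).1) (y, ξ₁ y, ξ₂ y) :=
    H.continuous_segmentMean_div.comp (continuous_id.prodMk (h₁.continuous.prodMk h₂.continuous))
  have hflux := eq_mul_exp_of_hasDerivAt hk (fun y hy =>
    (H.hasUniformDiv.hasDerivAt_segmentMean_mul_sub hΩ H.continuous H.continuous_div
      (fun z => (H.fst_pos z).ne') h₁ h₂ hy).congr_deriv (by field_simp [hne])) h0 hx
  rw [spreadFactor, div_mul_eq_mul_div, mul_div_assoc', eq_div_iff (hne _)]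
  linear_combination hflux

end IsTransverseField

/-- A continuous family of trajectories of `X` in `Ω`, parametrized by their ordinate `σ` at the
abscissa `0`; the trajectory through `(0, σ)` is the graph of `fun x => ξ (σ, x)`. -/
structure IsTrajectoryFamily (X : Plane → Plane) (Ω : Set Plane) (r : ℝ) (ξ : Plane → ℝ) :
    Prop where
  continuous : Continuous ξ
  initial : ∀ σ ∈ Ioo (-r) r, ξ (σ, 0) = σ
  isTrajectoryGraph : ∀ σ ∈ Ioo (-r) r, IsTrajectoryGraph X Ω r fun x => ξ (σ, x)

namespace IsTransverseField

variable {X : Plane → Plane} {h : Plane → ℝ} {α B : ℝ}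

/- Trajectories are differentiable in the initial value because the difference quotients are spread
factors, which are continuous. -/
lemma hasDerivAt_initial {Ω : Set Plane} (H : IsTransverseField Ω X h α B) (hΩ : Convex ℝ Ω)
    {r : ℝ} {ξ : Plane → ℝ} (hξ : IsTrajectoryFamily X Ω r ξ) {σ x : ℝ} (hσ : σ ∈ Ioo (-r) r)
    (hx : x ∈ Ioo (-r) r) :
    HasDerivAt (fun σ => ξ (σ, x))
      (spreadFactor X h (fun x => ξ (σ, x)) (fun x => ξ (σ, x)) x) σ := by
  have hcont : Continuous fun σ' =>
      spreadFactor X h (fun x => ξ (σ, x)) (fun x => ξ (σ', x)) x :=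
    (H.continuous_spreadFactor hξ.continuous).comp
      (by fun_prop : Continuous fun σ' : ℝ => (σ, σ', x))
  rw [hasDerivAt_iff_tendsto_slope]
  refine ((hcont.tendsto σ).mono_left nhdsWithin_le_nhds).congr' ?_
  filter_upwards [self_mem_nhdsWithin, mem_nhdsWithin_of_mem_nhds (Ioo_mem_nhds hσ.1 hσ.2)]
    with σ' hne hσ'
  rw [slope_def_field, H.sub_eq_mul_spreadFactor hΩ (hξ.isTrajectoryGraph σ hσ)
    (hξ.isTrajectoryGraph σ' hσ') hx, hξ.initial σ hσ, hξ.initial σ' hσ',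
    mul_div_cancel_left₀ _ (sub_ne_zero.2 hne)]

lemma exists_isTrajectoryGraph {ρ : ℝ} (hρ : 0 < ρ)
    (H : IsTransverseField (Ioo (-ρ) ρ ×ˢ Ioo (-ρ) ρ) X h α B) (σ : ℝ) :
    ∃ η : ℝ → ℝ, η 0 = σ ∧ LipschitzWith 1 η ∧ (σ ∈ Ioo (-(ρ / 2)) (ρ / 2) →
      IsTrajectoryGraph X (Ioo (-ρ) ρ ×ˢ Ioo (-ρ) ρ) (ρ / 2) η) := by
  obtain ⟨η, hη0, hηlip, hη⟩ := exists_lipschitzWith_forall_hasDerivAt H.continuous_slopeP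
    (C := 1) (by simpa using H.abs_slopeP_le_one) σ hρ.le
  have hsub : Ioo (-(ρ / 2)) (ρ / 2) ⊆ Ioo (-ρ) ρ := Ioo_subset_Ioo (by linarith) (by linarith)
  refine ⟨η, hη0, hηlip, fun hσ => ⟨hηlip.continuous, fun x hx => ⟨hsub hx, ?_⟩,
    fun x hx => hη x (hsub hx)⟩⟩
  have hdist : |η x - σ| ≤ |x| := by
    simpa [Real.dist_eq, hη0] using hηlip.dist_le_mul x 0
  have hx' := abs_lt.2 hx
  have hηx := abs_le.1 hdist
  constructor <;> linarith [hσ.1, hσ.2]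

lemma exists_isTrajectoryFamily {ρ : ℝ} (hρ : 0 < ρ)
    (H : IsTransverseField (Ioo (-ρ) ρ ×ˢ Ioo (-ρ) ρ) X h α B) :
    ∃ r > 0, ∃ ξ : Plane → ℝ, IsTrajectoryFamily X (Ioo (-ρ) ρ ×ˢ Ioo (-ρ) ρ) r ξ := by
  choose η hη0 hηlip hη using H.exists_isTrajectoryGraph hρ
  have hr : 0 < ρ / 4 := by positivity
  have hsub : Icc (-(ρ / 4)) (ρ / 4) ⊆ Ioo (-(ρ / 2)) (ρ / 2) :=
    Icc_subset_Ioo (by linarith) (by linarith)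
  have hIoo : Ioo (-(ρ / 4)) (ρ / 4) ⊆ Ioo (-(ρ / 2)) (ρ / 2) := Ioo_subset_Icc_self.trans hsub
  have hconvex := (convex_Ioo (𝕜 := ℝ) (-ρ) ρ).prod (convex_Ioo (𝕜 := ℝ) (-ρ) ρ)
  let K : NNReal := (B / α * Real.exp (B / α * (ρ / 2))).toNNReal
  have hlip : ∀ x ∈ Icc (-(ρ / 4)) (ρ / 4),
      LipschitzOnWith K (fun σ => η σ x) (Icc (-(ρ / 4)) (ρ / 4)) := by
    refine fun x hx => LipschitzOnWith.of_dist_le_mul fun σ hσ σ' hσ' => ?_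
    rw [Real.dist_eq, Real.dist_eq, H.sub_eq_mul_spreadFactor hconvex (hη σ' (hsub hσ'))
      (hη σ (hsub hσ)) (hsub hx), hη0, hη0, abs_mul, mul_comm]
    exact mul_le_mul_of_nonneg_right
      ((H.abs_spreadFactor_le _ _ (hsub hx)).trans (Real.le_coe_toNNReal _)) (abs_nonneg _)
  have hcont : ContinuousOn (fun z : Plane => η z.1 z.2)
      (Icc (-(ρ / 4)) (ρ / 4) ×ˢ Icc (-(ρ / 4)) (ρ / 4)) :=
    continuousOn_prod_of_continuousOn_lipschitzOnWith _ K
      (fun σ _ => (hηlip σ).continuous.continuousOn) hlip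
  obtain ⟨ξ, hξ, hξη, -⟩ := exists_continuous_eqOn_square hr.le hcont
  have heq {σ x : ℝ} (hσ : σ ∈ Ioo (-(ρ / 4)) (ρ / 4)) (hx : x ∈ Ioo (-(ρ / 4)) (ρ / 4)) :
      ξ (σ, x) = η σ x :=
    hξη (mk_mem_prod (Ioo_subset_Icc_self hσ) (Ioo_subset_Icc_self hx))
  refine ⟨ρ / 4, hr, ξ, hξ, fun σ hσ => ?_, fun σ hσ => ⟨by fun_prop, fun x hx => ?_,
    fun x hx => ?_⟩⟩
  · rw [heq hσ ⟨by linarith, hr⟩, hη0]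
  · rw [heq hσ hx]
    exact (hη σ (hIoo hσ)).mem x (hIoo hx)
  · rw [heq hσ hx]
    refine ((hη σ (hIoo hσ)).hasDerivAt x (hIoo hx)).congr_of_eventuallyEq ?_
    filter_upwards [Ioo_mem_nhds hx.1 hx.2] with y hy using heq hσ hy

end IsTransverseField

/-- The linear form `w ↦ wedgeP v w`. -/
noncomputable def wedgeCLM (v : Plane) : Plane →L[ℝ] ℝ := columnsP (-v.2) v.1

lemma wedgeCLM_apply (v w : Plane) : wedgeCLM v w = wedgeP v w := by
  simp only [wedgeCLM, columnsP_apply, wedgeP, smul_eq_mul]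
  ring

/-- `G` is an integrating factor in `U` for a field `X` with divergence `h`: it satisfies
`X G = -h G`, the equation `div (G X) = 0` in differentiated form, along all curves in `U` which
follow `X` at an arbitrary speed `β`. -/
def IsIntegratingFactor (X : Plane → Plane) (h : Plane → ℝ) (U : Set Plane) (G : Plane → ℝ) :
    Prop :=
  ∀ (c : ℝ → Plane) (β : ℝ → ℝ) (τ₀ : ℝ),
    (∀ᶠ τ in 𝓝 τ₀, c τ ∈ U ∧ HasDerivAt c (β τ • X (c τ)) τ) →
    HasDerivAt (fun τ => G (c τ)) (-(β τ₀ * h (c τ₀) * G (c τ₀))) τ₀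

lemma IsIntegratingFactor.mono {X : Plane → Plane} {h : Plane → ℝ} {U V : Set Plane}
    {G : Plane → ℝ} (H : IsIntegratingFactor X h U G) (hVU : V ⊆ U) :
    IsIntegratingFactor X h V G :=
  fun c β τ₀ hc => H c β τ₀ (hc.mono fun _ hτ => ⟨hVU hτ.1, hτ.2⟩)

/-- `t` is a `C¹` first integral of `X` on `U`: its differential is `w ↦ G * wedgeP X w`, that is
`∇t = -G X^⊥`, with `G` a positive continuous integrating factor. -/
structure IsFirstIntegral (X : Plane → Plane) (h : Plane → ℝ) (U : Set Plane)
    (t G : Plane → ℝ) : Prop where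
  isOpen : IsOpen U
  continuousOn : ContinuousOn G U
  pos : ∀ q ∈ U, 0 < G q
  hasFDerivAt : ∀ q ∈ U, HasFDerivAt t (G q • wedgeCLM (X q)) q
  transport : IsIntegratingFactor X h U G

lemma IsFirstIntegral.congr {X X' : Plane → Plane} {h h' : Plane → ℝ} {U : Set Plane}
    {t G : Plane → ℝ} (H : IsFirstIntegral X h U t G) (hX : EqOn X X' U) (hh : EqOn h h' U) :
    IsFirstIntegral X' h' U t G where
  isOpen := H.isOpen
  continuousOn := H.continuousOn
  pos := H.pos
  hasFDerivAt q hq := hX hq ▸ H.hasFDerivAt q hq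
  transport c β τ₀ hc := by
    rw [← hh hc.self_of_nhds.1]
    exact H.transport c β τ₀ (hc.mono fun τ hτ => ⟨hτ.1, by rw [hX hτ.1]; exact hτ.2⟩)

lemma eventually_comp_eq_of_tangent {t : Plane → ℝ} {c : ℝ → Plane} {v : ℝ → Plane}
    {g β : ℝ → ℝ} {τ₀ : ℝ}
    (h : ∀ᶠ τ in 𝓝 τ₀, HasFDerivAt t (g τ • wedgeCLM (v τ)) (c τ) ∧
      HasDerivAt c (β τ • v τ) τ) :
    ∀ᶠ τ in 𝓝 τ₀, t (c τ) = t (c τ₀) := by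
  have hzero : ∀ᶠ τ in 𝓝 τ₀, HasDerivAt (fun τ => t (c τ)) 0 τ := by
    filter_upwards [h] with τ hτ
    refine (hτ.1.comp_hasDerivAt τ hτ.2).congr_deriv ?_
    simp only [smul_apply, map_smul, wedgeCLM_apply, wedgeP, smul_eq_mul]
    ring
  obtain ⟨δ, hδ, hball⟩ := Metric.eventually_nhds_iff_ball.1 hzero
  rw [Real.ball_eq_Ioo] at hball
  have hτ₀ : τ₀ ∈ Ioo (τ₀ - δ) (τ₀ + δ) := ⟨by linarith, by linarith⟩
  filter_upwards [Ioo_mem_nhds hτ₀.1 hτ₀.2] with τ hτ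
  exact eq_of_hasDerivAt_zero hball hτ hτ₀

/-- The factor `(X₁)₀ exp (∫₀ˣ h / X₁)` along the trajectory `y = ξ x`. By conservation of flux its
inverse is the integrating factor of the first integral that labels trajectories by their ordinate
at `x = 0`. -/
noncomputable def trajectoryWeight (X : Plane → Plane) (h : Plane → ℝ) (ξ : ℝ → ℝ) (x : ℝ) : ℝ :=
  (X (0, ξ 0)).1 * Real.exp (∫ y in (0 : ℝ)..x, h (y, ξ y) / (X (y, ξ y)).1)

lemma spreadFactor_self_mul_fst {X : Plane → Plane} {ξ : ℝ → ℝ} {x : ℝ}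
    (hX : (X (x, ξ x)).1 ≠ 0) (h : Plane → ℝ) :
    spreadFactor X h ξ ξ x * (X (x, ξ x)).1 = trajectoryWeight X h ξ x := by
  rw [spreadFactor_self, trajectoryWeight]
  field_simp

lemma hasDerivAt_trajectoryWeight {X : Plane → Plane} {h : Plane → ℝ} {ξ : ℝ → ℝ}
    (hk : Continuous fun y => h (y, ξ y) / (X (y, ξ y)).1) (x : ℝ) :
    HasDerivAt (trajectoryWeight X h ξ)
      (trajectoryWeight X h ξ x * (h (x, ξ x) / (X (x, ξ x)).1)) x :=
  ((hk.integral_hasStrictDerivAt 0 x).hasDerivAt.exp.const_mul _).congr_deriv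
    (mul_assoc _ _ _).symm

lemma hasDerivAt_trajectoryWeight_inv_comp {X : Plane → Plane} {h : Plane → ℝ} {ξ : ℝ → ℝ}
    {c : ℝ → Plane} {b τ : ℝ} (hk : Continuous fun y => h (y, ξ y) / (X (y, ξ y)).1)
    (hX : (X (c τ)).1 ≠ 0) (hX₀ : (X (0, ξ 0)).1 ≠ 0) (hc : HasDerivAt c (b • X (c τ)) τ)
    (hcξ : ξ (c τ).1 = (c τ).2) :
    HasDerivAt (fun s => (trajectoryWeight X h ξ (c s).1)⁻¹)
      (-(b * h (c τ) * (trajectoryWeight X h ξ (c τ).1)⁻¹)) τ := by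
  have hW : trajectoryWeight X h ξ (c τ).1 ≠ 0 := mul_ne_zero hX₀ (Real.exp_pos _).ne'
  have hWc := (hasDerivAt_trajectoryWeight hk (c τ).1).comp τ hc.fst
  rw [hcξ] at hWc
  refine (hWc.fun_inv hW).congr_deriv ?_
  simp only [Prod.mk.eta, Function.comp_apply, Prod.smul_fst, smul_eq_mul]
  field_simp

namespace IsTransverseField

variable {Ω : Set Plane} {X : Plane → Plane} {h : Plane → ℝ} {α B : ℝ}

lemma trajectoryWeight_pos (H : IsTransverseField Ω X h α B) (ξ : ℝ → ℝ) (x : ℝ) :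
    0 < trajectoryWeight X h ξ x :=
  mul_pos (H.fst_pos _) (Real.exp_pos _)

lemma continuous_div_comp (H : IsTransverseField Ω X h α B) {ξ : ℝ → ℝ} (hξ : Continuous ξ) :
    Continuous fun y => h (y, ξ y) / (X (y, ξ y)).1 :=
  (H.continuous_div.comp (by fun_prop)).div (H.continuous.fst.comp (by fun_prop))
    fun _ => (H.fst_pos _).ne'

lemma continuous_spreadFactor_self (H : IsTransverseField Ω X h α B) {ξ : Plane → ℝ}
    (hξ : Continuous ξ) :
    Continuous fun z : Plane =>
      spreadFactor X h (fun x => ξ (z.1, x)) (fun x => ξ (z.1, x)) z.2 :=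
  (H.continuous_spreadFactor hξ).comp
    (by fun_prop : Continuous fun z : Plane => (z.1, z.1, z.2))

lemma continuous_trajectoryWeight (H : IsTransverseField Ω X h α B) {ξ : Plane → ℝ}
    (hξ : Continuous ξ) :
    Continuous fun z : Plane => trajectoryWeight X h (fun x => ξ (z.1, x)) z.2 := by
  simp only [← spreadFactor_self_mul_fst (H.fst_pos _).ne']
  exact (H.continuous_spreadFactor_self hξ).mul (H.continuous.fst.comp (by fun_prop))

lemma hasFDerivAt_trajectory_chart (H : IsTransverseField Ω X h α B) (hΩ : Convex ℝ Ω) {r : ℝ}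
    {ξ : Plane → ℝ} (hξ : IsTrajectoryFamily X Ω r ξ) {z : Plane}
    (hz : z ∈ Ioo (-r) r ×ˢ Ioo (-r) r) :
    HasFDerivAt (fun z : Plane => (z.2, ξ z))
      (columnsP (0, spreadFactor X h (fun x => ξ (z.1, x)) (fun x => ξ (z.1, x)) z.2)
        (1, slopeP X (z.2, ξ z))) z := by
  have hξz := (hasStrictFDerivAt_of_partials (isOpen_Ioo.prod isOpen_Ioo)
    (b := fun z => slopeP X (z.2, ξ z))
    (fun q hq => H.hasDerivAt_initial hΩ hξ hq.1 hq.2)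
    (fun q hq => (hξ.isTrajectoryGraph q.1 hq.1).hasDerivAt q.2 hq.2)
    (H.continuous_spreadFactor_self hξ.continuous).continuousOn
    (H.continuous_slopeP.comp (continuous_snd.prodMk hξ.continuous)).continuousOn hz).hasFDerivAt
  refine (hasFDerivAt_snd.prodMk hξz).congr_fderiv ?_
  ext <;> simp [columnsP_apply]

/- The first integral is the ordinate `σ` of the trajectory at `x = 0`, obtained by inverting
`(σ, x) ↦ (x, ξ (σ, x))`. -/
lemma exists_trajectory_label (H : IsTransverseField Ω X h α B) (hΩ : Convex ℝ Ω) {r : ℝ}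
    (hr : 0 < r) {ξ : Plane → ℝ} (hξ : IsTrajectoryFamily X Ω r ξ) :
    ∃ (U : Set Plane) (t : Plane → ℝ), IsOpen U ∧ 0 ∈ U ∧ ∀ q ∈ U,
      (t q, q.1) ∈ Ioo (-r) r ×ˢ Ioo (-r) r ∧ ξ (t q, q.1) = q.2 ∧
      HasFDerivAt t
        ((trajectoryWeight X h (fun x => ξ (t q, x)) q.1)⁻¹ • wedgeCLM (X q)) q := by
  have hd := H.continuous_spreadFactor_self hξ.continuous
  have hdpos (z : Plane) :
      0 < spreadFactor X h (fun x => ξ (z.1, x)) (fun x => ξ (z.1, x)) z.2 :=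
    mul_pos (div_pos (H.segmentMean_fst_pos _) (H.segmentMean_fst_pos _)) (Real.exp_pos _)
  have hm := H.continuous_slopeP.comp (continuous_snd.prodMk hξ.continuous)
  have h0 : (0 : ℝ) ∈ Ioo (-r) r := ⟨neg_neg_of_pos hr, hr⟩
  obtain ⟨e, he0, heS, heΞ, -, -, hes⟩ := exists_openPartialHomeomorph_of_columns
    (isOpen_Ioo.prod isOpen_Ioo) (fun z hz => H.hasFDerivAt_trajectory_chart hΩ hξ hz)
    (continuous_const.prodMk hd).continuousOn (continuous_const.prodMk hm).continuousOn
    (fun z _ => by simpa [wedgeP] using (hdpos z).ne') (mk_mem_prod h0 h0)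
  refine ⟨e.target, fun q => (e.symm q).1, e.open_target, ?_, fun q hq => ?_⟩
  · have h0e := e.map_source he0
    rwa [heΞ, hξ.initial 0 h0] at h0e
  have hq' : ((e.symm q).2, ξ (e.symm q)) = q := by rw [← heΞ, e.right_inv hq]
  have hx : (e.symm q).2 = q.1 := congrArg Prod.fst hq'
  have hW := spreadFactor_self_mul_fst (ξ := fun x => ξ ((e.symm q).1, x)) (x := (e.symm q).2)
    (H.fst_pos _).ne' h
  refine ⟨hx ▸ heS (e.map_target hq), hx ▸ congrArg Prod.snd hq', ?_⟩
  refine (hes q hq).fst.congr_fderiv (ContinuousLinearMap.ext fun v => ?_)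
  have hXq := (H.fst_pos q).ne'
  have hdq := (hdpos (e.symm q)).ne'
  rw [← hx, ← hW]
  simp only [Prod.mk.eta, hq', ContinuousLinearMap.comp_apply,
    ContinuousLinearMap.coe_fst', smul_apply, wedgeCLM_apply, invColumnsP, columnsP_apply, wedgeP,
    slopeP, Prod.smul_fst, Prod.fst_add, smul_eq_mul]
  field_simp
  ring

lemma exists_isFirstIntegral (H : IsTransverseField Ω X h α B) (hΩ : Convex ℝ Ω) {r : ℝ}
    (hr : 0 < r) {ξ : Plane → ℝ} (hξ : IsTrajectoryFamily X Ω r ξ) :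
    ∃ (U : Set Plane) (t G : Plane → ℝ), 0 ∈ U ∧ U ⊆ Ω ∧ IsFirstIntegral X h U t G := by
  obtain ⟨U, t, hU, h0, ht⟩ := H.exists_trajectory_label hΩ hr hξ
  have htcont : ContinuousOn t U := fun q hq => (ht q hq).2.2.continuousAt.continuousWithinAt
  refine ⟨U, t, fun q => (trajectoryWeight X h (fun x => ξ (t q, x)) q.1)⁻¹, h0, fun q hq => ?_,
    hU, ?_, fun q _ => inv_pos.2 (H.trajectoryWeight_pos _ _), fun q hq => (ht q hq).2.2, ?_⟩
  · obtain ⟨hS, hq2, -⟩ := ht q hq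
    have hmem := (hξ.isTrajectoryGraph _ hS.1).mem q.1 hS.2
    rwa [hq2] at hmem
  · have hW := (H.continuous_trajectoryWeight hξ.continuous).comp_continuousOn
      (htcont.prodMk continuousOn_fst)
    exact hW.inv₀ fun q _ => (H.trajectoryWeight_pos (fun x => ξ (t q, x)) q.1).ne'
  · intro c β τ₀ hc
    obtain ⟨hcU, hcd⟩ := hc.self_of_nhds
    have hlevel := eventually_comp_eq_of_tangent
      (hc.mono fun τ hτ => ⟨(ht (c τ) hτ.1).2.2, hτ.2⟩)
    refine (hasDerivAt_trajectoryWeight_inv_comp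
      (H.continuous_div_comp (hξ.continuous.comp (.prodMk_right (t (c τ₀))))) (H.fst_pos _).ne'
      (H.fst_pos _).ne' hcd (ht _ hcU).2.1).congr_of_eventuallyEq ?_
    filter_upwards [hlevel] with τ hτ
    rw [hτ]
    rfl

end IsTransverseField

lemma exists_square_subset {S : Set Plane} (hS : S ∈ 𝓝 0) :
    ∃ ρ > 0, Icc (-ρ) ρ ×ˢ Icc (-ρ) ρ ⊆ S := by
  obtain ⟨ρ, hρ, hρS⟩ := Metric.nhds_basis_closedBall.mem_iff.1 hS
  refine ⟨ρ, hρ, fun z hz => hρS ?_⟩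
  rw [mem_closedBall_zero_iff, Prod.norm_def]
  exact max_le (abs_le.2 hz.1) (abs_le.2 hz.2)

namespace HasUniformDiv

variable {Ω : Set Plane} {X : Plane → Plane} {h : Plane → ℝ}

lemma exists_isTransverseField (hdiv : HasUniformDiv Ω X h) (hΩ : IsOpen Ω) (h0 : 0 ∈ Ω)
    (hX0 : X 0 = (1, 0)) :
    ∃ ρ > 0, Ioo (-ρ) ρ ×ˢ Ioo (-ρ) ρ ⊆ Ω ∧ ∃ (X' : Plane → Plane) (h' : Plane → ℝ) (B : ℝ),
      IsTransverseField (Ioo (-ρ) ρ ×ˢ Ioo (-ρ) ρ) X' h' (1 / 2) B ∧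
      EqOn X' X (Ioo (-ρ) ρ ×ˢ Ioo (-ρ) ρ) ∧ EqOn h' h (Ioo (-ρ) ρ ×ˢ Ioo (-ρ) ρ) := by
  obtain ⟨hX, hh⟩ := hdiv.continuousOn hΩ
  have hXc : ContinuousAt X 0 := hX.continuousAt (hΩ.mem_nhds h0)
  have hfst : ∀ᶠ z in 𝓝 (0 : Plane), 1 / 2 < (X z).1 :=
    hXc.fst.eventually (lt_mem_nhds (by norm_num [hX0]))
  have hsnd : ∀ᶠ z in 𝓝 (0 : Plane), |(X z).2| < 1 / 2 :=
    hXc.snd.abs.eventually (gt_mem_nhds (by norm_num [hX0]))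
  obtain ⟨ρ, hρ, hsub⟩ := exists_square_subset
    (inter_mem (hΩ.mem_nhds h0) (inter_mem hfst hsnd))
  have hcompact : IsCompact (Icc (-ρ) ρ ×ˢ Icc (-ρ) ρ) := isCompact_Icc.prod isCompact_Icc
  have hsubΩ : Icc (-ρ) ρ ×ˢ Icc (-ρ) ρ ⊆ Ω := fun z hz => (hsub hz).1
  obtain ⟨B₁, hB₁⟩ := hcompact.exists_bound_of_continuousOn (hX.mono hsubΩ)
  obtain ⟨B₂, hB₂⟩ := hcompact.exists_bound_of_continuousOn (hh.mono hsubΩ)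
  obtain ⟨g, hg, hgeq, hgval⟩ :=
    exists_continuous_eqOn_square hρ.le ((hX.prodMk hh).mono hsubΩ)
  have hIoo : Ioo (-ρ) ρ ×ˢ Ioo (-ρ) ρ ⊆ Icc (-ρ) ρ ×ˢ Icc (-ρ) ρ :=
    prod_mono Ioo_subset_Icc_self Ioo_subset_Icc_self
  have hgX : EqOn (fun z => (g z).1) X (Ioo (-ρ) ρ ×ˢ Ioo (-ρ) ρ) :=
    fun z hz => congrArg Prod.fst (hgeq (hIoo hz))
  have hgh : EqOn (fun z => (g z).2) h (Ioo (-ρ) ρ ×ˢ Ioo (-ρ) ρ) :=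
    fun z hz => congrArg Prod.snd (hgeq (hIoo hz))
  have hval (P : Plane × ℝ → Prop) (hP : ∀ w ∈ Icc (-ρ) ρ ×ˢ Icc (-ρ) ρ, P (X w, h w))
      (z : Plane) : P (g z) := by
    obtain ⟨w, hw, hz⟩ := hgval z
    exact hz ▸ hP w hw
  refine ⟨ρ, hρ, hIoo.trans hsubΩ, _, _, max B₁ B₂, ⟨hg.fst, hg.snd,
    (hdiv.mono (hIoo.trans hsubΩ)).congr hgX.symm hgh.symm, by norm_num,
    hval (fun w => 1 / 2 ≤ w.1.1) fun w hw => (hsub hw).2.1.le,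
    hval (fun w => w.1.1 ≤ max B₁ B₂) fun w hw => ?_,
    hval (fun w => |w.1.2| ≤ w.1.1) fun w hw => (hsub hw).2.2.le.trans (hsub hw).2.1.le,
    hval (fun w => |w.2| ≤ max B₁ B₂) fun w hw => (hB₂ w hw).trans (le_max_right _ _)⟩,
    hgX, hgh⟩
  calc (X w).1 ≤ ‖X w‖ := (Real.le_norm_self _).trans (norm_fst_le (X w))
    _ ≤ max B₁ B₂ := (hB₁ w hw).trans (le_max_left _ _)

lemma exists_isFirstIntegral_at_zero (hdiv : HasUniformDiv Ω X h) (hΩ : IsOpen Ω) (h0 : 0 ∈ Ω)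
    (hX0 : X 0 = (1, 0)) :
    ∃ (U : Set Plane) (t G : Plane → ℝ), 0 ∈ U ∧ U ⊆ Ω ∧ IsFirstIntegral X h U t G := by
  obtain ⟨ρ, hρ, hρΩ, X', h', B, H, hX, hh⟩ := hdiv.exists_isTransverseField hΩ h0 hX0
  obtain ⟨r, hr, ξ, hξ⟩ := H.exists_isTrajectoryFamily hρ
  obtain ⟨U, t, G, h0U, hU, hG⟩ := H.exists_isFirstIntegral
    ((convex_Ioo (𝕜 := ℝ) (-ρ) ρ).prod (convex_Ioo (𝕜 := ℝ) (-ρ) ρ)) hr hξ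
  exact ⟨U, t, G, h0U, hU.trans hρΩ, hG.congr (hX.mono hU) (hh.mono hU)⟩

end HasUniformDiv

section AreaPreserving

variable {E : Plane ≃L[ℝ] Plane} {X : Plane → Plane} {h : Plane → ℝ}

lemma exists_area_preserving_map {ν : Plane} (hν : ν ≠ 0) :
    ∃ E : Plane ≃L[ℝ] Plane, (∀ v w, wedgeP (E v) (E w) = wedgeP v w) ∧ E (1, 0) = ν := by
  have hsq : ν.1 ^ 2 + ν.2 ^ 2 ≠ 0 := fun h => hν (Prod.ext
    (pow_eq_zero_iff two_ne_zero |>.1 (by nlinarith [sq_nonneg ν.1, sq_nonneg ν.2]))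
    (pow_eq_zero_iff two_ne_zero |>.1 (by nlinarith [sq_nonneg ν.1, sq_nonneg ν.2])))
  let w : Plane := (ν.1 ^ 2 + ν.2 ^ 2)⁻¹ • (-ν.2, ν.1)
  have hw : wedgeP ν w = 1 := by
    simp only [wedgeP, w, Prod.smul_mk, smul_eq_mul]
    field_simp
    ring
  have happly (v : Plane) : columnsEquivP ν w (hw ▸ one_ne_zero) v = v.1 • ν + v.2 • w :=
    columnsP_apply ν w v
  refine ⟨columnsEquivP ν w (hw ▸ one_ne_zero), fun v v' => ?_, by simp [happly]⟩
  simp only [wedgeP] at hw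
  simp only [happly, wedgeP, Prod.fst_add, Prod.snd_add, Prod.smul_fst, Prod.smul_snd, smul_eq_mul]
  linear_combination (v.1 * v'.2 - v.2 * v'.1) * hw

lemma wedgeP_symm_left (hE : ∀ v w, wedgeP (E v) (E w) = wedgeP v w) (v w : Plane) :
    wedgeP (E.symm v) w = wedgeP v (E w) := by
  rw [← hE, E.apply_symm_apply]

lemma divP_comp_affine (hE : ∀ v w, wedgeP (E v) (E w) = wedgeP v w) {Y : Plane → Plane}
    {p z : Plane} (hY : DifferentiableAt ℝ Y (p + E z)) :
    divP (fun z => E.symm (Y (p + E z))) z = divP Y (p + E z) := by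
  have hder (v : Plane) : fderiv ℝ (fun z => E.symm (Y (p + E z))) z v =
      E.symm (fderiv ℝ Y (p + E z) (E v)) :=
    congrArg (· v) (E.symm.hasFDerivAt.comp z
      (hY.hasFDerivAt.comp z (E.hasFDerivAt.const_add p))).fderiv
  have h1 : wedgeP (1, 0) (0, 1) = 1 := by norm_num [wedgeP]
  have hdiv := wedgeP_fderiv_sub (fun z => E.symm (Y (p + E z))) z (1, 0) (0, 1)
  rw [hder, hder, wedgeP_symm_left hE, wedgeP_symm_left hE, wedgeP_fderiv_sub, hE, h1, mul_one,
    mul_one] at hdiv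
  exact hdiv.symm

lemma HasUniformDiv.comp_affine (hE : ∀ v w, wedgeP (E v) (E w) = wedgeP v w) {Ω : Set Plane}
    (hdiv : HasUniformDiv Ω X h) (p : Plane) :
    HasUniformDiv ((fun z => p + E z) ⁻¹' Ω) (fun z => E.symm (X (p + E z)))
      fun z => h (p + E z) := by
  intro K hKΩ hK
  have hR : Continuous fun z => p + E z := by fun_prop
  have hKR : K ⊆ (fun z => p + E z) ⁻¹' ((fun z => p + E z) '' K) := subset_preimage_image _ _
  obtain ⟨Y, hY, hYX, hYh⟩ := hdiv _ (image_subset_iff.2 hKΩ) (hK.image hR)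
  refine ⟨fun n z => E.symm (Y n (p + E z)), fun n => by fun_prop,
    (E.symm : Plane →L[ℝ] Plane).uniformContinuous.comp_tendstoUniformlyOn
      ((hYX.comp _).mono hKR), ?_⟩
  exact ((hYh.comp _).mono hKR).congr (.of_forall fun n z _ =>
    (divP_comp_affine hE ((hY n).differentiable one_ne_zero _)).symm)

lemma IsFirstIntegral.comp_affine (hE : ∀ v w, wedgeP (E v) (E w) = wedgeP v w) {U : Set Plane}
    {t G : Plane → ℝ} {p : Plane}
    (H : IsFirstIntegral (fun z => E.symm (X (p + E z))) (fun z => h (p + E z)) U t G) :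
    IsFirstIntegral X h ((fun q => E.symm (q - p)) ⁻¹' U) (fun q => t (E.symm (q - p)))
      fun q => G (E.symm (q - p)) := by
  have hR : Continuous fun q => E.symm (q - p) := by fun_prop
  have hinv (q : Plane) : p + E (E.symm (q - p)) = q := by simp
  refine ⟨H.isOpen.preimage hR, H.continuousOn.comp hR.continuousOn fun q hq => hq,
    fun q hq => H.pos _ hq, fun q hq => ?_, fun c β τ₀ hc => ?_⟩
  · refine ((H.hasFDerivAt _ hq).comp q
      (E.symm.hasFDerivAt.comp q ((hasFDerivAt_id q).sub_const p))).congr_fderiv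
      (ContinuousLinearMap.ext fun v => ?_)
    simp [wedgeCLM_apply, wedgeP_symm_left hE]
  · have htransport := H.transport (fun τ => E.symm (c τ - p)) β τ₀ (hc.mono fun τ hτ =>
      ⟨hτ.1, (E.symm.hasFDerivAt.comp_hasDerivAt τ (hτ.2.sub_const p)).congr_deriv (by
        rw [hinv]
        exact map_smul E.symm (β τ) (X (c τ)))⟩)
    simpa only [hinv] using htransport

theorem HasUniformDiv.exists_isFirstIntegral {Ω : Set Plane} (hdiv : HasUniformDiv Ω X h)
    (hΩ : IsOpen Ω) {p : Plane} (hp : p ∈ Ω) (hXp : X p ≠ 0) :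
    ∃ (U : Set Plane) (t G : Plane → ℝ), p ∈ U ∧ U ⊆ Ω ∧ IsFirstIntegral X h U t G := by
  obtain ⟨E, hE, hE1⟩ := exists_area_preserving_map hXp
  have hR : Continuous fun z => p + E z := by fun_prop
  obtain ⟨U, t, G, h0U, hU, hG⟩ := (hdiv.comp_affine hE p).exists_isFirstIntegral_at_zero
    (hΩ.preimage hR) (by simpa using hp) (by simp [← hE1])
  exact ⟨_, _, _, by simpa using h0U, fun q hq => by simpa using hU hq, hG.comp_affine hE⟩

end AreaPreserving

/-! ### Reparametrized integral curves -/

lemma exists_openPartialHomeomorph_primitive {b : ℝ → ℝ} {x₁ x₂ τ₀ : ℝ}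
    (hb : ContinuousOn b (Ioo x₁ x₂)) (hb0 : ∀ τ ∈ Ioo x₁ x₂, b τ ≠ 0) (hτ₀ : τ₀ ∈ Ioo x₁ x₂) :
    ∃ e : OpenPartialHomeomorph ℝ ℝ, τ₀ ∈ e.source ∧ e.source ⊆ Ioo x₁ x₂ ∧
      (∀ τ ∈ e.source, HasDerivAt e (b τ) τ) ∧
      ∀ y ∈ e.target, HasDerivAt e.symm (b (e.symm y))⁻¹ y := by
  have hder : ∀ τ ∈ Ioo x₁ x₂, HasDerivAt (fun y => ∫ z in τ₀..y, b z) (b τ) τ := fun _ =>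
    hasDerivAt_integral_of_continuousOn isOpen_Ioo ordConnected_Ioo hb hτ₀
  have hstrict := (hasStrictDerivAt_of_hasDerivAt_of_continuousAt
    (by filter_upwards [isOpen_Ioo.mem_nhds hτ₀] with τ using hder τ)
    (hb.continuousAt (isOpen_Ioo.mem_nhds hτ₀))).hasStrictFDerivAt_equiv (hb0 τ₀ hτ₀)
  let e := (hstrict.toOpenPartialHomeomorph _).restrOpen (Ioo x₁ x₂) isOpen_Ioo
  have hsub : e.source ⊆ Ioo x₁ x₂ := fun τ (hτ : τ ∈ _ ∩ Ioo x₁ x₂) => hτ.2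
  refine ⟨e, ⟨hstrict.mem_toOpenPartialHomeomorph_source, hτ₀⟩, hsub,
    fun τ hτ => hder τ (hsub hτ), fun y hy => ?_⟩
  have hy' := hsub (e.map_target hy)
  exact e.hasDerivAt_symm hy (hb0 _ hy') (hder _ hy')

section Reparametrization

variable {Y : Plane → Plane} {Ω : Set Plane} {c : ℝ → Plane} {b : ℝ → ℝ} {x₁ x₂ τ₀ : ℝ}

lemma exists_isCurveIn_reparametrization (hc : ∀ τ ∈ Ioo x₁ x₂, HasDerivAt c (b τ • Y (c τ)) τ)
    (hcΩ : MapsTo c (Ioo x₁ x₂) Ω) (hb : ContinuousOn b (Ioo x₁ x₂))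
    (hb0 : ∀ τ ∈ Ioo x₁ x₂, b τ ≠ 0) (hτ₀ : τ₀ ∈ Ioo x₁ x₂) :
    ∃ (γ : ℝ → Plane) (a' b' : ℝ) (σ : ℝ → ℝ), IsCurveIn Y Ω γ a' b' ∧ σ τ₀ ∈ Ioo a' b' ∧
      HasDerivAt σ (b τ₀) τ₀ ∧ ∀ᶠ τ in 𝓝 τ₀, γ (σ τ) = c τ := by
  obtain ⟨e, hτe, hsub, he, he'⟩ := exists_openPartialHomeomorph_primitive hb hb0 hτ₀
  obtain ⟨δ, hδ, hball⟩ := Metric.isOpen_iff.1 e.open_target _ (e.map_source hτe)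
  rw [Real.ball_eq_Ioo] at hball
  have hmem {y : ℝ} (hy : y ∈ Ioo (e τ₀ - δ) (e τ₀ + δ)) : e.symm y ∈ Ioo x₁ x₂ :=
    hsub (e.map_target (hball hy))
  refine ⟨c ∘ e.symm, e τ₀ - δ, e τ₀ + δ, e, ⟨fun y hy => ?_, fun y hy => hcΩ (hmem hy)⟩,
    ⟨by linarith, by linarith⟩, he τ₀ hτe, ?_⟩
  · refine (((hc _ (hmem hy)).scomp y (he' y (hball hy))).congr_deriv ?_).hasDerivWithinAt
    rw [inv_smul_smul₀ (hb0 _ (hmem hy)), Function.comp_apply]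
  · filter_upwards [e.open_source.mem_nhds hτe] with τ hτ
    rw [Function.comp_apply, e.left_inv hτ]

lemma exists_isCurveIn_through (hc : ∀ τ ∈ Ioo x₁ x₂, HasDerivAt c (b τ • Y (c τ)) τ)
    (hcΩ : MapsTo c (Ioo x₁ x₂) Ω) (hb : ContinuousOn b (Ioo x₁ x₂))
    (hb0 : ∀ τ ∈ Ioo x₁ x₂, b τ ≠ 0) (hτ₀ : τ₀ ∈ Ioo x₁ x₂) :
    ∃ (γ : ℝ → Plane) (a' b' τ : ℝ), IsCurveIn Y Ω γ a' b' ∧ τ ∈ Ioo a' b' ∧ γ τ = c τ₀ := by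
  obtain ⟨γ, a', b', σ, hγ, hσ, -, hγc⟩ :=
    exists_isCurveIn_reparametrization hc hcΩ hb hb0 hτ₀
  exact ⟨γ, a', b', σ τ₀, hγ, hσ, hγc.self_of_nhds⟩

lemma HasDerivAlong.hasDerivAt_comp {h : Plane → ℝ} {d : ℝ} (hd : HasDerivAlong Y Ω h (c τ₀) d)
    (hc : ∀ τ ∈ Ioo x₁ x₂, HasDerivAt c (b τ • Y (c τ)) τ) (hcΩ : MapsTo c (Ioo x₁ x₂) Ω)
    (hb : ContinuousOn b (Ioo x₁ x₂)) (hb0 : ∀ τ ∈ Ioo x₁ x₂, b τ ≠ 0) (hτ₀ : τ₀ ∈ Ioo x₁ x₂) :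
    HasDerivAt (fun τ => h (c τ)) (b τ₀ * d) τ₀ := by
  obtain ⟨γ, a', b', σ, hγ, hσ, hσ', hγc⟩ :=
    exists_isCurveIn_reparametrization hc hcΩ hb hb0 hτ₀
  rw [mul_comm]
  refine ((hd γ a' b' (σ τ₀) hγ hσ hγc.self_of_nhds).comp τ₀ hσ').congr_of_eventuallyEq ?_
  filter_upwards [hγc] with τ hτ
  rw [Function.comp_apply, hτ]

end Reparametrization

/-! ### Regularity from a first order system along one family of coordinate lines -/

section Integrals

variable {E : Type*} [NormedAddCommGroup E] [NormedSpace ℝ E] {a b c d s₀ : ℝ}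
  {k k' : ℝ × ℝ → E}

lemma continuousOn_integral_fst (hk : ContinuousOn k (Ioo a b ×ˢ Ioo c d)) (hs₀ : s₀ ∈ Ioo a b) :
    ContinuousOn (fun z : ℝ × ℝ => ∫ s in s₀..z.1, k (s, z.2)) (Ioo a b ×ˢ Ioo c d) := by
  have hmem (z : ℝ × ℝ) (hz : z ∈ Ioo a b ×ˢ Ioo c d) (r : ℝ) (hr : r ∈ uIcc (0 : ℝ) 1) :
      (s₀ + (z.1 - s₀) * r, z.2) ∈ Ioo a b ×ˢ Ioo c d := by
    rw [uIcc_of_le zero_le_one] at hr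
    have := (convex_Ioo a b).add_smul_sub_mem hs₀ hz.1 hr
    exact ⟨by rwa [mul_comm], hz.2⟩
  have hunit : ContinuousOn (fun z : ℝ × ℝ => ∫ r in (0 : ℝ)..1, k (s₀ + (z.1 - s₀) * r, z.2))
      (Ioo a b ×ˢ Ioo c d) :=
    continuousOn_intervalIntegral_param
      (f := fun w : (ℝ × ℝ) × ℝ => k (s₀ + (w.1.1 - s₀) * w.2, w.1.2))
      (hk.comp (by fun_prop) fun w hw => hmem w.1 hw.1 w.2 hw.2)
  have hlength : ContinuousOn (fun z : ℝ × ℝ => z.1 - s₀) (Ioo a b ×ˢ Ioo c d) := by fun_prop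
  refine (hlength.smul hunit).congr fun z _ => ?_
  have hsubst := intervalIntegral.smul_integral_comp_add_mul (a := 0) (b := 1)
    (fun s => k (s, z.2)) (z.1 - s₀) s₀
  simpa using hsubst.symm

lemma hasDerivAt_integral_fst [CompleteSpace E] (hk : ContinuousOn k (Ioo a b ×ˢ Ioo c d))
    (hk' : ContinuousOn k' (Ioo a b ×ˢ Ioo c d))
    (hd : ∀ z ∈ Ioo a b ×ˢ Ioo c d, HasDerivAt (fun t => k (z.1, t)) (k' z) z.2)
    (hs₀ : s₀ ∈ Ioo a b) {z : ℝ × ℝ} (hz : z ∈ Ioo a b ×ˢ Ioo c d) :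
    HasDerivAt (fun t => ∫ s in s₀..z.1, k (s, t)) (∫ s in s₀..z.1, k' (s, z.2)) z.2 := by
  have hslice : ContinuousOn (fun t => ∫ s in s₀..z.1, k' (s, t)) (Ioo c d) :=
    (continuousOn_integral_fst hk' hs₀).comp (f := fun t => (z.1, t)) (by fun_prop)
      fun t ht => ⟨hz.1, ht⟩
  refine hasDerivAt_of_integral_eq hslice hz.2 fun x hx y hy _ => ?_
  have hbox : uIcc s₀ z.1 ×ˢ uIcc x y ⊆ Ioo a b ×ˢ Ioo c d :=
    prod_mono (ordConnected_Ioo.uIcc_subset hs₀ hz.1) (ordConnected_Ioo.uIcc_subset hx hy)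
  calc (∫ s in s₀..z.1, k (s, y)) - ∫ s in s₀..z.1, k (s, x)
      = ∫ s in s₀..z.1, (k (s, y) - k (s, x)) := by
        rw [intervalIntegral.integral_sub]
        · exact intervalIntegrable_slice_fst (hk.mono hbox) right_mem_uIcc
        · exact intervalIntegrable_slice_fst (hk.mono hbox) left_mem_uIcc
    _ = ∫ s in s₀..z.1, ∫ t in x..y, k' (s, t) := by
        refine intervalIntegral.integral_congr fun s hs => ?_
        exact (intervalIntegral.integral_eq_sub_of_hasDerivAt
          (f := fun t => k (s, t)) (fun t ht => hd (s, t) (hbox ⟨hs, ht⟩))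
          (intervalIntegrable_slice_snd (hk'.mono hbox) hs)).symm
    _ = ∫ t in x..y, ∫ s in s₀..z.1, k' (s, t) :=
        integral_swap_of_continuousOn (hk'.mono hbox)

lemma contDiffOn_one_integral_fst [CompleteSpace E] (hk : ContinuousOn k (Ioo a b ×ˢ Ioo c d))
    (hk' : ContinuousOn k' (Ioo a b ×ˢ Ioo c d))
    (hd : ∀ z ∈ Ioo a b ×ˢ Ioo c d, HasDerivAt (fun t => k (z.1, t)) (k' z) z.2)
    (hs₀ : s₀ ∈ Ioo a b) :
    ContDiffOn ℝ 1 (fun z : ℝ × ℝ => ∫ s in s₀..z.1, k (s, z.2)) (Ioo a b ×ˢ Ioo c d) :=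
  contDiffOn_one_of_partials (isOpen_Ioo.prod isOpen_Ioo)
    (fun z hz => hasDerivAt_integral_of_continuousOn (k := fun s => k (s, z.2)) isOpen_Ioo
      ordConnected_Ioo (hk.comp (by fun_prop) fun _ hs => ⟨hs, hz.2⟩) hs₀ hz.1)
    (fun _ hz => hasDerivAt_integral_fst hk hk' hd hs₀ hz) hk (continuousOn_integral_fst hk' hs₀)

lemma exists_integral_ne_zero [CompleteSpace E] {κ : ℝ → E} (hκ : ContinuousOn κ (Ioo a b))
    (hs₀ : s₀ ∈ Ioo a b) (hκ0 : κ s₀ ≠ 0) : ∃ s₁ ∈ Ioo a b, ∫ s in s₀..s₁, κ s ≠ 0 := by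
  have hne := (hasDerivAt_integral_of_continuousOn isOpen_Ioo ordConnected_Ioo hκ hs₀
    hs₀).eventually_ne (c := 0) hκ0
  have hmem : ∀ᶠ s₁ in 𝓝[≠] s₀, s₁ ∈ Ioo a b :=
    (isOpen_Ioo.mem_nhds hs₀ : Ioo a b ∈ 𝓝 s₀) |> eventually_nhdsWithin_of_eventually_nhds
  obtain ⟨s₁, hs₁, h⟩ := (hmem.and hne).exists
  exact ⟨s₁, hs₁, h⟩

end Integrals

section System

open Complex

lemma eq_mul_cexp_of_hasDerivAt {n k : ℝ → ℂ} {a b s₀ s : ℝ} (hk : ContinuousOn k (Ioo a b))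
    (hn : ∀ s ∈ Ioo a b, HasDerivAt n (k s * n s) s) (hs₀ : s₀ ∈ Ioo a b) (hs : s ∈ Ioo a b) :
    n s = n s₀ * exp (∫ x in s₀..s, k x) := by
  have hquot : ∀ s ∈ Ioo a b, HasDerivAt (fun s => n s * exp (-∫ x in s₀..s, k x)) 0 s :=
    fun s hs => ((hn s hs).mul (hasDerivAt_integral_of_continuousOn isOpen_Ioo ordConnected_Ioo
      hk hs₀ hs).fun_neg.cexp).congr_deriv (by ring)
  have hconst := eq_of_hasDerivAt_zero hquot hs hs₀
  simp only [intervalIntegral.integral_same, neg_zero, exp_zero, mul_one] at hconst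
  rw [← hconst, mul_assoc, ← exp_add, neg_add_cancel, exp_zero, mul_one]

variable {a b c d s₀ : ℝ} {φ n : ℝ × ℝ → ℂ} {κ κ' η η' : ℝ × ℝ → ℂ}

/- The increment of `φ` along a line `t = const` is `n (s₀, t)` times an integral which is
differentiable in `t` and, over a short segment, does not vanish. -/
lemma contDiffOn_of_increment (hκ : ContinuousOn κ (Ioo a b ×ˢ Ioo c d))
    (hκ' : ContinuousOn κ' (Ioo a b ×ˢ Ioo c d))
    (hκ0 : ∀ z ∈ Ioo a b ×ˢ Ioo c d, κ z ≠ 0)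
    (hκt : ∀ z ∈ Ioo a b ×ˢ Ioo c d, HasDerivAt (fun t => κ (z.1, t)) (κ' z) z.2)
    {ν : ℝ → ℂ} (hφ : ContDiffOn ℝ 1 φ (Ioo a b ×ˢ Ioo c d))
    (hφs : ∀ z ∈ Ioo a b ×ˢ Ioo c d, HasDerivAt (fun s => φ (s, z.2)) (ν z.2 * κ z) z.1)
    (hs₀ : s₀ ∈ Ioo a b) : ContDiffOn ℝ 1 ν (Ioo c d) := by
  intro t₀ ht₀
  obtain ⟨s₁, hs₁, hne⟩ := exists_integral_ne_zero (κ := fun s => κ (s, t₀))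
    (hκ.comp (by fun_prop) fun s hs => ⟨hs, ht₀⟩) hs₀ (hκ0 (s₀, t₀) ⟨hs₀, ht₀⟩)
  have hslice {f : ℝ × ℝ → ℂ} (hf : ContDiffOn ℝ 1 f (Ioo a b ×ˢ Ioo c d)) {s : ℝ}
      (hs : s ∈ Ioo a b) : ContDiffAt ℝ 1 (fun t => f (s, t)) t₀ :=
    (hf.comp (by fun_prop) fun t ht => ⟨hs, ht⟩).contDiffAt (isOpen_Ioo.mem_nhds ht₀)
  have hq : ContDiffAt ℝ 1 (fun t => ∫ s in s₀..s₁, κ (s, t)) t₀ :=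
    hslice (contDiffOn_one_integral_fst hκ hκ' hκt hs₀) hs₁
  refine ContDiffAt.contDiffWithinAt <|
    (((hslice hφ hs₁).sub (hslice hφ hs₀)).mul (hq.inv hne)).congr_of_eventuallyEq ?_
  filter_upwards [isOpen_Ioo.mem_nhds ht₀, hq.continuousAt.eventually_ne hne] with t ht htne
  have hseg {s : ℝ} (hs : s ∈ uIcc s₀ s₁) : (s, t) ∈ Ioo a b ×ˢ Ioo c d :=
    ⟨ordConnected_Ioo.uIcc_subset hs₀ hs₁ hs, ht⟩
  change ν t = (φ (s₁, t) - φ (s₀, t)) * (∫ s in s₀..s₁, κ (s, t))⁻¹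
  rw [eq_mul_inv_iff_mul_eq₀ htne, ← intervalIntegral.integral_const_mul]
  exact intervalIntegral.integral_eq_sub_of_hasDerivAt (f := fun s => φ (s, t))
    (f' := fun s => ν t * κ (s, t)) (fun s hs => hφs (s, t) (hseg hs))
    (continuousOn_const.mul (hκ.comp (by fun_prop) fun s hs => hseg hs)).intervalIntegrable

lemma contDiffOn_of_system {ε ε' : ℝ × ℝ → ℂ}
    (hn : ∀ z ∈ Ioo a b ×ˢ Ioo c d, HasDerivAt (fun s => n (s, z.2)) (η z * n z) z.1)
    (hφ : ContDiffOn ℝ 1 φ (Ioo a b ×ˢ Ioo c d))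
    (hφs : ∀ z ∈ Ioo a b ×ˢ Ioo c d, HasDerivAt (fun s => φ (s, z.2)) (ε z * n z) z.1)
    (hε : ContinuousOn ε (Ioo a b ×ˢ Ioo c d)) (hε' : ContinuousOn ε' (Ioo a b ×ˢ Ioo c d))
    (hε0 : ∀ z ∈ Ioo a b ×ˢ Ioo c d, ε z ≠ 0)
    (hεt : ∀ z ∈ Ioo a b ×ˢ Ioo c d, HasDerivAt (fun t => ε (z.1, t)) (ε' z) z.2)
    (hη : ContinuousOn η (Ioo a b ×ˢ Ioo c d)) (hη' : ContinuousOn η' (Ioo a b ×ˢ Ioo c d))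
    (hηt : ∀ z ∈ Ioo a b ×ˢ Ioo c d, HasDerivAt (fun t => η (z.1, t)) (η' z) z.2) :
    ContDiffOn ℝ 1 n (Ioo a b ×ˢ Ioo c d) := by
  rcases (Ioo a b).eq_empty_or_nonempty with hempty | ⟨s₀, hs₀⟩
  · simp [hempty]
  let w : ℝ × ℝ → ℂ := fun z => exp (∫ s in s₀..z.1, η (s, z.2))
  have hw : ContDiffOn ℝ 1 w (Ioo a b ×ˢ Ioo c d) :=
    (contDiffOn_one_integral_fst hη hη' hηt hs₀).cexp
  have hwt : ∀ z ∈ Ioo a b ×ˢ Ioo c d,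
      HasDerivAt (fun t => w (z.1, t)) (w z * ∫ s in s₀..z.1, η' (s, z.2)) z.2 :=
    fun z hz => (hasDerivAt_integral_fst hη hη' hηt hs₀ hz).cexp
  have hsol : ∀ z ∈ Ioo a b ×ˢ Ioo c d, n z = n (s₀, z.2) * w z := fun z hz =>
    eq_mul_cexp_of_hasDerivAt (n := fun s => n (s, z.2)) (k := fun s => η (s, z.2))
      (hη.comp (by fun_prop) fun s hs => ⟨hs, hz.2⟩) (fun s hs => hn (s, z.2) ⟨hs, hz.2⟩)
      hs₀ hz.1
  have hν : ContDiffOn ℝ 1 (fun t => n (s₀, t)) (Ioo c d) :=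
    contDiffOn_of_increment (κ := fun z => ε z * w z) (hε.mul hw.continuousOn)
      ((hε'.mul hw.continuousOn).add
        (hε.mul (hw.continuousOn.mul (continuousOn_integral_fst hη' hs₀))))
      (fun z hz => mul_ne_zero (hε0 z hz) (exp_ne_zero _))
      (fun z hz => (hεt z hz).mul (hwt z hz)) hφ
      (fun z hz => (hφs z hz).congr_deriv (by rw [hsol z hz]; ring)) hs₀
  exact ((hν.comp contDiffOn_snd fun z hz => hz.2).mul hw).congr hsol

end System

/-! ### Characteristic coordinates -/

lemma lenP_pos {v : Plane} (hv : v ≠ 0) : 0 < lenP v := by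
  refine Real.sqrt_pos.2 (lt_of_le_of_ne (by positivity) fun h => hv ?_)
  ext <;> simp only [Prod.fst_zero, Prod.snd_zero] <;> nlinarith [sq_nonneg v.1, sq_nonneg v.2]

lemma lenP_sq (v : Plane) : lenP v ^ 2 = v.1 ^ 2 + v.2 ^ 2 := Real.sq_sqrt (by positivity)

lemma perpP_smul (x : ℝ) (v : Plane) : perpP (x • v) = x • perpP v := by
  ext <;> simp [perpP]

section Normal

variable {Ω : Set Plane} {u : Plane → ℝ} {F : Plane → Plane} {p : Plane}

lemma lenD_pos (hns : Nonsingular Ω u F) (hp : p ∈ Ω) : 0 < lenD u F p := lenP_pos (hns p hp)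

lemma lenD_smul_normalN (hns : Nonsingular Ω u F) (hp : p ∈ Ω) :
    lenD u F p • normalN u F p = shiftedGrad u F p :=
  smul_inv_smul₀ (lenD_pos hns hp).ne' _

lemma normalN_sq_add_sq (hns : Nonsingular Ω u F) (hp : p ∈ Ω) :
    (normalN u F p).1 ^ 2 + (normalN u F p).2 ^ 2 = 1 := by
  have hD := (lenD_pos hns hp).ne'
  have hsq : lenD u F p ^ 2 = _ := lenP_sq (shiftedGrad u F p)
  simp only [normalN, Prod.smul_fst, Prod.smul_snd, smul_eq_mul]
  field_simp
  exact hsq.symm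

lemma normalN_ne_zero (hns : Nonsingular Ω u F) (hp : p ∈ Ω) : normalN u F p ≠ 0 :=
  smul_ne_zero (inv_ne_zero (lenD_pos hns hp).ne') (hns p hp)

lemma normalPerp_ne_zero (hns : Nonsingular Ω u F) (hp : p ∈ Ω) : normalPerp u F p ≠ 0 :=
  fun h0 => normalN_ne_zero hns hp
    (Prod.ext (neg_eq_zero.1 (congrArg Prod.snd h0)) (congrArg Prod.fst h0))

variable (hΩ : IsOpen Ω) (hu : ContDiffOn ℝ 1 u Ω) (hF : ContDiffOn ℝ 1 F Ω)
include hΩ hu hF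

lemma continuousOn_shiftedGrad : ContinuousOn (shiftedGrad u F) Ω :=
  (continuousOn_gradP hΩ hu).add hF.continuousOn

lemma continuousOn_lenD : ContinuousOn (lenD u F) Ω := by
  have hV := continuousOn_shiftedGrad hΩ hu hF
  exact ((hV.fst.pow 2).add (hV.snd.pow 2)).sqrt

lemma continuousOn_normalN (hns : Nonsingular Ω u F) : ContinuousOn (normalN u F) Ω :=
  ((continuousOn_lenD hΩ hu hF).inv₀ fun _ hp => (lenD_pos hns hp).ne').smul
    (continuousOn_shiftedGrad hΩ hu hF)

omit hu in
lemma continuousOn_rotP : ContinuousOn (rotP F) Ω := by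
  have hF' := hF.continuousOn_fderiv_of_isOpen hΩ le_rfl
  exact (hF'.clm_apply continuousOn_const).snd.sub (hF'.clm_apply continuousOn_const).fst

lemma hasUniformDiv_lenD_smul_normalPerp (hns : Nonsingular Ω u F) :
    HasUniformDiv Ω (fun p => lenD u F p • normalPerp u F p) (rotP F) := by
  refine ((hasWeakDiv_perpP_shiftedGrad hΩ hu hF).hasUniformDiv hΩ
    (continuousOn_perpP (continuousOn_shiftedGrad hΩ hu hF)) (continuousOn_rotP hΩ hF)).congr
    (fun p hp => ?_) fun p _ => rfl
  rw [normalPerp, ← perpP_smul, lenD_smul_normalN hns hp]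

end Normal

lemma eq_columnsP {E : Type*} [NormedAddCommGroup E] [NormedSpace ℝ E] (L : Plane →L[ℝ] E) :
    L = columnsP (L (1, 0)) (L (0, 1)) := by
  ext <;> simp [columnsP_apply]

section Partials

variable {E : Type*} [NormedAddCommGroup E] [NormedSpace ℝ E] {f : Plane → E} {a b : E}
  {z : Plane}

lemma hasDerivAt_left_of_columnsP (h : HasFDerivAt f (columnsP a b) z) :
    HasDerivAt (fun x => f (x, z.2)) a z.1 := by
  have hline : HasDerivAt (fun x : ℝ => ((x, z.2) : Plane)) (1, 0) z.1 :=
    (hasDerivAt_id z.1).prodMk (hasDerivAt_const z.1 z.2)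
  refine (HasFDerivAt.comp_hasDerivAt (l := f) z.1 h hline).congr_deriv ?_
  simp [columnsP_apply]

lemma hasDerivAt_right_of_columnsP (h : HasFDerivAt f (columnsP a b) z) :
    HasDerivAt (fun y => f (z.1, y)) b z.2 := by
  have hline : HasDerivAt (fun y : ℝ => ((z.1, y) : Plane)) (0, 1) z.2 :=
    (hasDerivAt_const z.2 z.1).prodMk (hasDerivAt_id z.2)
  refine (HasFDerivAt.comp_hasDerivAt (l := f) z.2 h hline).congr_deriv ?_
  simp [columnsP_apply]

end Partials

section Frame

variable {n : Plane} {κ l : ℝ}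

lemma wedgeP_orthogonal_columns (hn : n.1 ^ 2 + n.2 ^ 2 = 1) :
    wedgeP (κ * n.2, l * n.1) (-(κ * n.1), l * n.2) = κ * l := by
  simp only [wedgeP]
  linear_combination κ * l * hn

lemma invColumnsP_orthogonal_columns (hn : n.1 ^ 2 + n.2 ^ 2 = 1) (hκ : κ ≠ 0) (hl : l ≠ 0) :
    invColumnsP (κ * n.2, l * n.1) (-(κ * n.1), l * n.2) = columnsP (κ⁻¹ • perpP n) (l⁻¹ • n) := by
  rw [invColumnsP, wedgeP_orthogonal_columns hn]
  ext <;> simp [columnsP_apply, perpP] <;> field_simp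

end Frame

namespace IsCharCoords

variable {Ω : Set Plane} {u : Plane → ℝ} {F : Plane → Plane}
  {Ψ : OpenPartialHomeomorph Plane Plane} {f g : Plane → ℝ}

lemma hasFDerivAt (hΨ : IsCharCoords Ω u F Ψ f g) {p : Plane} (hp : p ∈ Ψ.source) :
    HasFDerivAt Ψ (columnsP
      (f p * (normalN u F p).2, g p * lenD u F p * (normalN u F p).1)
      (-(f p * (normalN u F p).1), g p * lenD u F p * (normalN u F p).2)) p := by
  have hd : HasFDerivAt Ψ (fderiv ℝ Ψ p) p :=
    ((hΨ.contDiffOn.differentiableOn one_ne_zero).differentiableAt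
      (Ψ.open_source.mem_nhds hp)).hasFDerivAt
  have hs := hΨ.grad_s p hp
  have ht := hΨ.grad_t p hp
  rw [gradP, hd.fst.fderiv] at hs
  rw [gradP, hd.snd.fderiv] at ht
  rw [eq_columnsP (fderiv ℝ Ψ p)] at hd
  refine hd.congr_fderiv (congrArg₂ columnsP (Prod.ext ?_ ?_) (Prod.ext ?_ ?_))
  · exact (congrArg Prod.fst hs :)
  · exact (congrArg Prod.fst ht :)
  · exact (congrArg Prod.snd hs).trans (mul_neg _ _)
  · exact (congrArg Prod.snd ht :)

lemma hasFDerivAt_symm (hΨ : IsCharCoords Ω u F Ψ f g) (hns : Nonsingular Ω u F) {z : Plane}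
    (hz : z ∈ Ψ.target) :
    HasFDerivAt Ψ.symm (columnsP ((f (Ψ.symm z))⁻¹ • normalPerp u F (Ψ.symm z))
      ((g (Ψ.symm z) * lenD u F (Ψ.symm z))⁻¹ • normalN u F (Ψ.symm z))) z := by
  have hp := Ψ.map_target hz
  have hn := normalN_sq_add_sq hns (hΨ.source_subset hp)
  have hf := (hΨ.f_pos _ hp).ne'
  have hg := (mul_pos (hΨ.g_pos _ hp) (lenD_pos hns (hΨ.source_subset hp))).ne'
  rw [normalPerp, ← invColumnsP_orthogonal_columns hn hf hg]
  exact Ψ.hasFDerivAt_symm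
    (f' := columnsEquivP _ _ (by rw [wedgeP_orthogonal_columns hn]; exact mul_ne_zero hf hg)) hz
    (hΨ.hasFDerivAt hp)

end IsCharCoords

lemma exists_isCharCoords {Ω : Set Plane} (hΩ : IsOpen Ω) {u : Plane → ℝ} {F : Plane → Plane}
    {H : Plane → ℝ} (hu : ContDiffOn ℝ 1 u Ω) (hF : ContDiffOn ℝ 1 F Ω)
    (hns : Nonsingular Ω u F) (hdiv : HasUniformDiv Ω (normalN u F) H) {p : Plane} (hp : p ∈ Ω) :
    ∃ (Ψ : OpenPartialHomeomorph Plane Plane) (f g : Plane → ℝ), p ∈ Ψ.source ∧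
      IsCharCoords Ω u F Ψ f g ∧ IsIntegratingFactor (normalN u F) H Ψ.source f ∧
      IsIntegratingFactor (fun q => lenD u F q • normalPerp u F q) (rotP F) Ψ.source g := by
  obtain ⟨U, s, f, hpU, hUΩ, hs⟩ := hdiv.exists_isFirstIntegral hΩ hp (normalN_ne_zero hns hp)
  obtain ⟨U', t, g, hpU', -, ht⟩ :=
    (hasUniformDiv_lenD_smul_normalPerp hΩ hu hF hns).exists_isFirstIntegral hΩ hp
      (smul_ne_zero (lenD_pos hns hp).ne' (normalPerp_ne_zero hns hp))
  have hSΩ : U ∩ U' ⊆ Ω := inter_subset_left.trans hUΩ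
  have hf := hs.continuousOn.mono (inter_subset_left (t := U'))
  have hg := ht.continuousOn.mono (inter_subset_right (s := U))
  have hN := (continuousOn_normalN hΩ hu hF hns).mono hSΩ
  have hgD := hg.mul ((continuousOn_lenD hΩ hu hF).mono hSΩ)
  have hder : ∀ q ∈ U ∩ U', HasFDerivAt (fun q => ((-s q, t q) : Plane)) (columnsP
      (f q * (normalN u F q).2, g q * lenD u F q * (normalN u F q).1)
      (-(f q * (normalN u F q).1), g q * lenD u F q * (normalN u F q).2)) q := fun q hq => by
    refine ((hs.hasFDerivAt q hq.1).neg.prodMk (ht.hasFDerivAt q hq.2)).congr_fderiv ?_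
    ext <;> simp [columnsP_apply, wedgeCLM_apply, wedgeP, normalPerp, perpP, mul_assoc]
  obtain ⟨Ψ, hpΨ, hΨS, hΨ, hΨ1, hΨ2, -⟩ := exists_openPartialHomeomorph_of_columns
    (hs.isOpen.inter ht.isOpen) hder ((hf.mul hN.snd).prodMk (hgD.mul hN.fst))
    ((hf.mul hN.fst).neg.prodMk (hgD.mul hN.snd)) (fun q hq => by
      rw [wedgeP_orthogonal_columns (normalN_sq_add_sq hns (hSΩ hq))]
      exact (mul_pos (hs.pos q hq.1)
        (mul_pos (ht.pos q hq.2) (lenD_pos hns (hSΩ hq)))).ne') ⟨hpU, hpU'⟩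
  refine ⟨Ψ, f, g, hpΨ, ⟨hΨS.trans hSΩ, hΨ1, hΨ2, hf.mono hΨS, hg.mono hΨS,
    fun q hq => hs.pos q (hΨS hq).1, fun q hq => ht.pos q (hΨS hq).2, fun q hq => ?_,
    fun q hq => ?_⟩, hs.transport.mono (hΨS.trans inter_subset_left),
    ht.transport.mono (hΨS.trans inter_subset_right)⟩
  all_goals simp only [hΨ, gradP]
  · rw [(hder q (hΨS hq)).fst.fderiv]
    simp [columnsP_apply, normalPerp, perpP]
  · rw [(hder q (hΨS hq)).snd.fderiv]
    ext <;> simp [columnsP_apply]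

lemma exists_Ioo_prod_Ioo_subset {S : Set Plane} (hS : IsOpen S) {z : Plane} (hz : z ∈ S) :
    ∃ a b c d : ℝ, z ∈ Ioo a b ×ˢ Ioo c d ∧ Ioo a b ×ˢ Ioo c d ⊆ S := by
  obtain ⟨δ, hδ, h⟩ := Metric.isOpen_iff.1 hS z hz
  rw [← ball_prod_same, Real.ball_eq_Ioo, Real.ball_eq_Ioo] at h
  exact ⟨_, _, _, _, ⟨⟨by linarith, by linarith⟩, by linarith, by linarith⟩, h⟩

/-- The identification of the plane with `ℂ`. -/
noncomputable def toComplexP : Plane ≃L[ℝ] ℂ := Complex.equivRealProdCLM.symm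

lemma toComplexP_perpP (v : Plane) : toComplexP (perpP v) = -Complex.I * toComplexP v := by
  simp only [toComplexP, Complex.equivRealProdCLM_symm_apply, perpP]
  push_cast
  linear_combination (v.2 : ℂ) * Complex.I_mul_I

lemma hasDerivAt_toComplexP_of_smul_perpP {c : ℝ → Plane} {x k : ℝ} {v : Plane}
    (h : HasDerivAt c (k • perpP v) x) :
    HasDerivAt (fun x => toComplexP (c x)) (-Complex.I * k * toComplexP v) x := by
  refine (toComplexP.hasFDerivAt.comp_hasDerivAt x h).congr_deriv ?_
  change toComplexP (k • perpP v) = _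
  rw [map_smul, toComplexP_perpP, Complex.real_smul]
  ring

namespace IsCharCoords

variable {Ω : Set Plane} {u : Plane → ℝ} {F : Plane → Plane} {H : Plane → ℝ}
  {Ψ : OpenPartialHomeomorph Plane Plane} {f g : Plane → ℝ}

lemma mapsTo_symm (hΨ : IsCharCoords Ω u F Ψ f g) : MapsTo Ψ.symm Ψ.target Ω :=
  fun _ hz => hΨ.source_subset (Ψ.map_target hz)

lemma gradFactor_t_pos (hΨ : IsCharCoords Ω u F Ψ f g) (hns : Nonsingular Ω u F) {z : Plane}
    (hz : z ∈ Ψ.target) : 0 < g (Ψ.symm z) * lenD u F (Ψ.symm z) :=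
  mul_pos (hΨ.g_pos _ (Ψ.map_target hz)) (lenD_pos hns (hΨ.mapsTo_symm hz))

lemma continuousOn_speed_s (hΨ : IsCharCoords Ω u F Ψ f g) :
    ContinuousOn (fun z => (f (Ψ.symm z))⁻¹) Ψ.target :=
  (hΨ.f_cont.comp Ψ.continuousOn_symm Ψ.symm.mapsTo).inv₀
    fun _ hz => (hΨ.f_pos _ (Ψ.map_target hz)).ne'

lemma continuousOn_speed_t (hΨ : IsCharCoords Ω u F Ψ f g) (hns : Nonsingular Ω u F)
    (hD : ContinuousOn (lenD u F) Ω) :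
    ContinuousOn (fun z => (g (Ψ.symm z) * lenD u F (Ψ.symm z))⁻¹) Ψ.target :=
  ((hΨ.g_cont.comp Ψ.continuousOn_symm Ψ.symm.mapsTo).mul
    (hD.comp Ψ.continuousOn_symm hΨ.mapsTo_symm)).inv₀ fun _ hz => (hΨ.gradFactor_t_pos hns hz).ne'

section Rectangle

variable {a b c d : ℝ} (hΨ : IsCharCoords Ω u F Ψ f g) (hns : Nonsingular Ω u F)
  (hR : Ioo a b ×ˢ Ioo c d ⊆ Ψ.target) {z : Plane} (hz : z ∈ Ioo a b ×ˢ Ioo c d)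
include hΨ hns hR hz

lemma hasDerivAt_normalN_symm (hΩ : IsOpen Ω) (hdiv : HasUniformDiv Ω (normalN u F) H) :
    HasDerivAt (fun s => normalN u F (Ψ.symm (s, z.2)))
      (((f (Ψ.symm z))⁻¹ * H (Ψ.symm z)) • normalPerp u F (Ψ.symm z)) z.1 := by
  have hline {s : ℝ} (hs : s ∈ Ioo a b) : (s, z.2) ∈ Ψ.target := hR ⟨hs, hz.2⟩
  exact hdiv.hasDerivAt_unit_field hΩ (fun p hp => normalN_sq_add_sq hns hp)
    (c := fun s => Ψ.symm (s, z.2)) (e := fun s => (f (Ψ.symm (s, z.2)))⁻¹)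
    (fun s hs => hΨ.mapsTo_symm (hline hs))
    (fun s hs => hasDerivAt_left_of_columnsP (hΨ.hasFDerivAt_symm hns (hline hs)))
    (hΨ.continuousOn_speed_s.comp (f := fun s => (s, z.2)) (by fun_prop) fun s hs => hline hs)
    (fun s hs => (inv_pos.2 (hΨ.f_pos _ (Ψ.map_target (hline hs)))).le) hz.1

lemma hasDerivAt_comp_symm_of_hasDerivAlong (hD : ContinuousOn (lenD u F) Ω) {k : Plane → ℝ}
    {k' : ℝ} (hk : HasDerivAlong (normalN u F) Ω k (Ψ.symm z) k') :
    HasDerivAt (fun t => k (Ψ.symm (z.1, t)))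
      ((g (Ψ.symm z) * lenD u F (Ψ.symm z))⁻¹ * k') z.2 := by
  have hline {t : ℝ} (ht : t ∈ Ioo c d) : (z.1, t) ∈ Ψ.target := hR ⟨hz.1, ht⟩
  exact hk.hasDerivAt_comp (c := fun t => Ψ.symm (z.1, t))
    (b := fun t => (g (Ψ.symm (z.1, t)) * lenD u F (Ψ.symm (z.1, t)))⁻¹)
    (fun t ht => hasDerivAt_right_of_columnsP (hΨ.hasFDerivAt_symm hns (hline ht)))
    (fun t ht => hΨ.mapsTo_symm (hline ht))
    ((hΨ.continuousOn_speed_t hns hD).comp (f := fun t => (z.1, t)) (by fun_prop)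
      fun t ht => hline ht)
    (fun t ht => (inv_pos.2 (hΨ.gradFactor_t_pos hns (hline ht))).ne') hz.2

lemma hasDerivAt_speed_s (hfH : IsIntegratingFactor (normalN u F) H Ψ.source f) :
    HasDerivAt (fun t => (f (Ψ.symm (z.1, t)))⁻¹)
      ((g (Ψ.symm z) * lenD u F (Ψ.symm z))⁻¹ * H (Ψ.symm z) * (f (Ψ.symm z))⁻¹) z.2 := by
  have hline {t : ℝ} (ht : t ∈ Ioo c d) : (z.1, t) ∈ Ψ.target := hR ⟨hz.1, ht⟩
  have hf0 : f (Ψ.symm z) ≠ 0 := (hΨ.f_pos _ (Ψ.map_target (hR hz))).ne'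
  have hf := hfH (fun t => Ψ.symm (z.1, t))
    (fun t => (g (Ψ.symm (z.1, t)) * lenD u F (Ψ.symm (z.1, t)))⁻¹) z.2 <| by
      filter_upwards [isOpen_Ioo.mem_nhds hz.2] with t ht
      exact ⟨Ψ.map_target (hline ht),
        hasDerivAt_right_of_columnsP (hΨ.hasFDerivAt_symm hns (hline ht))⟩
  refine (hf.fun_inv hf0).congr_deriv ?_
  field_simp

end Rectangle

/- In the complex notation `φ` for the position and `n` for the normal, the coordinates satisfy
`φ_s = -i ε n` and `n_s = -i ε H n` with `ε = 1 / f`. -/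
lemma contDiffOn_normalN_symm (hΨ : IsCharCoords Ω u F Ψ f g) (hns : Nonsingular Ω u F)
    (hΩ : IsOpen Ω) (hD : ContinuousOn (lenD u F) Ω) (hdiv : HasUniformDiv Ω (normalN u F) H)
    (hfH : IsIntegratingFactor (normalN u F) H Ψ.source f) {NH : Plane → ℝ}
    (hNH : HasContDerivAlong (normalN u F) Ω H NH) {a b c d : ℝ}
    (hR : Ioo a b ×ˢ Ioo c d ⊆ Ψ.target) :
    ContDiffOn ℝ 1 (fun z => toComplexP (normalN u F (Ψ.symm z))) (Ioo a b ×ˢ Ioo c d) := by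
  have hpull {k : Plane → ℝ} (hk : ContinuousOn k Ω) :
      ContinuousOn (fun z => k (Ψ.symm z)) (Ioo a b ×ˢ Ioo c d) :=
    (hk.comp Ψ.continuousOn_symm hΨ.mapsTo_symm).mono hR
  have hH := hpull (hdiv.continuousOn hΩ).2
  have hε := hΨ.continuousOn_speed_s.mono hR
  have hε' := ((hΨ.continuousOn_speed_t hns hD).mono hR).mul hH |>.mul hε
  have hη' := (hε'.mul hH).add (hε.mul
    (((hΨ.continuousOn_speed_t hns hD).mono hR).mul (hpull hNH.1)))
  have hcast {k : Plane → ℝ} (hk : ContinuousOn k (Ioo a b ×ˢ Ioo c d)) :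
      ContinuousOn (fun z => -Complex.I * k z) (Ioo a b ×ˢ Ioo c d) :=
    continuousOn_const.mul (Complex.continuous_ofReal.comp_continuousOn hk)
  have hεt : ∀ z ∈ Ioo a b ×ˢ Ioo c d, HasDerivAt (fun t => (f (Ψ.symm (z.1, t)))⁻¹) _ z.2 :=
    fun z hz => hΨ.hasDerivAt_speed_s hns hR hz hfH
  have hηt : ∀ z ∈ Ioo a b ×ˢ Ioo c d,
      HasDerivAt (fun t => (f (Ψ.symm (z.1, t)))⁻¹ * H (Ψ.symm (z.1, t))) _ z.2 := fun z hz =>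
    (hεt z hz).mul (hΨ.hasDerivAt_comp_symm_of_hasDerivAlong hns hR hz hD
      (hNH.2 _ (hΨ.mapsTo_symm (hR hz))))
  exact contDiffOn_of_system (φ := fun z => toComplexP (Ψ.symm z))
    (fun z hz => hasDerivAt_toComplexP_of_smul_perpP
      (hΨ.hasDerivAt_normalN_symm hns hR hz hΩ hdiv))
    (toComplexP.contDiff.comp_contDiffOn (hΨ.contDiffOn_symm.mono hR))
    (fun z hz => hasDerivAt_toComplexP_of_smul_perpP
      (hasDerivAt_left_of_columnsP (hΨ.hasFDerivAt_symm hns (hR hz))))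
    (hcast hε) (hcast hε')
    (fun z hz => mul_ne_zero (neg_ne_zero.2 Complex.I_ne_zero)
      (Complex.ofReal_ne_zero.2 (inv_pos.2 (hΨ.f_pos _ (Ψ.map_target (hR hz)))).ne'))
    (fun z hz => (hεt z hz).ofReal_comp.const_mul _)
    (hcast (hε.mul hH)) (hcast hη') (fun z hz => (hηt z hz).ofReal_comp.const_mul _)

lemma contDiffOn_normalN (hΨ : IsCharCoords Ω u F Ψ f g) (hns : Nonsingular Ω u F)
    (hΩ : IsOpen Ω) (hD : ContinuousOn (lenD u F) Ω) (hdiv : HasUniformDiv Ω (normalN u F) H)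
    (hfH : IsIntegratingFactor (normalN u F) H Ψ.source f) {NH : Plane → ℝ}
    (hNH : HasContDerivAlong (normalN u F) Ω H NH) :
    ContDiffOn ℝ 1 (normalN u F) Ψ.source := by
  have hchart : ContDiffOn ℝ 1 (fun z => normalN u F (Ψ.symm z)) Ψ.target := fun z hz => by
    obtain ⟨a, b, c, d, hzR, hR⟩ := exists_Ioo_prod_Ioo_subset Ψ.open_target hz
    have hn := toComplexP.symm.contDiff.comp_contDiffOn
      (hΨ.contDiffOn_normalN_symm hns hΩ hD hdiv hfH hNH hR)
    refine ContDiffAt.contDiffWithinAt ?_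
    simpa only [Function.comp_def, ContinuousLinearEquiv.symm_apply_apply] using
      hn.contDiffAt ((isOpen_Ioo.prod isOpen_Ioo).mem_nhds hzR)
  exact (hchart.comp hΨ.contDiffOn Ψ.mapsTo).congr fun q hq => by
    rw [Function.comp_apply, Ψ.left_inv hq]

lemma exists_isCharCurve (hΨ : IsCharCoords Ω u F Ψ f g) (hns : Nonsingular Ω u F) {p : Plane}
    (hp : p ∈ Ψ.source) :
    ∃ (γ : ℝ → Plane) (a b τ : ℝ), IsCharCurve Ω u F γ a b ∧ τ ∈ Ioo a b ∧ γ τ = p := by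
  obtain ⟨a, b, c, d, hz, hR⟩ := exists_Ioo_prod_Ioo_subset Ψ.open_target (Ψ.map_source hp)
  have hline {s : ℝ} (hs : s ∈ Ioo a b) : (s, (Ψ p).2) ∈ Ψ.target := hR ⟨hs, hz.2⟩
  have hγ := exists_isCurveIn_through (c := fun s => Ψ.symm (s, (Ψ p).2))
    (fun s hs => hasDerivAt_left_of_columnsP (hΨ.hasFDerivAt_symm hns (hline hs)))
    (fun s hs => hΨ.mapsTo_symm (hline hs))
    (hΨ.continuousOn_speed_s.comp (by fun_prop) fun s hs => hline hs)
    (fun s hs => (inv_pos.2 (hΨ.f_pos _ (Ψ.map_target (hline hs)))).ne') hz.1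
  simpa only [IsCharCurve, normalPerp, Prod.mk.eta, Ψ.left_inv hp] using hγ

lemma exists_isSeedCurve (hΨ : IsCharCoords Ω u F Ψ f g) (hns : Nonsingular Ω u F)
    (hD : ContinuousOn (lenD u F) Ω) {p : Plane} (hp : p ∈ Ψ.source) :
    ∃ (γ : ℝ → Plane) (a b τ : ℝ), IsSeedCurve Ω u F γ a b ∧ τ ∈ Ioo a b ∧ γ τ = p := by
  obtain ⟨a, b, c, d, hz, hR⟩ := exists_Ioo_prod_Ioo_subset Ψ.open_target (Ψ.map_source hp)
  have hline {t : ℝ} (ht : t ∈ Ioo c d) : ((Ψ p).1, t) ∈ Ψ.target := hR ⟨hz.1, ht⟩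
  have hγ := exists_isCurveIn_through (c := fun t => Ψ.symm ((Ψ p).1, t))
    (fun t ht => hasDerivAt_right_of_columnsP (hΨ.hasFDerivAt_symm hns (hline ht)))
    (fun t ht => hΨ.mapsTo_symm (hline ht))
    ((hΨ.continuousOn_speed_t hns hD).comp (by fun_prop) fun t ht => hline ht)
    (fun t ht => (inv_pos.2 (hΨ.gradFactor_t_pos hns (hline ht))).ne') hz.2
  simpa only [IsSeedCurve, Prod.mk.eta, Ψ.left_inv hp] using hγ

end IsCharCoords

/-! ### The derivative of `D` along the characteristic curves -/

lemma IsCurveIn.hasDerivAt {V : Plane → Plane} {Ω : Set Plane} {γ : ℝ → Plane} {a b τ : ℝ}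
    (hγ : IsCurveIn V Ω γ a b) (hτ : τ ∈ Ioo a b) : HasDerivAt γ (V (γ τ)) τ :=
  (hγ.1 τ hτ).hasDerivAt (isOpen_Ioo.mem_nhds hτ)

namespace IsCharCoords

variable {Ω : Set Plane} {u : Plane → ℝ} {F : Plane → Plane}
  {Ψ : OpenPartialHomeomorph Plane Plane} {f g : Plane → ℝ}

lemma hasFDerivAt_snd (hΨ : IsCharCoords Ω u F Ψ f g) {p : Plane} (hp : p ∈ Ψ.source) :
    HasFDerivAt (fun q => (Ψ q).2) ((g p * lenD u F p) • wedgeCLM (normalPerp u F p)) p := by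
  refine (hΨ.hasFDerivAt hp).snd.congr_fderiv ?_
  ext <;> simp [columnsP_apply, wedgeCLM_apply, wedgeP, normalPerp, perpP]

lemma eventually_snd_comp_eq (hΨ : IsCharCoords Ω u F Ψ f g) {γ : ℝ → Plane} {a b τ : ℝ}
    (hγ : IsCharCurve Ω u F γ a b) (hτ : τ ∈ Ioo a b) (hγτ : γ τ ∈ Ψ.source) :
    ∀ᶠ r in 𝓝 τ, (Ψ (γ r)).2 = (Ψ (γ τ)).2 := by
  refine eventually_comp_eq_of_tangent (t := fun q => (Ψ q).2) (v := fun r => normalPerp u F (γ r))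
    (g := fun r => g (γ r) * lenD u F (γ r)) (β := fun _ => 1) ?_
  filter_upwards [(hγ.hasDerivAt hτ).continuousAt.eventually_mem (Ψ.open_source.mem_nhds hγτ),
    isOpen_Ioo.mem_nhds hτ] with r hr hrab
  exact ⟨hΨ.hasFDerivAt_snd hr, by simpa only [one_smul] using hγ.hasDerivAt hrab⟩

/- On a rectangle a first integral `w` of `N^⊥` depends on `t` alone, and so does
`∂w/∂t = G / (g D)`. -/
lemma div_eq_div_of_hasFDerivAt (hΨ : IsCharCoords Ω u F Ψ f g) (hns : Nonsingular Ω u F)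
    {w G : Plane → ℝ} {a b c d : ℝ} (hR : Ioo a b ×ˢ Ioo c d ⊆ Ψ.target)
    (hw : ∀ z ∈ Ioo a b ×ˢ Ioo c d,
      HasFDerivAt w (G (Ψ.symm z) • wedgeCLM (normalPerp u F (Ψ.symm z))) (Ψ.symm z))
    {s s' t : ℝ} (hs : s ∈ Ioo a b) (hs' : s' ∈ Ioo a b) (ht : t ∈ Ioo c d) :
    G (Ψ.symm (s, t)) / (g (Ψ.symm (s, t)) * lenD u F (Ψ.symm (s, t))) =
      G (Ψ.symm (s', t)) / (g (Ψ.symm (s', t)) * lenD u F (Ψ.symm (s', t))) := by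
  have hconst : ∀ t ∈ Ioo c d, w (Ψ.symm (s, t)) = w (Ψ.symm (s', t)) := fun t ht => by
    refine eq_of_hasDerivAt_zero (f := fun s => w (Ψ.symm (s, t))) (fun x hx => ?_) hs hs'
    refine ((hw (x, t) ⟨hx, ht⟩).comp_hasDerivAt x (hasDerivAt_left_of_columnsP
      (hΨ.hasFDerivAt_symm hns (hR (mk_mem_prod hx ht))))).congr_deriv ?_
    simp only [smul_apply, map_smul, wedgeCLM_apply, wedgeP, smul_eq_mul]
    ring
  have ht_deriv : ∀ x ∈ Ioo a b, HasDerivAt (fun t => w (Ψ.symm (x, t)))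
      (G (Ψ.symm (x, t)) / (g (Ψ.symm (x, t)) * lenD u F (Ψ.symm (x, t)))) t := fun x hx => by
    have hn := normalN_sq_add_sq hns (hΨ.mapsTo_symm (hR (mk_mem_prod hx ht)))
    refine ((hw (x, t) ⟨hx, ht⟩).comp_hasDerivAt t (hasDerivAt_right_of_columnsP
      (hΨ.hasFDerivAt_symm hns (hR (mk_mem_prod hx ht))))).congr_deriv ?_
    simp only [smul_apply, map_smul, wedgeCLM_apply, wedgeP, normalPerp, perpP, smul_eq_mul,
      div_eq_mul_inv]
    linear_combination (G (Ψ.symm (x, t)) * (g (Ψ.symm (x, t)) * lenD u F (Ψ.symm (x, t)))⁻¹) * hn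
  refine (ht_deriv s hs).unique ((ht_deriv s' hs').congr_of_eventuallyEq ?_)
  filter_upwards [isOpen_Ioo.mem_nhds ht] with t' ht'
  exact hconst t' ht'

lemma eventually_div_comp_eq (hΨ : IsCharCoords Ω u F Ψ f g) (hns : Nonsingular Ω u F)
    {U : Set Plane} {k w G : Plane → ℝ} (hw : IsFirstIntegral (normalPerp u F) k U w G)
    {γ : ℝ → Plane} {a b τ : ℝ} (hγ : IsCharCurve Ω u F γ a b) (hτ : τ ∈ Ioo a b)
    (hγΨ : γ τ ∈ Ψ.source) (hγU : γ τ ∈ U) :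
    ∀ᶠ r in 𝓝 τ, G (γ r) / (g (γ r) * lenD u F (γ r)) =
      G (γ τ) / (g (γ τ) * lenD u F (γ τ)) := by
  obtain ⟨a', b', c', d', hz, hR⟩ := exists_Ioo_prod_Ioo_subset
    (Ψ.symm.isOpen_inter_preimage hw.isOpen)
    (z := Ψ (γ τ)) ⟨Ψ.map_source hγΨ, by rwa [mem_preimage, Ψ.left_inv hγΨ]⟩
  have hγc := (hγ.hasDerivAt hτ).continuousAt
  have hΨγ : ContinuousAt (fun r => (Ψ (γ r)).1) τ :=
    ((Ψ.continuousAt hγΨ).comp hγc).fst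
  filter_upwards [hΨ.eventually_snd_comp_eq hγ hτ hγΨ,
    hγc.eventually_mem (Ψ.open_source.mem_nhds hγΨ),
    hΨγ.eventually_mem (isOpen_Ioo.mem_nhds hz.1)] with r hr hrΨ hrR
  have hconst := hΨ.div_eq_div_of_hasFDerivAt hns (fun z hz => (hR hz).1)
    (fun z hz => hw.hasFDerivAt _ (hR hz).2) hrR hz.1 hz.2
  rwa [Prod.mk.eta, ← hr, Prod.mk.eta, Ψ.left_inv hγΨ, Ψ.left_inv hrΨ] at hconst

/- `G` is an integrating factor of `N^⊥` and `g` one of `D N^⊥`, so that `D` is a constant multiple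
of `G / g` along each characteristic curve. -/
lemma hasDerivAt_lenD_comp (hΨ : IsCharCoords Ω u F Ψ f g) (hns : Nonsingular Ω u F)
    {h k w G : Plane → ℝ} {U : Set Plane}
    (hg : IsIntegratingFactor (fun q => lenD u F q • normalPerp u F q) h Ψ.source g)
    (hw : IsFirstIntegral (normalPerp u F) k U w G)
    {γ : ℝ → Plane} {a b τ : ℝ} (hγ : IsCharCurve Ω u F γ a b) (hτ : τ ∈ Ioo a b)
    (hγΨ : γ τ ∈ Ψ.source) (hγU : γ τ ∈ U) :
    HasDerivAt (fun r => lenD u F (γ r)) (h (γ τ) - lenD u F (γ τ) * k (γ τ)) τ := by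
  have hγc := (hγ.hasDerivAt hτ).continuousAt
  have hΨev := hγc.eventually_mem (Ψ.open_source.mem_nhds hγΨ)
  have hD {q : Plane} (hq : q ∈ Ψ.source) : lenD u F q ≠ 0 :=
    (lenD_pos hns (hΨ.source_subset hq)).ne'
  have hg0 {q : Plane} (hq : q ∈ Ψ.source) : g q ≠ 0 := (hΨ.g_pos q hq).ne'
  have hG0 := (hw.pos _ hγU).ne'
  have hG' := hw.transport γ (fun _ => 1) τ <| by
    filter_upwards [hγc.eventually_mem (hw.isOpen.mem_nhds hγU), isOpen_Ioo.mem_nhds hτ]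
      with r hrU hr
    exact ⟨hrU, by simpa only [one_smul] using hγ.hasDerivAt hr⟩
  have hg' := hg γ (fun r => (lenD u F (γ r))⁻¹) τ <| by
    filter_upwards [hΨev, isOpen_Ioo.mem_nhds hτ] with r hrΨ hr
    exact ⟨hrΨ, by simpa only [inv_smul_smul₀ (hD hrΨ)] using hγ.hasDerivAt hr⟩
  refine (((hG'.fun_div hg' (hg0 hγΨ)).div_const
    (G (γ τ) / (g (γ τ) * lenD u F (γ τ)))).congr_of_eventuallyEq ?_).congr_deriv ?_
  · filter_upwards [hΨev, hΨ.eventually_div_comp_eq hns hw hγ hτ hγΨ hγU,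
      hγc.eventually_mem (hw.isOpen.mem_nhds hγU)] with r hrΨ hr hrU
    have hGr := (hw.pos _ hrU).ne'
    have hgr := hg0 hrΨ
    have hDr := hD hrΨ
    rw [← hr]
    field_simp
  · have hgτ := hg0 hγΨ
    have hDτ := hD hγΨ
    field_simp
    ring

end IsCharCoords

lemma IsCurveIn.contDiffOn_two {V : Plane → Plane} {Ω : Set Plane} {γ : ℝ → Plane} {a b : ℝ}
    (hγ : IsCurveIn V Ω γ a b) (hV : ContDiffOn ℝ 1 V Ω) : ContDiffOn ℝ 2 γ (Ioo a b) := by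
  have hdiff : DifferentiableOn ℝ γ (Ioo a b) := fun s hs =>
    (hγ.hasDerivAt hs).differentiableAt.differentiableWithinAt
  have hderiv : EqOn (deriv γ) (V ∘ γ) (Ioo a b) := fun s hs => (hγ.hasDerivAt hs).deriv
  have hγ₁ : ContDiffOn ℝ 1 γ (Ioo a b) := by
    rw [← zero_add 1, contDiffOn_succ_iff_deriv_of_isOpen isOpen_Ioo, contDiffOn_zero]
    exact ⟨hdiff, by simp, (hV.continuousOn.comp hdiff.continuousOn hγ.2).congr hderiv⟩
  rw [← one_add_one_eq_two, contDiffOn_succ_iff_deriv_of_isOpen isOpen_Ioo]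
  exact ⟨hdiff, by simp, (hV.comp hγ₁ hγ.2).congr hderiv⟩

/-! ### Angle functions -/

lemma exists_cos_sin_eq {x y : ℝ} (h : x ^ 2 + y ^ 2 = 1) :
    ∃ θ : ℝ, x = Real.cos θ ∧ y = Real.sin θ := by
  have hnorm : ‖(⟨x, y⟩ : ℂ)‖ = 1 := by
    rw [Complex.norm_def, Complex.normSq_mk, ← sq, ← sq, h, Real.sqrt_one]
  have hne : (⟨x, y⟩ : ℂ) ≠ 0 := norm_ne_zero_iff.1 (hnorm ▸ one_ne_zero)
  exact ⟨Complex.arg ⟨x, y⟩, by rw [Complex.cos_arg hne, hnorm, div_one],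
    by rw [Complex.sin_arg, hnorm, div_one]⟩

lemma cos_sin_add_arcsin {α C S x y : ℝ} (hC : C = x * Real.cos α + y * Real.sin α)
    (hS : S = y * Real.cos α - x * Real.sin α) (hxy : x ^ 2 + y ^ 2 = 1) (hpos : 0 < C) :
    x = Real.cos (α + Real.arcsin S) ∧ y = Real.sin (α + Real.arcsin S) := by
  have hα := Real.sin_sq_add_cos_sq α
  have hCS : C ^ 2 + S ^ 2 = 1 := by
    rw [hC, hS]
    linear_combination (x ^ 2 + y ^ 2) * hα + hxy
  have hcos : Real.cos (Real.arcsin S) = C := by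
    rw [Real.cos_arcsin, ← hCS, add_sub_cancel_right, Real.sqrt_sq hpos.le]
  have hsin : Real.sin (Real.arcsin S) = S := Real.sin_arcsin (by nlinarith) (by nlinarith)
  rw [Real.cos_add, Real.sin_add, hcos, hsin, hC, hS]
  exact ⟨by linear_combination -x * hα, by linear_combination -y * hα⟩

section Angle

variable {N : Plane → Plane} {U : Set Plane} {θ : Plane → ℝ}

lemma exists_continuousOn_angle (hU : IsOpen U) (hN : ContinuousOn N U)
    (hunit : ∀ q ∈ U, (N q).1 ^ 2 + (N q).2 ^ 2 = 1) {p : Plane} (hp : p ∈ U) :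
    ∃ (V : Set Plane) (θ : Plane → ℝ), IsOpen V ∧ p ∈ V ∧ V ⊆ U ∧ ContinuousOn θ V ∧
      ∀ q ∈ V, N q = (Real.cos (θ q), Real.sin (θ q)) := by
  obtain ⟨α, hcos, hsin⟩ := exists_cos_sin_eq (hunit p hp)
  have hC : ContinuousOn (fun q => (N q).1 * Real.cos α + (N q).2 * Real.sin α) U := by fun_prop
  have hS : ContinuousOn (fun q => (N q).2 * Real.cos α - (N q).1 * Real.sin α) U := by fun_prop
  refine ⟨_, fun q => α + Real.arcsin ((N q).2 * Real.cos α - (N q).1 * Real.sin α),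
    hC.isOpen_inter_preimage hU (isOpen_Ioi (a := 0)), ⟨hp, ?_⟩, inter_subset_left,
    continuousOn_const.add (Real.continuous_arcsin.comp_continuousOn (hS.mono inter_subset_left)),
    fun q hq => ?_⟩
  · rw [mem_preimage, hcos, hsin, ← sq, ← sq, Real.cos_sq_add_sin_sq]
    exact one_pos (α := ℝ)
  · obtain ⟨hx, hy⟩ := cos_sin_add_arcsin rfl rfl (hunit q hq.1) hq.2
    exact Prod.ext hx hy

variable (hU : IsOpen U) (hangle : ∀ q ∈ U, N q = (Real.cos (θ q), Real.sin (θ q)))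
include hU hangle

lemma contDiffOn_angle (hN : ContDiffOn ℝ 1 N U) (hθ : ContinuousOn θ U) :
    ContDiffOn ℝ 1 θ U := fun p hp => by
  have hUp := hU.mem_nhds hp
  have hNp : ContDiffAt ℝ 1 N p := hN.contDiffAt hUp
  have hS : ContDiffAt ℝ 1 (fun q => (N q).2 * Real.cos (θ p) - (N q).1 * Real.sin (θ p)) p :=
    (hNp.snd.mul contDiffAt_const).sub (hNp.fst.mul contDiffAt_const)
  have hS0 : (N p).2 * Real.cos (θ p) - (N p).1 * Real.sin (θ p) = 0 := by
    rw [hangle p hp]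
    ring
  have harcsin : ContDiffAt ℝ 1
      (fun q => θ p + Real.arcsin ((N q).2 * Real.cos (θ p) - (N q).1 * Real.sin (θ p))) p :=
    contDiffAt_const.add (ContDiffAt.comp (g := Real.arcsin) p
      (Real.contDiffAt_arcsin (by simp [hS0]) (by simp [hS0])) hS)
  have hnear : ∀ᶠ q in 𝓝 p, |θ q - θ p| < Real.pi / 2 :=
    ((hθ.continuousAt hUp).sub continuousAt_const).abs.eventually
      (Iio_mem_nhds (by simp [Real.pi_pos]))
  refine (harcsin.congr_of_eventuallyEq ?_).contDiffWithinAt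
  filter_upwards [hnear, hUp] with q hq hqU
  rw [hangle q hqU, ← Real.sin_sub,
    Real.arcsin_sin (by linarith [(abs_lt.1 hq).1]) (abs_lt.1 hq).2.le, add_sub_cancel]

lemma fderiv_angle_apply (hθ : ContDiffOn ℝ 1 θ U) {p : Plane} (hp : p ∈ U) :
    fderiv ℝ θ p (N p) = divP (fun q => perpP (N q)) p := by
  have hd : HasFDerivAt θ (fderiv ℝ θ p) p :=
    ((hθ.differentiableOn one_ne_zero).differentiableAt (hU.mem_nhds hp)).hasFDerivAt
  have hperp : HasFDerivAt (fun q => perpP (N q)) _ p :=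
    (hd.sin.prodMk hd.cos.neg).congr_of_eventuallyEq <| by
      filter_upwards [hU.mem_nhds hp] with q hq
      rw [hangle q hq]
      rfl
  rw [divP, hperp.fderiv, apply_eq_smul_add_smul, hangle p hp]
  simp

end Angle

/-! ### The regularity theorem -/

section Solution

variable {Ω : Set Plane} {u : Plane → ℝ} {F : Plane → Plane} {H : Plane → ℝ}

lemma contDiffOn_normalN_of_hasUniformDiv (hΩ : IsOpen Ω) (hu : ContDiffOn ℝ 1 u Ω)
    (hF : ContDiffOn ℝ 1 F Ω) (hns : Nonsingular Ω u F) (hdiv : HasUniformDiv Ω (normalN u F) H)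
    {NH : Plane → ℝ} (hNH : HasContDerivAlong (normalN u F) Ω H NH) :
    ContDiffOn ℝ 1 (normalN u F) Ω := fun p hp => by
  obtain ⟨Ψ, f, g, hpΨ, hΨ, hf, -⟩ := exists_isCharCoords hΩ hu hF hns hdiv hp
  exact ((hΨ.contDiffOn_normalN hns hΩ (continuousOn_lenD hΩ hu hF) hdiv hf hNH).contDiffAt
    (Ψ.open_source.mem_nhds hpΨ)).contDiffWithinAt

lemma contDiffOn_normalPerp (hN : ContDiffOn ℝ 1 (normalN u F) Ω) :
    ContDiffOn ℝ 1 (normalPerp u F) Ω :=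
  hN.snd.prodMk hN.fst.neg

lemma hasContDerivAlong_lenD (hΩ : IsOpen Ω) (hu : ContDiffOn ℝ 1 u Ω) (hF : ContDiffOn ℝ 1 F Ω)
    (hns : Nonsingular Ω u F) (hdiv : HasUniformDiv Ω (normalN u F) H)
    (hN : ContDiffOn ℝ 1 (normalN u F) Ω) :
    HasContDerivAlong (normalPerp u F) Ω (lenD u F)
      (fun p => rotP F p - lenD u F p * divP (normalPerp u F) p) := by
  have hperp := contDiffOn_normalPerp hN
  have hdivPerp := continuousOn_divP hΩ hperp
  refine ⟨(continuousOn_rotP hΩ hF).sub ((continuousOn_lenD hΩ hu hF).mul hdivPerp), ?_⟩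
  rintro _ hp γ a b τ hγ hτ rfl
  obtain ⟨Ψ, f, g, hpΨ, hΨ, -, hg⟩ := exists_isCharCoords hΩ hu hF hns hdiv hp
  obtain ⟨U, w, G, hpU, -, hw⟩ := ((hasWeakDiv_divP hΩ hperp).hasUniformDiv hΩ hperp.continuousOn
    hdivPerp).exists_isFirstIntegral hΩ hp (normalPerp_ne_zero hns hp)
  exact hΨ.hasDerivAt_lenD_comp hns hg hw hγ hτ hpΨ hpU

lemma HasContDerivAlong.log {V : Plane → Plane} {h k : Plane → ℝ}
    (hk : HasContDerivAlong V Ω h k) (hh : ContinuousOn h Ω) (h0 : ∀ p ∈ Ω, h p ≠ 0) :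
    HasContDerivAlong V Ω (fun p => Real.log (h p)) (fun p => k p / h p) := by
  refine ⟨hk.1.div hh h0, ?_⟩
  rintro _ hp γ a b τ hγ hτ rfl
  exact (hk.2 _ hp γ a b τ hγ hτ rfl).log (h0 _ hp)

lemma IsCharCoords.hasDerivAt_angle {Ψ : OpenPartialHomeomorph Plane Plane} {f g : Plane → ℝ}
    (hΨ : IsCharCoords Ω u F Ψ f g) (hns : Nonsingular Ω u F) {U : Set Plane} (hU : IsOpen U)
    {θ : Plane → ℝ} (hθ : IsAngleOn u F U θ) (hθ₁ : ContDiffOn ℝ 1 θ U) {p : Plane}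
    (hp : p ∈ U ∩ Ψ.source) :
    HasDerivAt (fun t => θ (Ψ.symm ((Ψ p).1, t)))
      ((g p * lenD u F p)⁻¹ * divP (normalPerp u F) p) (Ψ p).2 := by
  have hd : HasFDerivAt θ (fderiv ℝ θ p) (Ψ.symm ((Ψ p).1, (Ψ p).2)) := by
    rw [Prod.mk.eta, Ψ.left_inv hp.2]
    exact ((hθ₁.differentiableOn one_ne_zero).differentiableAt (hU.mem_nhds hp.1)).hasFDerivAt
  refine (hd.comp_hasDerivAt (Ψ p).2 (hasDerivAt_right_of_columnsP
    (hΨ.hasFDerivAt_symm hns (Ψ.map_source hp.2)))).congr_deriv ?_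
  rw [Ψ.left_inv hp.2, map_smul, fderiv_angle_apply hU hθ.2 hθ₁ hp.1]
  rfl

end Solution

end Development

theorem theoremD_general (Ω : Set Plane) (hΩo : IsOpen Ω)
    (u : Plane → ℝ) (F : Plane → Plane) (H : Plane → ℝ)
    (hu : ContDiffOn ℝ 1 u Ω) (hF : ContDiffOn ℝ 1 F Ω) (hH : ContinuousOn H Ω)
    (hns : Nonsingular Ω u F) (hweak : IsWeakSolution Ω u F H)
    (hNH : ∃ NH : Plane → ℝ, HasContDerivAlong (normalN u F) Ω H NH) :
    (∀ p ∈ Ω, ∃ (U : Set Plane) (θ : Plane → ℝ), IsOpen U ∧ p ∈ U ∧ U ⊆ Ω ∧ IsAngleOn u F U θ) ∧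
    (∀ (U : Set Plane) (θ : Plane → ℝ), IsOpen U → U ⊆ Ω → IsAngleOn u F U θ →
      ContDiffOn ℝ 1 θ U) ∧
    ContDiffOn ℝ 1 (normalN u F) Ω ∧
    (∀ p ∈ Ω, ∃ (γ : ℝ → Plane) (a b τ : ℝ), IsCharCurve Ω u F γ a b ∧ τ ∈ Ioo a b ∧ γ τ = p) ∧
    (∀ p ∈ Ω, ∃ (γ : ℝ → Plane) (a b τ : ℝ), IsSeedCurve Ω u F γ a b ∧ τ ∈ Ioo a b ∧ γ τ = p) ∧
    (∀ (γ : ℝ → Plane) (a b : ℝ), IsCharCurve Ω u F γ a b → ContDiffOn ℝ 2 γ (Ioo a b)) ∧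
    (∀ (γ : ℝ → Plane) (a b : ℝ), IsSeedCurve Ω u F γ a b → ContDiffOn ℝ 2 γ (Ioo a b)) ∧
    (∀ p ∈ Ω, ∃ (Ψ : OpenPartialHomeomorph Plane Plane) (f g : Plane → ℝ),
      p ∈ Ψ.source ∧ IsCharCoords Ω u F Ψ f g) ∧
    (∃ ND NlogD : Plane → ℝ,
      HasContDerivAlong (normalPerp u F) Ω (lenD u F) ND ∧
      HasContDerivAlong (normalPerp u F) Ω (fun p => Real.log (lenD u F p)) NlogD ∧
      ∀ (Ψ : OpenPartialHomeomorph Plane Plane) (f g : Plane → ℝ), IsCharCoords Ω u F Ψ f g →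
        ∀ (U : Set Plane) (θ : Plane → ℝ), IsOpen U → U ⊆ Ω → IsAngleOn u F U θ →
          ∀ p ∈ U ∩ Ψ.source,
            HasDerivAt (fun t => θ (Ψ.symm ((Ψ p).1, t)))
              (rotP F p / (g p * lenD u F p ^ 2) - NlogD p / (g p * lenD u F p)) (Ψ p).2 ∧
            rotP F p / (g p * lenD u F p ^ 2) - NlogD p / (g p * lenD u F p)
              = 1 / (g p * lenD u F p ^ 2) * (rotP F p - ND p)) := by
  obtain ⟨NH, hNH⟩ := hNH
  have hdiv : HasUniformDiv Ω (normalN u F) H :=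
    HasWeakDiv.hasUniformDiv hΩo hweak (continuousOn_normalN hΩo hu hF hns) hH
  have hD := continuousOn_lenD hΩo hu hF
  have hcoords := fun p (hp : p ∈ Ω) => exists_isCharCoords hΩo hu hF hns hdiv hp
  have hN := contDiffOn_normalN_of_hasUniformDiv hΩo hu hF hns hdiv hNH
  have hND := hasContDerivAlong_lenD hΩo hu hF hns hdiv hN
  have hangle {U θ} (hU : IsOpen U) (hUΩ : U ⊆ Ω) (hθ : IsAngleOn u F U θ) : ContDiffOn ℝ 1 θ U :=
    contDiffOn_angle hU hθ.2 (hN.mono hUΩ) hθ.1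
  refine ⟨fun p hp => exists_continuousOn_angle hΩo hN.continuousOn
      (fun q hq => normalN_sq_add_sq hns hq) hp, fun U θ => hangle, hN, fun p hp => ?_,
    fun p hp => ?_, fun γ a b hγ => hγ.contDiffOn_two (contDiffOn_normalPerp hN),
    fun γ a b hγ => hγ.contDiffOn_two hN, fun p hp => ?_, _, _, hND,
    hND.log hD fun p hp => (lenD_pos hns hp).ne', fun Ψ f g hΨ U θ hU hUΩ hθ p hp => ?_⟩
  · obtain ⟨Ψ, f, g, hpΨ, hΨ, -⟩ := hcoords p hp
    exact hΨ.exists_isCharCurve hns hpΨ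
  · obtain ⟨Ψ, f, g, hpΨ, hΨ, -⟩ := hcoords p hp
    exact hΨ.exists_isSeedCurve hns hD hpΨ
  · obtain ⟨Ψ, f, g, hpΨ, hΨ, -⟩ := hcoords p hp
    exact ⟨Ψ, f, g, hpΨ, hΨ⟩
  · have hg := (hΨ.g_pos p hp.2).ne'
    have hDp := (lenD_pos hns (hUΩ hp.1)).ne'
    exact ⟨(hΨ.hasDerivAt_angle hns hU hθ (hangle hU hUΩ hθ) hp).congr_deriv
      (by field_simp; ring), by field_simp⟩

theorem theoremD (Ω : Set Plane) (hΩo : IsOpen Ω) (hΩc : IsConnected Ω)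
    (u : Plane → ℝ) (F : Plane → Plane) (H : Plane → ℝ)
    (hu : ContDiffOn ℝ 1 u Ω) (hF : ContDiffOn ℝ 1 F Ω) (hH : ContinuousOn H Ω)
    (hns : Nonsingular Ω u F) (hweak : IsWeakSolution Ω u F H)
    (hNH : ∃ NH : Plane → ℝ, HasContDerivAlong (normalN u F) Ω H NH) :
    -- angle functions exist near every point, and each of them is of class C¹, as is the normal
    (∀ p ∈ Ω, ∃ (U : Set Plane) (θ : Plane → ℝ), IsOpen U ∧ p ∈ U ∧ U ⊆ Ω ∧ IsAngleOn u F U θ) ∧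
    (∀ (U : Set Plane) (θ : Plane → ℝ), IsOpen U → U ⊆ Ω → IsAngleOn u F U θ →
      ContDiffOn ℝ 1 θ U) ∧
    ContDiffOn ℝ 1 (normalN u F) Ω ∧
    -- characteristic and seed curves pass through every point, and all of them are of class C²
    (∀ p ∈ Ω, ∃ (γ : ℝ → Plane) (a b τ : ℝ), IsCharCurve Ω u F γ a b ∧ τ ∈ Ioo a b ∧ γ τ = p) ∧
    (∀ p ∈ Ω, ∃ (γ : ℝ → Plane) (a b τ : ℝ), IsSeedCurve Ω u F γ a b ∧ τ ∈ Ioo a b ∧ γ τ = p) ∧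
    (∀ (γ : ℝ → Plane) (a b : ℝ), IsCharCurve Ω u F γ a b → ContDiffOn ℝ 2 γ (Ioo a b)) ∧
    (∀ (γ : ℝ → Plane) (a b : ℝ), IsSeedCurve Ω u F γ a b → ContDiffOn ℝ 2 γ (Ioo a b)) ∧
    -- characteristic coordinates exist near every point
    (∀ p ∈ Ω, ∃ (Ψ : OpenPartialHomeomorph Plane Plane) (f g : Plane → ℝ),
      p ∈ Ψ.source ∧ IsCharCoords Ω u F Ψ f g) ∧
    -- the derivatives of D and log D along the characteristic curves exist and are continuous,
    -- and the formula for θ_t holds in all characteristic coordinates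
    (∃ ND NlogD : Plane → ℝ,
      HasContDerivAlong (normalPerp u F) Ω (lenD u F) ND ∧
      HasContDerivAlong (normalPerp u F) Ω (fun p => Real.log (lenD u F p)) NlogD ∧
      ∀ (Ψ : OpenPartialHomeomorph Plane Plane) (f g : Plane → ℝ), IsCharCoords Ω u F Ψ f g →
        ∀ (U : Set Plane) (θ : Plane → ℝ), IsOpen U → U ⊆ Ω → IsAngleOn u F U θ →
          ∀ p ∈ U ∩ Ψ.source,
            HasDerivAt (fun t => θ (Ψ.symm ((Ψ p).1, t)))
              (rotP F p / (g p * lenD u F p ^ 2) - NlogD p / (g p * lenD u F p)) (Ψ p).2 ∧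
            rotP F p / (g p * lenD u F p ^ 2) - NlogD p / (g p * lenD u F p)
              = 1 / (g p * lenD u F p ^ 2) * (rotP F p - ND p)) :=
  theoremD_general Ω hΩo u F H hu hF hH hns hweak hNH
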